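/- Let $L,n,d\ge 1$ be integers. Place a qudit of local dimension $d$ at each site $(i,j)\in[L]\times[n+1]$ of a grid with $L$ columns and $n+1$ rows; the Hilbert space is $(\mathbb C^d)^{\otimes L(n+1)}$. Consider a Hamiltonian $H_0=\sum_{i=1}^{L-1}\sum_{j=1}^{n}h_{ij}$, where each $h_{ij}$ is an orthogonal projector that acts nontrivially only on the qudits of the plaquette $\{i,i+1\}\times\{j,j+1\}$. For a positive semidefinite operator $M$ let $\mathrm{gap}(M)$ be its smallest nonzero eigenvalue (with $\mathrm{gap}(0)=+\infty$), and define the local gap $\gamma=\min_{S\subseteq[L-1]\times[n]}\mathrm{gap}\big(\sum_{(i,j)\in S}h_{ij}\big)$. Assume that $H_0$ is frustration-free with a unique ground state, i.e. its null space is spanned by a single unit vector $|\Omega\rangle$. For $1\le c<L$, the entanglement entropy of $|\Omega\rangle$ across the vertical cut between columns $c$ and $c+1$ is $-\mathrm{tr}(\rho\log\rho)$, where $\rho$ is the reduced density matrix of $|\Omega\rangle\langle\Omega|$ on columns $1,\dots,c$ and $\log$ is the natural logarithm. Theorem. If $\gamma=\Omega(1)$ and $d=O(1)$, then the entanglement entropy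 of $|\Omega\rangle$ across the cut is at most $n^{1+O((\log n)^{-1/5})}$. Explicitly: for every $\gamma_0>0$ and $d_0\in\mathbb N$ there are constants $C$ and $n_0$, depending only on $\gamma_0$ and $d_0$, such that for all $n\ge n_0$, all $L$, all $d\le d_0$, all $1\le c<L$, and every such Hamiltonian with local gap $\gamma\ge\gamma_0$, the entanglement entropy of $|\Omega\rangle$ across the cut is at most $n^{1+C(\log n)^{-1/5}}$. -/

import Mathlib

namespace AreaLaw2D

/-- Sites of the grid with `L` columns and `n + 1` rows, as (column, row) pairs (0-indexed). -/
abbrev Site (L n : ℕ) : Type := Fin L × Fin (n + 1)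

/-- Product-basis labels: an element of `{0, …, d - 1}` at every site. -/
abbrev Config (L n d : ℕ) : Type := Site L n → Fin d

/-- The Hilbert space `(ℂ^d)^{⊗ L(n+1)}`, in coordinates with respect to the orthonormal
product basis. -/
abbrev State (L n d : ℕ) : Type := EuclideanSpace ℂ (Config L n d)

/-- Operators on the Hilbert space, as matrices in the product basis. -/
abbrev Op (L n d : ℕ) : Type := Matrix (Config L n d) (Config L n d) ℂ

/-- The plaquette `{i, i+1} × {j, j+1}`. -/
def plaquette (L n i j : ℕ) : Set (Site L n) :=
  {s | (s.1.val = i ∨ s.1.val = i + 1) ∧ (s.2.val = j ∨ s.2.val = j + 1)}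

open Classical in
/-- `M = A ⊗ 1` for an operator `A` on the qudits in `X` and the identity on all other qudits. -/
def ActsOnlyOn {L n d : ℕ} (M : Op L n d) (X : Set (Site L n)) : Prop :=
  ∃ A : Matrix (X → Fin d) (X → Fin d) ℂ, ∀ σ τ : Config L n d,
    M σ τ = if (∀ s, s ∉ X → σ s = τ s) then A (fun s => σ s) (fun s => τ s) else 0

/-- One operator for each plaquette, each an orthogonal projector acting nontrivially only on
the four qudits of its plaquette. -/
structure IsPlaquetteProjectors {L n d : ℕ} (h : Fin (L - 1) → Fin n → Op L n d) : Prop where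
  isHermitian : ∀ i j, (h i j).IsHermitian
  mul_self : ∀ i j, h i j * h i j = h i j
  actsOnlyOn : ∀ i j, ActsOnlyOn (h i j) (plaquette L n i j)

/-- The sum of the local terms in `S`. -/
def partialHamiltonian {L n d : ℕ} (h : Fin (L - 1) → Fin n → Op L n d)
    (S : Finset (Fin (L - 1) × Fin n)) : Op L n d :=
  ∑ p ∈ S, h p.1 p.2

/-- The full Hamiltonian `∑ i, ∑ j, h i j`. -/
def hamiltonian {L n d : ℕ} (h : Fin (L - 1) → Fin n → Op L n d) : Op L n d :=
  ∑ i, ∑ j, h i j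

/-- The smallest nonzero eigenvalue of a positive semidefinite operator
(`⊤` for the zero operator, which has none). -/
noncomputable def gap {L n d : ℕ} (M : Op L n d) : EReal :=
  ⨅ (μ : ℝ) (_ : μ ≠ 0)
    (_ : Module.End.HasEigenvalue (Matrix.toEuclideanLin M : State L n d →ₗ[ℂ] State L n d)
      (μ : ℂ)), (μ : EReal)

/-- The local gap: the minimum of the gap over all subsets of the local terms. -/
noncomputable def localGap {L n d : ℕ} (h : Fin (L - 1) → Fin n → Op L n d) : EReal :=
  ⨅ S : Finset (Fin (L - 1) × Fin n), gap (partialHamiltonian h S)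

/-- `Ω` is a unit vector that spans the null space of `H`. -/
def IsUniqueZeroEnergyGroundState {L n d : ℕ} (H : Op L n d) (Ω : State L n d) : Prop :=
  ‖Ω‖ = 1 ∧ LinearMap.ker (Matrix.toEuclideanLin H : State L n d →ₗ[ℂ] State L n d)
    = Submodule.span ℂ {Ω}

/-- The sites in the first `c` columns. -/
abbrev LeftSite (L n c : ℕ) : Type := {s : Site L n // s.1.val < c}

/-- The sites in the remaining columns. -/
abbrev RightSite (L n c : ℕ) : Type := {s : Site L n // ¬ s.1.val < c}

/-- The amplitudes of `ψ` as a (left configuration) × (right configuration) matrix. -/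
def amplitudeMatrix {L n d : ℕ} (c : ℕ) (ψ : State L n d) :
    Matrix (LeftSite L n c → Fin d) (RightSite L n c → Fin d) ℂ :=
  Matrix.of fun a b =>
    ψ ((Equiv.piEquivPiSubtypeProd (fun s : Site L n => s.1.val < c) (fun _ => Fin d)).symm (a, b))

/-- The reduced density matrix on the left region: the partial trace of `|ψ⟩⟨ψ|` over the
right region. -/
noncomputable def reducedState {L n d : ℕ} (c : ℕ) (ψ : State L n d) :
    Matrix (LeftSite L n c → Fin d) (LeftSite L n c → Fin d) ℂ :=
  Matrix.of fun a a' =>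
    ∑ b, amplitudeMatrix c ψ a b * star (amplitudeMatrix c ψ a' b)

theorem reducedState_isHermitian {L n d : ℕ} (c : ℕ) (ψ : State L n d) :
    (reducedState c ψ).IsHermitian :=
  Matrix.isHermitian_mul_conjTranspose_self (amplitudeMatrix c ψ)

/-- The entanglement entropy `-tr ρ log ρ` (natural logarithm) across the cut between the
first `c` columns and the others. -/
noncomputable def entanglementEntropy {L n d : ℕ} (c : ℕ) (ψ : State L n d) : ℝ :=
  ∑ k, Real.negMulLog ((reducedState_isHermitian c ψ).eigenvalues k)

end AreaLaw2D

namespace AreaLaw2D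

set_option linter.unusedSectionVars false

/-! ### Elementary estimates for orthogonal projections. -/

section Projections

variable {E : Type*} [NormedAddCommGroup E] [InnerProductSpace ℂ E] [CompleteSpace E]

/-! The entropy is controlled by an approximate ground state projection: an operator `K` that fixes
`Ω`, preserves its orthogonal complement and shrinks it by `ε`, and multiplies Schmidt ranks across
the cut by at most `D`. If `2 D ε² ≤ 1`, the entropy is at most `8 log D`
(`entanglementEntropy_le_of_approximate_projection`): the largest Schmidt coefficient is at least `1
/ (2 D)`, and powers of `K` applied to the leading Schmidt term approximate `Ω` by vectors of rank
`D ^ m`. It remains to build `K` with `log D = n ^ (1 + o(1))`, and three mechanisms do this.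

Chebyshev approximation. In a block of `2 l` rows only a strip of `w` columns next to the cut is
kept at full resolution; to its left and right each row is replaced by a single projection. The
detectability lemma (`LocallyGapped.sweep_contracts`) and the local gap keep the gap of this
coarse-grained Hamiltonian bounded below, while its norm is at most `2 l (w + 2)`, independently of
`L`. Hence a polynomial of degree about `r √(l w)` approximates the ground projection of the block
with error `2⁻ʳ`. Thanks to the square root this degree is smaller than `w` once `w` is large
compared with `l r²`.

Merging. Ground projections of overlapping row blocks multiply to that of the union with an error
exponentially small in the overlap (`LocallyGapped.norm_rowBlock_merge_le`). In such a product every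
exact projection is the formal sum `x + (x² - x) + (x³ - x²) + …` of increments of an approximation
`x`; truncating the product at a total order comparable with the number of factors gives a high
power of the old error for words only twice as long. One level of the recursion (`HasApprox.step`)
multiplies the number of rows by `κ`, the word length by `4 κ` and the error exponent by `2 κ`, so
only a factor `2` is lost per level.

Rank. A word of length `M` in polynomials of degree `t` has total degree at most `M t < w (τ + 1)`
in the strip columns, so every monomial uses some column at most `τ` times, and across that column
few products are needed. Formal commuting markers sort the monomials by their first such column
(`exists_light_decomposition`). Moving between that column and the wanted cut costs only `d ^ (w (n
+ 1))` each way.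

With `x = (log n) ^ (1/5)`, `κ ≈ exp (x⁴)`, `j ≈ x` levels and initial exponent `r = κ`, the
recursion covers all rows, and `κ` beats the loss `2 ^ j` and the factor `log n` coming from the
rank. The outcome is `log D = 73 M log n` with `M = (4 κ) ^ j κ ^ 9 = n ^ (1 + O((log n) ^
(-1/5)))`. If fewer than `κ ^ 8` columns lie left of the cut, the dimension bound suffices. -/

theorem starProjection_norm_sq_add {P : E →L[ℂ] E} (hP : IsStarProjection P) (v : E) :
    ‖P v‖ ^ 2 + ‖v - P v‖ ^ 2 = ‖v‖ ^ 2 := by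
  have h1 : inner ℂ (P v) (v - P v) = 0 := by
    have hsa := hP.isSelfAdjoint
    rw [ContinuousLinearMap.isSelfAdjoint_iff'] at hsa
    have : inner ℂ (P v) (v - P v) = inner ℂ v (P (v - P v)) := by
      rw [← ContinuousLinearMap.adjoint_inner_left, hsa]
    rw [this, map_sub]
    have h2 : P (P v) = P v := by
      have := congrArg (fun Q : E →L[ℂ] E => Q v) hP.isIdempotentElem.eq
      simpa using this
    rw [h2, sub_self, inner_zero_right]
  have h2 := norm_add_sq_eq_norm_sq_add_norm_sq_of_inner_eq_zero _ _ h1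
  have h3 : P v + (v - P v) = v := by abel
  rw [h3] at h2
  nlinarith [h2]

theorem starProjection_norm_le {P : E →L[ℂ] E} (hP : IsStarProjection P) (v : E) :
    ‖P v‖ ≤ ‖v‖ := by
  have := starProjection_norm_sq_add hP v
  exact le_of_sq_le_sq (by nlinarith [sq_nonneg ‖v - P v‖]) (norm_nonneg _) |> id

theorem starProjection_norm_compl_le {P : E →L[ℂ] E} (hP : IsStarProjection P) (v : E) :
    ‖v - P v‖ ≤ ‖v‖ := by
  have := starProjection_norm_sq_add hP v
  exact le_of_sq_le_sq (by nlinarith [sq_nonneg ‖P v‖]) (norm_nonneg _) |> id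

theorem starProjection_apply_apply {P : E →L[ℂ] E} (hP : IsStarProjection P) (v : E) :
    P (P v) = P v := by
  have := congrArg (fun Q : E →L[ℂ] E => Q v) hP.isIdempotentElem.eq
  simpa using this

end Projections

/-! ### Ground space projections and the detectability lemma. -/

section Detectability

variable {E : Type*} [NormedAddCommGroup E] [InnerProductSpace ℂ E] [FiniteDimensional ℂ E]
  {ι : Type*}

/-- The common kernel of the terms in `S`. -/
noncomputable def groundSpace (h : ι → E →L[ℂ] E) (S : Set ι) : Submodule ℂ E :=
  ⨅ a ∈ S, LinearMap.ker (h a : E →ₗ[ℂ] E)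

/-- The orthogonal projection onto the common kernel of the terms in `S`. -/
noncomputable def groundProj (h : ι → E →L[ℂ] E) (S : Set ι) : E →L[ℂ] E :=
  (groundSpace h S).starProjection

theorem mem_groundSpace {h : ι → E →L[ℂ] E} {S : Set ι} {v : E} :
    v ∈ groundSpace h S ↔ ∀ a ∈ S, h a v = 0 := by
  simp [groundSpace, Submodule.mem_iInf]

/-- The product of the complementary projections along a list of terms. -/
noncomputable def sweep (h : ι → E →L[ℂ] E) (l : List ι) : E →L[ℂ] E :=
  (l.map fun a => 1 - h a).prod

/-- Projections with local gap `γ`, each of which fails to commute with at most nine others. -/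
structure LocallyGapped (h : ι → E →L[ℂ] E) (γ : ℝ) : Prop where
  proj : ∀ a, IsStarProjection (h a)
  gap : ∀ (S : Finset ι) (v : E), groundProj h (S : Set ι) v = 0 →
    γ * ‖v‖ ^ 2 ≤ ∑ a ∈ S, ‖h a v‖ ^ 2
  degree_le : ∀ (a : ι) (S : Finset ι), (∀ b ∈ S, ¬ Commute (h a) (h b)) → S.card ≤ 9

theorem groundProj_isStarProjection (h : ι → E →L[ℂ] E) (S : Set ι) :
    IsStarProjection (groundProj h S) :=
  isStarProjection_starProjection

theorem groundProj_apply_eq_self_iff {h : ι → E →L[ℂ] E} {S : Set ι} {v : E} :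
    groundProj h S v = v ↔ ∀ a ∈ S, h a v = 0 := by
  rw [groundProj, Submodule.starProjection_eq_self_iff, mem_groundSpace]

theorem term_groundProj_apply {h : ι → E →L[ℂ] E} {S : Set ι} {a : ι} (ha : a ∈ S) (v : E) :
    h a (groundProj h S v) = 0 :=
  mem_groundSpace.1 (Submodule.starProjection_apply_mem _ v) a ha

theorem groundProj_mul_of_subset (h : ι → E →L[ℂ] E) {S S' : Set ι} (hS : S ⊆ S') :
    groundProj h S * groundProj h S' = groundProj h S' := by
  ext v
  exact groundProj_apply_eq_self_iff.2 fun a ha => term_groundProj_apply (hS ha) v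

theorem groundProj_mul_of_superset (h : ι → E →L[ℂ] E) {S S' : Set ι} (hS : S ⊆ S') :
    groundProj h S' * groundProj h S = groundProj h S' := by
  have h1 := congrArg star (groundProj_mul_of_subset h hS)
  rwa [star_mul, (groundProj_isStarProjection h S).isSelfAdjoint.star_eq,
    (groundProj_isStarProjection h S').isSelfAdjoint.star_eq] at h1

theorem groundProj_empty (h : ι → E →L[ℂ] E) : groundProj h ∅ = 1 := by
  ext v
  exact groundProj_apply_eq_self_iff.2 (by simp)

theorem sweep_append (h : ι → E →L[ℂ] E) (l l' : List ι) :
    sweep h (l ++ l') = sweep h l * sweep h l' := by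
  simp [sweep]

theorem sweep_mul_groundProj (h : ι → E →L[ℂ] E) {S : Set ι} {l : List ι}
    (hl : ∀ a ∈ l, a ∈ S) : sweep h l * groundProj h S = groundProj h S := by
  induction l with
  | nil => simp [sweep]
  | cons a l ih =>
    have h1 : sweep h (a :: l) = (1 - h a) * sweep h l := by simp [sweep]
    rw [h1, mul_assoc, ih fun b hb => hl b (List.mem_cons_of_mem _ hb)]
    ext v
    simp [term_groundProj_apply (hl a List.mem_cons_self)]

theorem groundProj_mul_sweep {h : ι → E →L[ℂ] E} (hp : ∀ a, IsStarProjection (h a)) {S : Set ι}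
    {l : List ι} (hl : ∀ a ∈ l, a ∈ S) : groundProj h S * sweep h l = groundProj h S := by
  induction l with
  | nil => simp [sweep]
  | cons a l ih =>
    have h1 : sweep h (a :: l) = (1 - h a) * sweep h l := by simp [sweep]
    have h2 : h a * groundProj h S = 0 := by
      ext v
      simp [term_groundProj_apply (hl a List.mem_cons_self)]
    have h3 : groundProj h S * h a = 0 := by
      have := congrArg star h2
      rwa [star_mul, (groundProj_isStarProjection h S).isSelfAdjoint.star_eq,
        (hp a).isSelfAdjoint.star_eq, star_zero] at this
    rw [h1, ← mul_assoc, mul_sub, h3, mul_one, sub_zero,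
      ih fun b hb => hl b (List.mem_cons_of_mem _ hb)]

/-- The number `x a` is the norm of the component removed when `1 - h a` is applied, so the squares
telescope by Pythagoras. Right after its own step `b` has energy zero; later factors commuting with
`h b` do not raise that energy, and a later non-commuting factor `a` raises it by at most `x a`. -/
theorem exists_sweep_losses [Fintype ι] {h : ι → E →L[ℂ] E} (hp : ∀ a, IsStarProjection (h a))
    (l : List ι) (hl : l.Nodup) (v : E) :
    ∃ x : ι → ℝ, (∀ a, 0 ≤ x a) ∧ (∀ a, a ∉ l → x a = 0) ∧
      ∑ a, x a ^ 2 = ‖v‖ ^ 2 - ‖sweep h l v‖ ^ 2 ∧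
      ∀ b ∈ l, ∃ S : Finset ι, (∀ a ∈ S, ¬ Commute (h b) (h a)) ∧
        ‖h b (sweep h l v)‖ ≤ ∑ a ∈ S, x a := by
  classical
  induction l with
  | nil => exact ⟨0, by simp, by simp, by simp [sweep], by simp⟩
  | cons p l ih =>
    obtain ⟨x, hx0, hxl, hxs, hxb⟩ := ih (List.nodup_cons.1 hl).2
    have hpl : p ∉ l := (List.nodup_cons.1 hl).1
    set u := sweep h l v with hu
    have h1 : sweep h (p :: l) v = u - h p u := by simp [sweep, hu]
    have hge : ∀ a, x a ≤ Function.update x p ‖h p u‖ a := by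
      intro a
      by_cases hap : a = p
      · subst hap; simp [hxl a hpl]
      · simp [Function.update_of_ne hap]
    refine ⟨Function.update x p ‖h p u‖, fun a => (hx0 a).trans (hge a), ?_, ?_, ?_⟩
    · intro a ha
      rw [List.mem_cons, not_or] at ha
      rw [Function.update_of_ne ha.1, hxl a ha.2]
    · have h2 := starProjection_norm_sq_add (hp p) u
      have h3 : ∑ a, Function.update x p ‖h p u‖ a ^ 2 = ∑ a, x a ^ 2 + ‖h p u‖ ^ 2 := by
        have h4 : ∀ a, Function.update x p ‖h p u‖ a ^ 2
            = x a ^ 2 + if a = p then ‖h p u‖ ^ 2 else 0 := by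
          intro a
          by_cases hap : a = p
          · subst hap; simp [hxl a hpl]
          · simp [hap]
        simp [h4, Finset.sum_add_distrib]
      rw [h3, hxs, h1]; linarith
    · intro b hb
      rw [h1]
      by_cases hbp : b = p
      · subst hbp
        refine ⟨∅, by simp, ?_⟩
        simp [map_sub, starProjection_apply_apply (hp b)]
      · have hbl : b ∈ l := by simpa [hbp] using hb
        obtain ⟨S, hS, hbS⟩ := hxb b hbl
        by_cases hc : Commute (h b) (h p)
        · refine ⟨S, hS, ?_⟩
          have h5 : h b (u - h p u) = h b u - h p (h b u) := by
            rw [map_sub]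
            have := congrArg (fun Q : E →L[ℂ] E => Q u) hc.eq
            simp only [mul_apply_eq_comp] at this
            rw [this]
          rw [h5]
          exact (starProjection_norm_compl_le (hp p) _).trans
            (hbS.trans (Finset.sum_le_sum fun a _ => hge a))
        · refine ⟨insert p S, ?_, ?_⟩
          · intro a ha
            rcases Finset.mem_insert.1 ha with rfl | ha
            · exact hc
            · exact hS a ha
          · rw [map_sub]
            refine (norm_sub_le _ _).trans ?_
            have h6 : ‖h b (h p u)‖ ≤ ‖h p u‖ := starProjection_norm_le (hp b) _
            -- The inductive set `S` is not known to lie in `l`, so it may already contain `p`,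
            -- where the old loss is zero.
            by_cases hpS : p ∈ S
            · rw [Finset.insert_eq_of_mem hpS]
              have h7 := Finset.add_sum_erase S (Function.update x p ‖h p u‖) hpS
              have h8 := Finset.add_sum_erase S x hpS
              rw [← h7]; rw [← h8, hxl p hpl] at hbS
              have h9 : ∑ a ∈ S.erase p, x a ≤ ∑ a ∈ S.erase p, Function.update x p ‖h p u‖ a :=
                Finset.sum_le_sum fun a _ => hge a
              simp only [Function.update_self]
              linarith
            · rw [Finset.sum_insert hpS, Function.update_self]
              have h9 : ∑ a ∈ S, x a ≤ ∑ a ∈ S, Function.update x p ‖h p u‖ a :=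
                Finset.sum_le_sum fun a _ => hge a
              linarith

/-- The detectability lemma: sweeping over the terms contracts the complement of the
ground space. -/
theorem LocallyGapped.sweep_contracts [Fintype ι] {h : ι → E →L[ℂ] E} {γ : ℝ}
    (H : LocallyGapped h γ) (l : List ι) (hl : l.Nodup) (v : E)
    (hv : groundProj h {a | a ∈ l} v = 0) :
    (1 + γ / 81) * ‖sweep h l v‖ ^ 2 ≤ ‖v‖ ^ 2 := by
  classical
  obtain ⟨x, hx0, hxl, hxs, hxb⟩ := exists_sweep_losses H.proj l hl v
  choose! S hS hbS using hxb
  set u := sweep h l v with hu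
  have h0 : groundProj h ((l.toFinset : Finset ι) : Set ι) u = 0 := by
    have h1 : ((l.toFinset : Finset ι) : Set ι) = {a | a ∈ l} := by ext; simp
    rw [h1, ← hv, hu, ← mul_apply_eq_comp,
      groundProj_mul_sweep (S := {a | a ∈ l}) H.proj fun a ha => ha]
  have h1 := H.gap l.toFinset u h0
  have h2 : ∀ b ∈ l.toFinset, ‖h b u‖ ^ 2 ≤
      9 * ∑ a, if Commute (h b) (h a) then 0 else x a ^ 2 := by
    intro b hb
    have hb' : b ∈ l := by simpa using hb
    have h3 : (∑ a ∈ S b, x a) ^ 2 ≤ (S b).card * ∑ a ∈ S b, x a ^ 2 :=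
      sq_sum_le_card_mul_sum_sq
    have h4 : ((S b).card : ℝ) ≤ 9 := by exact_mod_cast H.degree_le b (S b) (hS b hb')
    have h5 : ∑ a ∈ S b, x a ^ 2 ≤ ∑ a, if Commute (h b) (h a) then 0 else x a ^ 2 := by
      calc ∑ a ∈ S b, x a ^ 2 = ∑ a ∈ S b, if Commute (h b) (h a) then 0 else x a ^ 2 :=
            Finset.sum_congr rfl fun a ha => by rw [if_neg (hS b hb' a ha)]
        _ ≤ _ := Finset.sum_le_sum_of_subset_of_nonneg (Finset.subset_univ _)
            fun a _ _ => by split_ifs <;> positivity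
    have h6 : ‖h b u‖ ^ 2 ≤ (∑ a ∈ S b, x a) ^ 2 :=
      pow_le_pow_left₀ (norm_nonneg _) (hbS b hb') 2
    have h7 : (0:ℝ) ≤ ∑ a ∈ S b, x a ^ 2 := Finset.sum_nonneg fun a _ => sq_nonneg _
    calc _ ≤ _ := h6
      _ ≤ _ := h3
      _ ≤ 9 * ∑ a ∈ S b, x a ^ 2 := by gcongr
      _ ≤ _ := by gcongr
  -- Double counting: one factor `9` comes from Cauchy–Schwarz over the neighbours of `b`, the other
  -- from the number of `b` that charge the same loss `x a`.
  have h3 : ∑ b ∈ l.toFinset, ‖h b u‖ ^ 2 ≤ 81 * ∑ a, x a ^ 2 := by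
    calc ∑ b ∈ l.toFinset, ‖h b u‖ ^ 2
        ≤ ∑ b ∈ l.toFinset, 9 * ∑ a, (if Commute (h b) (h a) then 0 else x a ^ 2) :=
          Finset.sum_le_sum h2
      _ = 9 * ∑ a, ∑ b ∈ l.toFinset, (if Commute (h b) (h a) then 0 else x a ^ 2) := by
          rw [← Finset.mul_sum, Finset.sum_comm]
      _ ≤ 9 * ∑ a, 9 * x a ^ 2 := by
          gcongr with a
          have h4 : ∑ b ∈ l.toFinset, (if Commute (h b) (h a) then 0 else x a ^ 2)
              = (l.toFinset.filter fun b => ¬ Commute (h b) (h a)).card * x a ^ 2 := by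
            rw [← nsmul_eq_mul, ← Finset.sum_const, Finset.sum_filter]
            exact Finset.sum_congr rfl fun b _ => by split_ifs <;> simp_all
          rw [h4]
          have h5 : (l.toFinset.filter fun b => ¬ Commute (h b) (h a)).card ≤ 9 := by
            refine H.degree_le a _ fun b hb => ?_
            intro hc
            exact (Finset.mem_filter.1 hb).2 hc.symm
          have h6 : ((l.toFinset.filter fun b => ¬ Commute (h b) (h a)).card : ℝ) ≤ 9 := by
            exact_mod_cast h5
          gcongr
      _ = 81 * ∑ a, x a ^ 2 := by rw [← Finset.mul_sum]; ring
  rw [hxs] at h3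
  linarith

end Detectability

theorem pow_mul_eq_of_mul_eq {M : Type*} [Monoid M] {x y : M} (hxy : x * y = y) (k : ℕ) :
    x ^ k * y = y := by
  induction k with
  | zero => simp
  | succ k ih => rw [pow_succ, mul_assoc, hxy, ih]

/-! ### Merging the ground projections of two sets of terms. -/

section Merging

variable {E : Type*} [NormedAddCommGroup E] [InnerProductSpace ℂ E] [FiniteDimensional ℂ E]
  {ι : Type*} [Fintype ι] {h : ι → E →L[ℂ] E} {γ : ℝ}

/-- The contraction factor of the detectability lemma. -/
noncomputable def contraction (γ : ℝ) : ℝ := (Real.sqrt (1 + γ / 81))⁻¹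

theorem contraction_pos (hγ : 0 < γ) : 0 < contraction γ := by
  unfold contraction; positivity

theorem contraction_lt_one (hγ : 0 < γ) : contraction γ < 1 := by
  unfold contraction
  apply inv_lt_one_of_one_lt₀
  rw [Real.lt_sqrt (by norm_num)]
  linarith

theorem LocallyGapped.norm_sweep_le (H : LocallyGapped h γ) (hγ : 0 < γ) (l : List ι)
    (hl : l.Nodup) (v : E) (hv : groundProj h {a | a ∈ l} v = 0) :
    ‖sweep h l v‖ ≤ contraction γ * ‖v‖ := by
  have h1 := H.sweep_contracts l hl v hv
  have h2 : 0 < Real.sqrt (1 + γ / 81) := by positivity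
  rw [contraction, inv_mul_eq_div, le_div_iff₀ h2]
  refine le_of_sq_le_sq ?_ (norm_nonneg _) |> id
  rw [mul_pow, Real.sq_sqrt (by positivity)]
  linarith

theorem norm_groundProj_le (h : ι → E →L[ℂ] E) (S : Set ι) : ‖groundProj h S‖ ≤ 1 :=
  Submodule.starProjection_norm_le _

theorem norm_groundProj_apply_le (h : ι → E →L[ℂ] E) (S : Set ι) (v : E) :
    ‖groundProj h S v‖ ≤ ‖v‖ :=
  starProjection_norm_le (groundProj_isStarProjection h S) v

theorem groundProj_apply_apply_of_subset (h : ι → E →L[ℂ] E) {S S' : Set ι} (hS : S ⊆ S') (v : E) :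
    groundProj h S' (groundProj h S v) = groundProj h S' v := by
  rw [← mul_apply_eq_comp, groundProj_mul_of_superset h hS]

/-- The left projection absorbs a sweep over `S₁` and the right one a sweep over `S₂`, so a full
sweep over the union can be inserted between them for free; it contracts everything orthogonal to
the common ground space. -/
theorem LocallyGapped.norm_groundProj_mul_sub_le (H : LocallyGapped h γ) (hγ : 0 < γ)
    {S₁ S₂ : Set ι} (hS : Disjoint S₁ S₂) :
    ‖groundProj h S₁ * groundProj h S₂ - groundProj h (S₁ ∪ S₂)‖ ≤ contraction γ := by
  classical
  refine ContinuousLinearMap.opNorm_le_bound _ (contraction_pos hγ).le fun v => ?_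
  set G := groundProj h (S₁ ∪ S₂)
  set l₁ := S₁.toFinset.toList
  set l₂ := S₂.toFinset.toList
  have hl₁ : ∀ a ∈ l₁, a ∈ S₁ := by simp [l₁]
  have hl₂ : ∀ a ∈ l₂, a ∈ S₂ := by simp [l₂]
  have hset : {a | a ∈ l₁ ++ l₂} = S₁ ∪ S₂ := by ext; simp [l₁, l₂]
  have hnd : (l₁ ++ l₂).Nodup := by
    refine List.Nodup.append (Finset.nodup_toList _) (Finset.nodup_toList _) ?_
    intro a h1 h2
    exact Set.disjoint_left.1 hS (hl₁ a h1) (hl₂ a h2)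
  set w := groundProj h S₂ (v - G v)
  have hw : groundProj h {a | a ∈ l₁ ++ l₂} w = 0 := by
    rw [hset]
    change groundProj h (S₁ ∪ S₂) (groundProj h S₂ (v - G v)) = 0
    rw [groundProj_apply_apply_of_subset h Set.subset_union_right, map_sub,
      starProjection_apply_apply (groundProj_isStarProjection h _), sub_self]
  have h1 : (groundProj h S₁ * groundProj h S₂ - G) v
      = groundProj h S₁ (sweep h (l₁ ++ l₂) w) := by
    have e1 : groundProj h S₁ * sweep h (l₁ ++ l₂) * groundProj h S₂
        = groundProj h S₁ * groundProj h S₂ := by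
      rw [sweep_append, ← mul_assoc, groundProj_mul_sweep H.proj hl₁, mul_assoc,
        sweep_mul_groundProj h hl₂]
    have e2 : groundProj h S₁ * groundProj h S₂ * G = G := by
      rw [mul_assoc, groundProj_mul_of_subset h Set.subset_union_right,
        groundProj_mul_of_subset h Set.subset_union_left]
    have e3 : groundProj h S₁ * groundProj h S₂ - G
        = groundProj h S₁ * sweep h (l₁ ++ l₂) * groundProj h S₂ * (1 - G) := by
      rw [e1, mul_sub, e2, mul_one]
    rw [e3]
    rfl
  rw [h1]
  calc _ ≤ ‖sweep h (l₁ ++ l₂) w‖ := norm_groundProj_apply_le _ _ _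
    _ ≤ contraction γ * ‖w‖ := H.norm_sweep_le hγ _ hnd _ hw
    _ ≤ contraction γ * ‖v‖ := by
      have := (contraction_pos hγ).le
      gcongr
      exact (norm_groundProj_apply_le _ _ _).trans
        (starProjection_norm_compl_le (groundProj_isStarProjection h _) v)

/-- If the product of two projections is close to the projection `G` onto the intersection, then
vectors orthogonal to the intersection are detected by one of the two. -/
theorem detect_of_norm_mul_sub_le {P₁ P₂ G : E →L[ℂ] E} (h₁ : IsStarProjection P₁)
    {θ : ℝ} (hθ : θ < 1) (hn : ‖P₁ * P₂ - G‖ ≤ θ) {v : E} (hv : G v = 0) :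
    (1 - θ) ^ 2 * ‖v‖ ^ 2 ≤ 5 * (‖v - P₁ v‖ ^ 2 + ‖v - P₂ v‖ ^ 2) := by
  have h1 : ‖P₁ (P₂ v)‖ ≤ θ * ‖v‖ := by
    have h2 := (P₁ * P₂ - G).le_of_opNorm_le hn v
    simpa [hv] using h2
  have h3 : ‖v‖ ≤ ‖P₁ (P₂ v)‖ + ‖v - P₁ v‖ + 2 * ‖v - P₂ v‖ := by
    have e : v = P₁ (P₂ v) + (v - P₁ v) + P₁ (v - P₂ v) := by
      rw [map_sub]; abel
    have e2 := starProjection_norm_le h₁ (v - P₂ v)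
    calc ‖v‖ = ‖P₁ (P₂ v) + (v - P₁ v) + P₁ (v - P₂ v)‖ := by rw [← e]
      _ ≤ ‖P₁ (P₂ v)‖ + ‖v - P₁ v‖ + ‖P₁ (v - P₂ v)‖ := norm_add₃_le
      _ ≤ _ := by nlinarith [norm_nonneg (v - P₂ v)]
  have h4 : (1 - θ) * ‖v‖ ≤ ‖v - P₁ v‖ + 2 * ‖v - P₂ v‖ := by linarith
  have h5 : ((1 - θ) * ‖v‖) ^ 2 ≤ (‖v - P₁ v‖ + 2 * ‖v - P₂ v‖) ^ 2 := by
    have : 0 ≤ 1 - θ := by linarith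
    exact pow_le_pow_left₀ (by positivity) h4 2
  -- The factor `5 = 1² + 2²` is Cauchy–Schwarz for `a + 2 b`.
  nlinarith [sq_nonneg (2 * ‖v - P₁ v‖ - ‖v - P₂ v‖)]

/-- Pythagoras for `P` splits `v - P (Q v)` into `v - P v` and `P (v - Q v)`. When `P` and `Q`
commute, `P * Q` is the projection onto the intersection, so commuting ground projections merge with
no loss of constant. -/
theorem norm_sub_mul_sq_le {P Q : E →L[ℂ] E} (hP : IsStarProjection P) (v : E) :
    ‖v - P (Q v)‖ ^ 2 ≤ ‖v - P v‖ ^ 2 + ‖v - Q v‖ ^ 2 := by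
  have h1 := starProjection_norm_sq_add hP (v - P (Q v))
  have h2 : P (v - P (Q v)) = P (v - Q v) := by
    rw [map_sub, map_sub, starProjection_apply_apply hP]
  have h3 : v - P (Q v) - P (v - P (Q v)) = v - P v := by
    rw [h2, map_sub]; abel
  rw [h3, h2] at h1
  have h4 := starProjection_norm_le hP (v - Q v)
  have := pow_le_pow_left₀ (norm_nonneg _) h4 2
  linarith

theorem groundProj_union_of_commute {S₁ S₂ : Set ι}
    (hc : Commute (groundProj h S₁) (groundProj h S₂)) :
    groundProj h (S₁ ∪ S₂) = groundProj h S₁ * groundProj h S₂ := by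
  have h1 : groundProj h S₁ * groundProj h S₂ * groundProj h (S₁ ∪ S₂)
      = groundProj h (S₁ ∪ S₂) := by
    rw [mul_assoc, groundProj_mul_of_subset h Set.subset_union_right,
        groundProj_mul_of_subset h Set.subset_union_left]
  have h2 : groundProj h (S₁ ∪ S₂) * (groundProj h S₁ * groundProj h S₂)
      = groundProj h S₁ * groundProj h S₂ := by
    ext v
    refine groundProj_apply_eq_self_iff.2 ?_
    rintro a (ha | ha)
    · exact term_groundProj_apply ha _
    · rw [hc.eq]; exact term_groundProj_apply ha _
  rw [← h2, ← mul_assoc, groundProj_mul_of_superset h Set.subset_union_left,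
    groundProj_mul_of_superset h Set.subset_union_right]

theorem norm_sub_groundProj_biUnion_sq_le {κ : Type*} (S : κ → Set ι) (J : Finset κ)
    (hc : ∀ (T : Finset κ) (j : κ), T ⊆ J → j ∈ J → j ∉ T →
      Commute (groundProj h (S j)) (groundProj h (⋃ i ∈ T, S i)))
    (v : E) :
    ‖v - groundProj h (⋃ i ∈ J, S i) v‖ ^ 2 ≤ ∑ j ∈ J, ‖v - groundProj h (S j) v‖ ^ 2 := by
  classical
  induction J using Finset.induction_on with
  | empty => simp [groundProj_empty]
  | insert j J hj ih =>
    rw [Finset.sum_insert hj, Finset.set_biUnion_insert,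
      groundProj_union_of_commute
        (hc J j (Finset.subset_insert _ _) (Finset.mem_insert_self _ _) hj)]
    refine (norm_sub_mul_sq_le (groundProj_isStarProjection h _) v).trans ?_
    have := ih fun T i hT hi hiT =>
      hc T i (hT.trans (Finset.subset_insert _ _)) (Finset.mem_insert_of_mem hi) hiT
    linarith

end Merging

/-! ### Exponentially accurate merging of overlapping row intervals. -/

section Chain

variable {E : Type*} [NormedAddCommGroup E] [InnerProductSpace ℂ E] [FiniteDimensional ℂ E]
  {ι : Type*} [Fintype ι] {h : ι → E →L[ℂ] E} {γ : ℝ} (row : ι → ℕ)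

/-- The terms in the `m` rows starting with row `a`. -/
def rowBlock (a m : ℕ) : Set ι := {i | a ≤ row i ∧ row i < a + m}

open Classical in
/-- The terms in the `m` rows starting with row `a`, ordered by rows. -/
noncomputable def rowList (a m : ℕ) : List ι :=
  (List.range' a m).flatMap fun j => (Finset.univ.filter fun i => row i = j).toList

theorem mem_rowList {a m : ℕ} {i : ι} : i ∈ rowList row a m ↔ i ∈ rowBlock row a m := by
  simp [rowList, rowBlock, List.mem_range'_1]

theorem nodup_rowList (a m : ℕ) : (rowList row a m).Nodup := by
  classical
  rw [rowList, List.nodup_flatMap]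
  refine ⟨fun _ _ => Finset.nodup_toList _, ?_⟩
  refine (List.nodup_range' (s := a) (n := m)).imp ?_
  intro b c hbc i h1 h2
  simp at h1 h2
  exact hbc (h1.symm.trans h2)

theorem rowList_add (a m k : ℕ) :
    rowList row a (m + k) = rowList row a m ++ rowList row (a + m) k := by
  rw [rowList, rowList, rowList, ← List.flatMap_append, List.range'_append_1]

theorem rowBlock_subset {a m a' m' : ℕ} (h1 : a' ≤ a) (h2 : a + m ≤ a' + m') :
    rowBlock row a m ⊆ rowBlock row a' m' := fun i hi => by
  simp only [rowBlock, Set.mem_ofPred_eq] at *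
  omega

theorem commute_sweep {l l' : List ι} (hc : ∀ a ∈ l, ∀ b ∈ l', Commute (h a) (h b)) :
    Commute (sweep h l) (sweep h l') := by
  refine Commute.list_prod_left _ _ fun x hx => Commute.list_prod_right _ _ fun y hy => ?_
  obtain ⟨a, ha, rfl⟩ := List.mem_map.1 hx
  obtain ⟨b, hb, rfl⟩ := List.mem_map.1 hy
  have h1 := hc a ha b hb
  exact (Commute.one_left _).sub_left ((Commute.one_right _).sub_right h1)

variable {row}

/-- A light cone argument: the leftover terms of `s` sweeps lie in the last `s` rows of the left
interval or beyond it. They commute with the rows at distance two below, so the lower part of the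
next sweep moves left and is absorbed by the projection; each sweep costs one row of overlap. -/
theorem exists_groundProj_mul_sweep_pow (hp : ∀ a, IsStarProjection (h a))
    (hc : ∀ i j, row i + 1 < row j → Commute (h i) (h j)) (a x k y s : ℕ) (hs : s ≤ k) :
    ∃ l : List ι, (∀ i ∈ l, a + x + k ≤ row i + s ∧ i ∈ rowBlock row a (x + k + y)) ∧
      groundProj h (rowBlock row a (x + k)) * sweep h (rowList row a (x + k + y)) ^ s
        = groundProj h (rowBlock row a (x + k)) * sweep h l := by
  induction s with
  | zero => exact ⟨[], by simp, by simp [sweep]⟩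
  | succ s ih =>
    obtain ⟨l, hl, he⟩ := ih (by omega)
    set m := x + k - s - 1
    have hm : x + k + y = m + (y + s + 1) := by omega
    refine ⟨l ++ rowList row (a + m) (y + s + 1), ?_, ?_⟩
    · intro i hi
      rcases List.mem_append.1 hi with hi | hi
      · have := hl i hi
        exact ⟨by omega, this.2⟩
      · rw [mem_rowList] at hi
        simp only [rowBlock, Set.mem_ofPred_eq] at hi ⊢
        omega
    · have hcs : Commute (sweep h l) (sweep h (rowList row a m)) := by
        refine commute_sweep fun i hi j hj => (hc j i ?_).symm
        have h1 := (hl i hi).1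
        rw [mem_rowList] at hj
        simp only [rowBlock, Set.mem_ofPred_eq] at hj
        omega
      rw [pow_succ, ← mul_assoc, he]
      conv_lhs => rw [hm, rowList_add, sweep_append]
      rw [sweep_append, mul_assoc, ← mul_assoc (sweep h l), hcs.eq, mul_assoc, ← mul_assoc,
        groundProj_mul_sweep hp]
      intro i hi
      rw [mem_rowList] at hi
      exact rowBlock_subset row le_rfl (by omega) hi

theorem LocallyGapped.norm_sweep_pow_le (H : LocallyGapped h γ) (hγ : 0 < γ) (l : List ι)
    (hl : l.Nodup) (s : ℕ) (v : E) (hv : groundProj h {a | a ∈ l} v = 0) :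
    ‖(sweep h l ^ s) v‖ ≤ contraction γ ^ s * ‖v‖ := by
  induction s generalizing v with
  | zero => simp
  | succ s ih =>
    have h1 : groundProj h {a | a ∈ l} (sweep h l v) = 0 := by
      rw [← mul_apply_eq_comp, groundProj_mul_sweep (S := {a | a ∈ l}) H.proj fun a ha => ha, hv]
    rw [pow_succ, mul_apply_eq_comp]
    refine (ih _ h1).trans ?_
    rw [pow_succ, mul_assoc]
    have := contraction_pos hγ
    gcongr
    exact H.norm_sweep_le hγ l hl v hv

/-- Merging two overlapping intervals of rows. -/
theorem LocallyGapped.norm_rowBlock_merge_le (H : LocallyGapped h γ) (hγ : 0 < γ)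
    (hc : ∀ i j, row i + 1 < row j → Commute (h i) (h j)) (a x k y : ℕ) :
    ‖groundProj h (rowBlock row a (x + k)) * groundProj h (rowBlock row (a + x) (k + y))
      - groundProj h (rowBlock row a (x + k + y))‖ ≤ contraction γ ^ k := by
  have hθ := contraction_pos hγ
  refine ContinuousLinearMap.opNorm_le_bound _ (by positivity) fun v => ?_
  obtain ⟨l, hl, he⟩ := exists_groundProj_mul_sweep_pow H.proj hc a x k y k le_rfl
  set A := groundProj h (rowBlock row a (x + k))
  set B := groundProj h (rowBlock row (a + x) (k + y)) with hB
  set G := groundProj h (rowBlock row a (x + k + y)) with hG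
  set T := sweep h (rowList row a (x + k + y)) with hT
  have hset : {i | i ∈ rowList row a (x + k + y)} = rowBlock row a (x + k + y) := by
    ext i; exact mem_rowList row
  have hAG : A * G = G := groundProj_mul_of_subset h (rowBlock_subset row le_rfl (by omega))
  have hGB : G * B = G := groundProj_mul_of_superset h (rowBlock_subset row (by omega) (by omega))
  have hTG : T * G = G := sweep_mul_groundProj h fun i hi => (mem_rowList row).1 hi
  have hTkG : T ^ k * G = G := pow_mul_eq_of_mul_eq hTG k
  -- After `k` sweeps the leftover lies in the rows from `a + x` on, where `B` absorbs it. Thus `k`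
  -- sweeps fit between `A` and `B`, each contracting by `contraction γ`.
  have h1 : A * T ^ k * B = A * B := by
    rw [he, mul_assoc, sweep_mul_groundProj]
    intro i hi
    have := hl i hi
    simp only [rowBlock, Set.mem_ofPred_eq] at this ⊢
    omega
  have h2 : A * B - G = A * (T ^ k * ((1 - G) * B)) := by
    rw [sub_mul, one_mul, hGB, mul_sub, hTkG, mul_sub, hAG, ← mul_assoc, h1]
  rw [h2]
  have hw : groundProj h {i | i ∈ rowList row a (x + k + y)} (((1 - G) * B) v) = 0 := by
    rw [hset, ← mul_apply_eq_comp, ← mul_assoc, mul_sub, mul_one,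
      (groundProj_isStarProjection h _).isIdempotentElem.eq, sub_self, zero_mul]
    rfl
  calc ‖(A * (T ^ k * ((1 - G) * B))) v‖ ≤ ‖(T ^ k) (((1 - G) * B) v)‖ :=
        norm_groundProj_apply_le _ _ _
    _ ≤ contraction γ ^ k * ‖((1 - G) * B) v‖ :=
        H.norm_sweep_pow_le hγ _ (nodup_rowList row _ _) k _ hw
    _ ≤ contraction γ ^ k * ‖v‖ := by
      gcongr
      exact (starProjection_norm_compl_le (groundProj_isStarProjection h _) (B v)).trans
        (norm_groundProj_apply_le _ _ _)

end Chain

/-! ### Polynomials of a self-adjoint operator and its kernel projection. -/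

section Spectral

open Polynomial

variable {E : Type*} [NormedAddCommGroup E] [InnerProductSpace ℂ E] [FiniteDimensional ℂ E]

theorem aeval_apply_of_apply_eq_smul {T : E →L[ℂ] E} {v : E} {μ : ℂ} (hv : T v = μ • v)
    (p : ℂ[X]) : aeval T p v = p.eval μ • v := by
  induction p using Polynomial.induction_on' with
  | add p q hp hq => simp [hp, hq, add_smul]
  | monomial n a =>
    have h1 : ∀ n : ℕ, (T ^ n) v = μ ^ n • v := by
      intro n
      induction n with
      | zero => simp
      | succ n ih => rw [pow_succ, mul_apply_eq_comp, hv, map_smul, ih, smul_smul, pow_succ']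
    rw [aeval_monomial, eval_monomial, ← Algebra.smul_def]
    simp [h1, smul_smul]

/-- The orthogonal projection onto the kernel of an operator. -/
noncomputable def kerProj (T : E →L[ℂ] E) : E →L[ℂ] E :=
  (LinearMap.ker (T : E →ₗ[ℂ] E)).starProjection

theorem norm_aeval_sub_kerProj_le {T : E →L[ℂ] E} (hT : IsSelfAdjoint T) {p : ℂ[X]}
    (hp0 : p.eval 0 = 1) {ε : ℝ} (hε : 0 ≤ ε)
    (hp : ∀ μ : ℝ, μ ≠ 0 → Module.End.HasEigenvalue (T : E →ₗ[ℂ] E) (μ : ℂ) →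
      ‖p.eval (μ : ℂ)‖ ≤ ε) : ‖aeval T p - kerProj T‖ ≤ ε := by
  have hs : (T : E →ₗ[ℂ] E).IsSymmetric :=
    (ContinuousLinearMap.isSelfAdjoint_iff_isSymmetric).1 hT
  set b := hs.eigenvectorBasis rfl
  set ev := hs.eigenvalues rfl
  have hb : ∀ i, T (b i) = (ev i : ℂ) • b i := fun i => hs.apply_eigenvectorBasis rfl i
  set d : Fin (Module.finrank ℂ E) → ℂ := fun i => if ev i = 0 then 0 else p.eval (ev i : ℂ)
  have hd : ∀ i, ‖d i‖ ≤ ε := by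
    intro i
    simp only [d]
    split_ifs with h0
    · simpa using hε
    · exact hp _ h0 (hs.hasEigenvalue_eigenvalues rfl i)
  have hbd : ∀ i, (aeval T p - kerProj T) (b i) = d i • b i := by
    intro i
    have h1 := aeval_apply_of_apply_eq_smul (hb i) p
    rw [sub_apply, h1]
    simp only [d]
    split_ifs with h0
    · have h2 : kerProj T (b i) = b i := by
        rw [kerProj, Submodule.starProjection_eq_self_iff, LinearMap.mem_ker]
        exact (hb i).trans (by simp [h0])
      rw [h2, h0]
      simp [hp0]
    · have h2 : kerProj T (b i) = 0 := by
        rw [kerProj, Submodule.starProjection_apply_eq_zero_iff, Submodule.mem_orthogonal]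
        intro u hu
        rw [LinearMap.mem_ker] at hu
        have h3 := hs u (b i)
        rw [hu, inner_zero_left] at h3
        change (0:ℂ) = inner ℂ u (T (b i)) at h3
        rw [hb i, inner_smul_right] at h3
        have h4 : (ev i : ℂ) ≠ 0 := by exact_mod_cast h0
        simpa [h4] using h3.symm
      rw [h2, sub_zero]
  refine ContinuousLinearMap.opNorm_le_bound _ hε fun v => ?_
  have hv : (aeval T p - kerProj T) v = ∑ i, (b.repr v i * d i) • b i := by
    conv_lhs => rw [← b.sum_repr v, map_sum]
    refine Finset.sum_congr rfl fun i _ => ?_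
    rw [map_smul, hbd, smul_smul]
  have hr : ∀ i, b.repr ((aeval T p - kerProj T) v) i = b.repr v i * d i := by
    intro i
    rw [hv, OrthonormalBasis.repr_apply_apply, inner_sum]
    simp [inner_smul_right, OrthonormalBasis.inner_eq_ite]
  refine le_of_sq_le_sq ?_ (by positivity) |> id
  rw [← b.repr.norm_map, ← b.repr.norm_map v, mul_pow, EuclideanSpace.norm_sq_eq,
    EuclideanSpace.norm_sq_eq, Finset.mul_sum]
  refine Finset.sum_le_sum fun i _ => ?_
  rw [hr, norm_mul, mul_pow, mul_comm]
  have := hd i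
  gcongr

/-- The polynomial `∏ (1 - X / μ)` over the nonzero eigenvalues gives the kernel projection exactly.
This is how ground projections inherit supports and commutation relations from the terms. -/
theorem kerProj_mem_adjoin {T : E →L[ℂ] E} (hT : IsSelfAdjoint T) :
    kerProj T ∈ Algebra.adjoin ℂ {T} := by
  have hs : (T : E →ₗ[ℂ] E).IsSymmetric :=
    (ContinuousLinearMap.isSelfAdjoint_iff_isSymmetric).1 hT
  classical
  set ev := hs.eigenvalues rfl
  set J := (Finset.univ.image ev).filter (· ≠ 0)
  set p : ℂ[X] := ∏ μ ∈ J, (1 - C ((μ : ℂ)⁻¹) * X)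
  have h1 : p.eval 0 = 1 := by simp [p, eval_prod]
  have h2 := norm_aeval_sub_kerProj_le hT h1 le_rfl (fun μ hμ0 hμ => by
    obtain ⟨i, hi⟩ := hs.exists_eigenvalues_eq rfl hμ
    have h3 : ev i = μ := Complex.ofReal_injective hi
    have h4 : μ ∈ J := by
      simp only [J, Finset.mem_filter, Finset.mem_image, Finset.mem_univ, true_and]
      exact ⟨⟨i, h3⟩, hμ0⟩
    have h5 : (μ : ℂ) ≠ 0 := by exact_mod_cast hμ0
    have h6 : p.eval (μ : ℂ) = 0 := by
      rw [eval_prod]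
      exact Finset.prod_eq_zero h4 (by simp [h5])
    simp [h6])
  have h3 : aeval T p = kerProj T := by
    rw [← sub_eq_zero]
    exact norm_le_zero_iff.1 h2
  rw [← h3]
  exact aeval_mem_adjoin_singleton ℂ T

/-- A lower bound on the nonzero eigenvalues of a positive operator bounds its quadratic form. -/
theorem mul_norm_sq_le_of_eigenvalues {T : E →L[ℂ] E} (hT : IsSelfAdjoint T) {γ : ℝ}
    (hγ : ∀ μ : ℝ, μ ≠ 0 → Module.End.HasEigenvalue (T : E →ₗ[ℂ] E) (μ : ℂ) → γ ≤ μ)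
    {v : E} (hv : kerProj T v = 0) : γ * ‖v‖ ^ 2 ≤ (inner ℂ v (T v)).re := by
  have hs : (T : E →ₗ[ℂ] E).IsSymmetric :=
    (ContinuousLinearMap.isSelfAdjoint_iff_isSymmetric).1 hT
  set b := hs.eigenvectorBasis rfl
  set ev := hs.eigenvalues rfl
  have hb : ∀ i, T (b i) = (ev i : ℂ) • b i := fun i => hs.apply_eigenvectorBasis rfl i
  have hr : ∀ i, b.repr (T v) i = ev i * b.repr v i := fun i =>
    hs.eigenvectorBasis_apply_self_apply rfl v i
  have h1 : inner ℂ v (T v) = ∑ i, (ev i : ℂ) * (‖b.repr v i‖ ^ 2 : ℝ) := by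
    rw [← b.repr.inner_map_map, PiLp.inner_apply]
    refine Finset.sum_congr rfl fun i _ => ?_
    rw [hr]
    simp only [RCLike.inner_apply]
    rw [mul_assoc, Complex.mul_conj, Complex.normSq_eq_norm_sq]
  rw [h1, Complex.re_sum, ← b.repr.norm_map v, EuclideanSpace.norm_sq_eq, Finset.mul_sum]
  refine Finset.sum_le_sum fun i _ => ?_
  rw [← Complex.ofReal_mul, Complex.ofReal_re]
  by_cases h0 : ev i = 0
  · have h2 : b.repr v i = 0 := by
      rw [OrthonormalBasis.repr_apply_apply]
      rw [kerProj, Submodule.starProjection_apply_eq_zero_iff, Submodule.mem_orthogonal] at hv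
      exact hv _ (by rw [LinearMap.mem_ker]; exact (hb i).trans (by simp [h0]))
    simp [h2]
  · have := hγ _ h0 (hs.hasEigenvalue_eigenvalues rfl i)
    gcongr

end Spectral

/-! ### Chebyshev polynomials that are one at zero and small on the spectrum. -/

section Chebyshev

open Polynomial

theorem chebyshev_eval_ge {μ : ℝ} (hμ : 0 ≤ μ) (s : ℕ) :
    1 + (s : ℝ) ^ 2 * μ ≤ (Chebyshev.T ℝ s).eval (1 + μ) := by
  -- The three-term recurrence controls consecutive differences, which grow like `(2 s + 1) μ`; so
  -- value and difference are bounded together.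
  have key : ∀ s : ℕ, 1 + (s : ℝ) ^ 2 * μ ≤ (Chebyshev.T ℝ s).eval (1 + μ) ∧
      (2 * s + 1) * μ ≤ (Chebyshev.T ℝ (s + 1 : ℕ)).eval (1 + μ) - (Chebyshev.T ℝ s).eval (1 + μ) := by
    intro s
    induction s with
    | zero => simp
    | succ s ih =>
      obtain ⟨h1, h2⟩ := ih
      have h3 : (Chebyshev.T ℝ ((s + 1 + 1 : ℕ) : ℤ)).eval (1 + μ)
          = 2 * (1 + μ) * (Chebyshev.T ℝ ((s + 1 : ℕ) : ℤ)).eval (1 + μ)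
            - (Chebyshev.T ℝ (s : ℤ)).eval (1 + μ) := by
        have := Chebyshev.T_add_two ℝ (s : ℤ)
        push_cast
        rw [show ((s : ℤ) + 1 + 1) = s + 2 by ring, this]
        simp
      have hA : 1 + ((s + 1 : ℕ) : ℝ) ^ 2 * μ ≤ (Chebyshev.T ℝ ((s + 1 : ℕ) : ℤ)).eval (1 + μ) := by
        push_cast at h2 ⊢
        nlinarith
      refine ⟨hA, ?_⟩
      rw [h3]
      push_cast at hA h2 ⊢
      have : 0 ≤ ((s : ℝ) + 1) ^ 2 * μ := by positivity
      nlinarith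
  exact (key s).1

/-- A polynomial of degree `s * r` with value `1` at `0` and of size at most `2⁻ʳ` on `[γ, Λ]`. -/
theorem exists_polynomial_small_on_interval {γ Λ : ℝ} (hγ : 0 < γ) (hΛ : γ < Λ) (s r : ℕ)
    (hs : Λ ≤ s ^ 2 * γ) :
    ∃ p : ℂ[X], p.natDegree ≤ s * r ∧ p.eval 0 = 1 ∧
      ∀ x : ℝ, γ ≤ x → x ≤ Λ → ‖p.eval (x : ℂ)‖ ≤ (1 / 2) ^ r := by
  have hd : 0 < Λ - γ := by linarith
  set ℓ : ℝ[X] := C (1 + 2 * γ / (Λ - γ)) - C (2 / (Λ - γ)) * X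
  set τ : ℝ := (Chebyshev.T ℝ s).eval (1 + 2 * γ / (Λ - γ))
  -- The affine map `ℓ` sends `[γ, Λ]` to `[-1, 1]` and `0` to `1 + 2 γ / (Λ - γ)`; degree `s ≈ √(Λ
  -- / γ)` already makes the value there at least `2`.
  have hτ : 2 ≤ τ := by
    have h1 := chebyshev_eval_ge (μ := 2 * γ / (Λ - γ)) (by positivity) s
    have h2 : 1 ≤ (s : ℝ) ^ 2 * (2 * γ / (Λ - γ)) := by
      rw [← mul_div_assoc, le_div_iff₀ hd]
      nlinarith
    linarith
  set q : ℝ[X] := C τ⁻¹ * (Chebyshev.T ℝ s).comp ℓ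
  have hq0 : q.eval 0 = 1 := by
    have : τ ≠ 0 := by linarith
    simp only [q, ℓ, eval_mul, eval_C, eval_comp, eval_sub, eval_X, mul_zero, sub_zero]
    exact inv_mul_cancel₀ this
  have hqx : ∀ x, γ ≤ x → x ≤ Λ → |q.eval x| ≤ 1 / 2 := by
    intro x h1 h2
    simp only [q, ℓ, eval_mul, eval_C, eval_comp, eval_sub, eval_X, abs_mul]
    have h3 : |1 + 2 * γ / (Λ - γ) - 2 / (Λ - γ) * x| ≤ 1 := by
      have e : 1 + 2 * γ / (Λ - γ) - 2 / (Λ - γ) * x = 1 - 2 * ((x - γ) / (Λ - γ)) := by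
        field_simp; ring
      rw [e, abs_le]
      have h4 : 0 ≤ (x - γ) / (Λ - γ) := div_nonneg (by linarith) hd.le
      have h5 : (x - γ) / (Λ - γ) ≤ 1 := by rw [div_le_one hd]; linarith
      constructor <;> linarith
    have h4 := Chebyshev.abs_eval_T_real_le_one (s : ℤ) h3
    have h5 : |τ⁻¹| ≤ 1 / 2 := by
      rw [abs_of_pos (by positivity), inv_eq_one_div]
      exact one_div_le_one_div_of_le (by norm_num) hτ
    exact (mul_le_mul h5 h4 (abs_nonneg _) (by norm_num)).trans (by norm_num)
  have hqd : q.natDegree ≤ s := by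
    refine (natDegree_C_mul_le _ _).trans (natDegree_comp_le.trans ?_)
    have h1 : ℓ.natDegree ≤ 1 := by
      refine (natDegree_sub_le _ _).trans ?_
      simp only [natDegree_C]
      exact max_le (by norm_num) ((natDegree_C_mul_le _ _).trans natDegree_X_le)
    have h2 : (Chebyshev.T ℝ (s : ℤ)).natDegree ≤ s := by
      have := Chebyshev.natDegree_T ℝ (s : ℤ)
      rw [this]; simp
    calc _ ≤ s * 1 := Nat.mul_le_mul h2 h1
      _ = s := mul_one s
  refine ⟨(q ^ r).map (algebraMap ℝ ℂ), ?_, ?_, ?_⟩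
  · refine natDegree_map_le.trans (natDegree_pow_le.trans ?_)
    rw [mul_comm]
    gcongr
  · have h1 := Polynomial.eval_map_apply (p := q ^ r) (algebraMap ℝ ℂ) 0
    rw [map_zero] at h1
    rw [h1, eval_pow, hq0, one_pow, map_one]
  · intro x h1 h2
    have h3 := Polynomial.eval_map_apply (p := q ^ r) (algebraMap ℝ ℂ) x
    have h4 : ((q ^ r).map (algebraMap ℝ ℂ)).eval (x : ℂ) = (((q ^ r).eval x : ℝ) : ℂ) := h3
    rw [h4, Complex.norm_real, eval_pow, norm_pow]
    exact pow_le_pow_left₀ (norm_nonneg _) (hqx x h1 h2) r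

end Chebyshev

/-! ### Counting summands, the form in which ranks are tracked. -/

section SumLE

/-- `x` is a sum of at most `D` elements of `S`. -/
def SumLE {A : Type*} [AddCommMonoid A] (S : Set A) (D : ℕ) (x : A) : Prop :=
  ∃ l : List A, l.length ≤ D ∧ (∀ a ∈ l, a ∈ S) ∧ l.sum = x

namespace SumLE

variable {A A' : Type*} [AddCommMonoid A] [AddCommMonoid A'] {S T : Set A} {S' : Set A'}
  {D D' : ℕ} {x y : A}

theorem zero (S : Set A) (D : ℕ) : SumLE S D 0 := ⟨[], by simp, by simp, by simp⟩

theorem of_mem (hx : x ∈ S) : SumLE S 1 x := ⟨[x], by simp, by simpa using hx, by simp⟩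

theorem mono (hx : SumLE S D x) (hS : S ⊆ T) (hD : D ≤ D') : SumLE T D' x := by
  obtain ⟨l, h1, h2, h3⟩ := hx
  exact ⟨l, h1.trans hD, fun a ha => hS (h2 a ha), h3⟩

theorem add (hx : SumLE S D x) (hy : SumLE S D' y) : SumLE S (D + D') (x + y) := by
  obtain ⟨l, h1, h2, h3⟩ := hx
  obtain ⟨l', h1', h2', h3'⟩ := hy
  refine ⟨l ++ l', by simp; omega, ?_, by simp [h3, h3']⟩
  intro a ha
  rcases List.mem_append.1 ha with ha | ha
  · exact h2 a ha
  · exact h2' a ha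

theorem sum {κ : Type*} (s : Finset κ) (D : κ → ℕ) (x : κ → A)
    (hx : ∀ i ∈ s, SumLE S (D i) (x i)) : SumLE S (∑ i ∈ s, D i) (∑ i ∈ s, x i) := by
  classical
  induction s using Finset.induction_on with
  | empty => simpa using zero S 0
  | insert i s hi ih =>
    rw [Finset.sum_insert hi, Finset.sum_insert hi]
    exact (hx i (Finset.mem_insert_self _ _)).add
      (ih fun j hj => hx j (Finset.mem_insert_of_mem hj))

theorem bind (f : A →+ A') (hx : SumLE S D x) (hf : ∀ a ∈ S, SumLE S' D' (f a)) :
    SumLE S' (D * D') (f x) := by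
  obtain ⟨l, h1, h2, rfl⟩ := hx
  refine mono (D := l.length * D') ?_ subset_rfl (Nat.mul_le_mul_right _ h1)
  clear h1
  induction l with
  | nil => simpa using zero S' 0
  | cons a l ih =>
    rw [List.sum_cons, map_add, List.length_cons, add_mul, one_mul, add_comm (_ * _)]
    exact (hf a (h2 a List.mem_cons_self)).add (ih fun b hb => h2 b (List.mem_cons_of_mem _ hb))

theorem map (f : A →+ A') (hx : SumLE S D x) (hf : ∀ a ∈ S, f a ∈ S') : SumLE S' D (f x) := by
  simpa using hx.bind f fun a ha => of_mem (hf a ha)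

theorem mul {R : Type*} [NonUnitalNonAssocSemiring R] {S S' S'' : Set R} {x y : R}
    (hx : SumLE S D x) (hy : SumLE S' D' y) (hm : ∀ a ∈ S, ∀ b ∈ S', a * b ∈ S'') :
    SumLE S'' (D * D') (x * y) :=
  hx.bind (AddMonoidHom.mulRight y) fun a ha =>
    hy.map (AddMonoidHom.mulLeft a) fun b hb => hm a ha b hb

end SumLE

/-- Scalar multiples of products of at most `m` of the elements `B u`. -/
def words {U A : Type*} [Ring A] [Algebra ℂ A] (B : U → A) (m : ℕ) : Set A :=
  {x | ∃ (c : ℂ) (w : List U), w.length ≤ m ∧ x = c • (w.map B).prod}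

variable {U A : Type*} [Ring A] [Algebra ℂ A] {B : U → A}

theorem words_mono {m m' : ℕ} (hm : m ≤ m') : words B m ⊆ words B m' := by
  rintro x ⟨c, w, hw, rfl⟩
  exact ⟨c, w, hw.trans hm, rfl⟩

theorem words_mul {m m' : ℕ} {x y : A} (hx : x ∈ words B m) (hy : y ∈ words B m') :
    x * y ∈ words B (m + m') := by
  obtain ⟨c, w, hw, rfl⟩ := hx
  obtain ⟨c', w', hw', rfl⟩ := hy
  refine ⟨c * c', w ++ w', by simp; omega, ?_⟩
  rw [List.map_append, List.prod_append, smul_mul_smul_comm]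

theorem one_mem_words (m : ℕ) : (1 : A) ∈ words B m := ⟨1, [], by simp, by simp⟩

theorem SumLE.neg_words {m N : ℕ} {x : A} (hx : SumLE (words B m) N x) :
    SumLE (words B m) N (-x) := by
  refine hx.map (-AddMonoidHom.id A) ?_
  rintro _ ⟨c, w, hw, rfl⟩
  exact ⟨-c, w, hw, by simp⟩

theorem SumLE.pow_words {m N : ℕ} {x : A} (hx : SumLE (words B m) N x) (p : ℕ) :
    SumLE (words B (m * p)) (N ^ p) (x ^ p) := by
  induction p with
  | zero => simpa using SumLE.of_mem (one_mem_words _)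
  | succ p ih =>
    rw [pow_succ, pow_succ, Nat.mul_succ]
    exact ih.mul hx fun a ha b hb => words_mul ha hb

end SumLE

/-! ### Approximating a product of projections from approximations of its factors. -/

section Truncation

variable {U A : Type*} [NormedRing A] [NormedAlgebra ℂ A]

/-- The increments `x, x² - x, x³ - x², …` of the powers of `x`. -/
def powIncr (x : A) (p : ℕ) : A := if p = 0 then x else x ^ (p + 1) - x ^ p

theorem sum_powIncr (x : A) (P : ℕ) : ∑ p ∈ Finset.range (P + 1), powIncr x p = x ^ (P + 1) := by
  induction P with
  | zero => simp [powIncr]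
  | succ P ih => rw [Finset.sum_range_succ, ih]; simp [powIncr]

/-- The part of the ordered product of `∑ p, powIncr (x i) p` over `i < b` of total order at
most `P`. -/
def truncProd (x : ℕ → A) : ℕ → ℕ → A
  | 0, _ => 1
  | b + 1, P => ∑ p ∈ Finset.range (P + 1), truncProd x b (P - p) * powIncr (x b) p

/-- The ordered product of `g i` over `i < b`. -/
def orderedProd (g : ℕ → A) : ℕ → A
  | 0 => 1
  | b + 1 => orderedProd g b * g b

/-- Since `x` fixes `g` on both sides, `x = g + (x - g)` is a sum of two parts that annihilate each
other. Hence `x ^ (p + 1)` tends to `g` geometrically, and the increment of index `p` has size of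
order `δ ^ p`. -/
theorem sub_pow_of_fixed {x g : A} (h1 : x * g = g) (h2 : g * x = g) (h3 : g * g = g) (p : ℕ) :
    (x - g) ^ (p + 1) = x ^ (p + 1) - g := by
  induction p with
  | zero => simp
  | succ p ih =>
    rw [pow_succ, ih, sub_mul, mul_sub, mul_sub, h2, h3, sub_self, sub_zero, ← pow_succ]
    rw [pow_mul_eq_of_mul_eq h1]

theorem norm_powIncr_le {x g : A} (h1 : x * g = g) (h2 : g * x = g) (h3 : g * g = g)
    (hg : ‖g‖ ≤ 1) {δ : ℝ} (hδ1 : δ ≤ 1 / 16) (hx : ‖x - g‖ ≤ δ) (p : ℕ) :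
    ‖powIncr x p‖ ≤ (if p = 0 then 17 / 16 else 2) * δ ^ p := by
  have hδ0 : 0 ≤ δ := (norm_nonneg _).trans hx
  unfold powIncr
  split_ifs with hp
  · subst hp
    have : x = g + (x - g) := by abel
    rw [this, pow_zero, mul_one]
    exact (norm_add_le _ _).trans (by linarith)
  · obtain ⟨p, rfl⟩ := Nat.exists_eq_succ_of_ne_zero hp
    have e : x ^ (p + 1 + 1) - x ^ (p + 1) = (x - g) ^ (p + 1 + 1) - (x - g) ^ (p + 1) := by
      rw [sub_pow_of_fixed h1 h2 h3, sub_pow_of_fixed h1 h2 h3]; abel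
    rw [Nat.succ_eq_add_one, e]
    have h4 : ∀ q, ‖(x - g) ^ (q + 1)‖ ≤ δ ^ (q + 1) := fun q =>
      (norm_pow_le' _ (Nat.succ_pos q)).trans (pow_le_pow_left₀ (norm_nonneg _) hx _)
    have h5 : δ ^ (p + 1 + 1) ≤ δ ^ (p + 1) :=
      pow_le_pow_of_le_one hδ0 (by linarith) (Nat.le_succ _)
    calc _ ≤ ‖(x - g) ^ (p + 1 + 1)‖ + ‖(x - g) ^ (p + 1)‖ := norm_sub_le _ _
      _ ≤ δ ^ (p + 1 + 1) + δ ^ (p + 1) := add_le_add (h4 _) (h4 _)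
      _ ≤ _ := by linarith

theorem norm_orderedProd_le [NormOneClass A] {g : ℕ → A} (hg : ∀ i, ‖g i‖ ≤ 1) (b : ℕ) :
    ‖orderedProd g b‖ ≤ 1 := by
  induction b with
  | zero => simp [orderedProd]
  | succ b ih =>
    rw [orderedProd]
    exact (norm_mul_le _ _).trans (mul_le_one₀ ih (norm_nonneg _) (hg b))

/-- Discarded products of increments have total order at least `P + 1`, hence size of order `δ ^ (P
+ 1)`; the factors `2 ^ b` and `4 ^ (P + 1)` pay for their number. -/
theorem norm_truncProd_sub_le [NormOneClass A] {x g : ℕ → A} (h1 : ∀ i, x i * g i = g i)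
    (h2 : ∀ i, g i * x i = g i) (h3 : ∀ i, g i * g i = g i) (hg : ∀ i, ‖g i‖ ≤ 1) {δ : ℝ}
    (hδ0 : 0 ≤ δ) (hδ1 : δ ≤ 1 / 16) (hx : ∀ i, ‖x i - g i‖ ≤ δ) (b P : ℕ) :
    ‖truncProd x b P - orderedProd g b‖ ≤ 2 ^ b * (4 * δ) ^ (P + 1) := by
  induction b generalizing P with
  | zero => simp [truncProd, orderedProd]; positivity
  | succ b ih =>
    -- The increments up to `P` telescope to `x ^ (P + 1) = g + (x - g) ^ (P + 1)`, which leaves the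
    -- inductive errors and one tail.
    have e : truncProd x (b + 1) P - orderedProd g (b + 1)
        = ∑ p ∈ Finset.range (P + 1), (truncProd x b (P - p) - orderedProd g b) * powIncr (x b) p
          + orderedProd g b * (x b - g b) ^ (P + 1) := by
      rw [sub_pow_of_fixed (h1 b) (h2 b) (h3 b), ← sum_powIncr]
      simp only [sub_mul, mul_sub, Finset.sum_sub_distrib, Finset.mul_sum, truncProd, orderedProd]
      abel
    have hgeo : ∀ n : ℕ, ∑ p ∈ Finset.range n, (1 / 4 : ℝ) ^ p ≤ 4 / 3 := by
      intro n
      have := geom_sum_eq (x := (1 / 4 : ℝ)) (by norm_num) n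
      rw [this]
      have : (0:ℝ) ≤ (1 / 4) ^ n := by positivity
      rw [div_le_iff_of_neg (by norm_num)]
      linarith
    have hterm : ∀ p ∈ Finset.range (P + 1),
        ‖(truncProd x b (P - p) - orderedProd g b) * powIncr (x b) p‖
          ≤ 2 ^ b * (4 * δ) ^ (P + 1) * (2 * (1 / 4) ^ p - if p = 0 then 15 / 16 else 0) := by
      intro p hp
      have hp' : p ≤ P := by simpa [Nat.lt_succ_iff] using hp
      have e1 : (4 * δ) ^ (P + 1) = (4 * δ) ^ (P - p + 1) * (4 ^ p * δ ^ p) := by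
        rw [← mul_pow, ← pow_add]
        congr 1; omega
      have e2 : (2 * (1 / 4 : ℝ) ^ p - if p = 0 then 15 / 16 else 0)
          = (if p = 0 then 17 / 16 else 2) * (1 / 4) ^ p := by
        split_ifs with h
        · subst h; norm_num
        · ring
      have e3 : (4:ℝ) ^ p * (1 / 4) ^ p = 1 := by
        rw [← mul_pow]; norm_num
      calc _ ≤ ‖truncProd x b (P - p) - orderedProd g b‖ * ‖powIncr (x b) p‖ := norm_mul_le _ _
        _ ≤ (2 ^ b * (4 * δ) ^ (P - p + 1)) * ((if p = 0 then 17 / 16 else 2) * δ ^ p) :=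
            mul_le_mul (ih (P - p)) (norm_powIncr_le (h1 b) (h2 b) (h3 b) (hg b) hδ1 (hx b) p)
              (norm_nonneg _) (by positivity)
        _ = (2 ^ b * (4 * δ) ^ (P - p + 1)) * ((if p = 0 then 17 / 16 else 2) * δ ^ p)
              * (4 ^ p * (1 / 4) ^ p) := by rw [e3, mul_one]
        _ = _ := by rw [e1, e2]; ring
    have hlast : ‖orderedProd g b * (x b - g b) ^ (P + 1)‖
        ≤ 2 ^ b * (4 * δ) ^ (P + 1) * (1 / 4) := by
      have h4 : ‖(x b - g b) ^ (P + 1)‖ ≤ δ ^ (P + 1) :=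
        (norm_pow_le' _ (Nat.succ_pos P)).trans (pow_le_pow_left₀ (norm_nonneg _) (hx b) _)
      have h5 : δ ^ (P + 1) ≤ (4 * δ) ^ (P + 1) * (1 / 4) := by
        rw [mul_pow, pow_succ 4 P]
        have : (1:ℝ) ≤ 4 ^ P := one_le_pow₀ (by norm_num)
        have : 0 ≤ δ ^ (P + 1) := by positivity
        nlinarith
      have h6 : (1:ℝ) ≤ 2 ^ b := one_le_pow₀ (by norm_num)
      have h7 : 0 ≤ (4 * δ) ^ (P + 1) * (1 / 4) := by positivity
      calc _ ≤ ‖orderedProd g b‖ * ‖(x b - g b) ^ (P + 1)‖ := norm_mul_le _ _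
        _ ≤ 1 * δ ^ (P + 1) :=
            mul_le_mul (norm_orderedProd_le hg b) h4 (norm_nonneg _) zero_le_one
        _ ≤ _ := by nlinarith
    have hY : (0:ℝ) ≤ 2 ^ b * (4 * δ) ^ (P + 1) := by positivity
    rw [e]
    calc _ ≤ ∑ p ∈ Finset.range (P + 1), ‖(truncProd x b (P - p) - orderedProd g b)
            * powIncr (x b) p‖ + ‖orderedProd g b * (x b - g b) ^ (P + 1)‖ :=
          (norm_add_le _ _).trans (by gcongr; exact norm_sum_le _ _)
      _ ≤ ∑ p ∈ Finset.range (P + 1), 2 ^ b * (4 * δ) ^ (P + 1) *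
            (2 * (1 / 4) ^ p - if p = 0 then 15 / 16 else 0)
            + 2 ^ b * (4 * δ) ^ (P + 1) * (1 / 4) := add_le_add (Finset.sum_le_sum hterm) hlast
      _ = 2 ^ b * (4 * δ) ^ (P + 1) *
            (2 * ∑ p ∈ Finset.range (P + 1), (1 / 4 : ℝ) ^ p - 15 / 16 + 1 / 4) := by
          rw [← Finset.mul_sum, Finset.sum_sub_distrib, ← Finset.mul_sum]
          simp
          ring
      -- The induction closes because `2 · 4/3 - 15/16 + 1/4 < 2`. The sharper bound `17/16` for the
      -- zeroth increment, available since `δ ≤ 1/16`, is essential.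
      _ ≤ 2 ^ b * (4 * δ) ^ (P + 1) * 2 := by
          gcongr
          have := hgeo (P + 1)
          linarith
      _ = _ := by rw [pow_succ]; ring

/-- Increments of positive order kill the common fixed space, so truncation does not disturb it. -/
theorem truncProd_mul_of_fixed {x : ℕ → A} {g : A} (h1 : ∀ i, x i * g = g) (b P : ℕ) :
    truncProd x b P * g = g := by
  induction b generalizing P with
  | zero => simp [truncProd]
  | succ b ih =>
    rw [truncProd, Finset.sum_mul, Finset.sum_eq_single 0]
    · rw [mul_assoc]; simp [powIncr, h1, ih]
    · intro p _ hp
      rw [mul_assoc, powIncr, if_neg hp, sub_mul, pow_mul_eq_of_mul_eq (h1 b),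
        pow_mul_eq_of_mul_eq (h1 b), sub_self, mul_zero]
    · simp

theorem mul_pow_eq_of_mul_eq {M : Type*} [Monoid M] {x y : M} (hxy : y * x = y) (k : ℕ) :
    y * x ^ k = y := by
  induction k with
  | zero => simp
  | succ k ih => rw [pow_succ, ← mul_assoc, ih, hxy]

theorem mul_truncProd_of_fixed {x : ℕ → A} {g : A} (h1 : ∀ i, g * x i = g) (b P : ℕ) :
    g * truncProd x b P = g := by
  induction b generalizing P with
  | zero => simp [truncProd]
  | succ b ih =>
    rw [truncProd, Finset.mul_sum, Finset.sum_eq_single 0]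
    · rw [← mul_assoc]; simp [powIncr, h1, ih]
    · intro p _ hp
      rw [← mul_assoc, ih, powIncr, if_neg hp, mul_sub, mul_pow_eq_of_mul_eq (h1 b),
        mul_pow_eq_of_mul_eq (h1 b), sub_self]
    · simp

theorem sumLE_powIncr {B : U → A} {m N : ℕ} (hN : 1 ≤ N) {x : A} (hx : SumLE (words B m) N x)
    (p : ℕ) : SumLE (words B (m * (p + 1))) (2 * N ^ (p + 1)) (powIncr x p) := by
  unfold powIncr
  split_ifs with hp
  · subst hp
    exact hx.mono (words_mono (by simp)) (by simp; omega)
  · rw [sub_eq_add_neg]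
    refine ((hx.pow_words (p + 1)).add (((hx.pow_words p).mono (words_mono ?_) le_rfl).neg_words)).mono
      subset_rfl ?_
    · gcongr; omega
    · have : N ^ p ≤ N ^ (p + 1) := Nat.pow_le_pow_right hN (Nat.le_succ p)
      omega

/-- An increment of order `p` uses powers of `x` up to `p + 1`, so `b` factors of total order at
most `P` use at most `b + P` copies of the approximations: taking `P` of the size of `b` merely
doubles the length. -/
theorem sumLE_truncProd {B : U → A} {m N : ℕ} (hN : 1 ≤ N) {x : ℕ → A}
    (hx : ∀ i, SumLE (words B m) N (x i)) (b P : ℕ) :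
    SumLE (words B (m * (b + P))) ((4 * N) ^ (b + P)) (truncProd x b P) := by
  induction b generalizing P with
  | zero =>
    exact (SumLE.of_mem (one_mem_words _)).mono subset_rfl (Nat.one_le_pow _ _ (by omega))
  | succ b ih =>
    have h1 : ∀ p ∈ Finset.range (P + 1),
        SumLE (words B (m * (b + 1 + P))) (2 * 4 ^ (b + (P - p)) * N ^ (b + 1 + P))
          (truncProd x b (P - p) * powIncr (x b) p) := by
      intro p hp
      have hp' : p ≤ P := by simpa [Nat.lt_succ_iff] using hp
      refine ((ih (P - p)).mul (sumLE_powIncr hN (hx b) p)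
        fun a ha c hc => words_mul ha hc).mono (words_mono ?_) ?_
      · rw [← mul_add]; exact Nat.mul_le_mul_left _ (by omega)
      · rw [mul_pow, show b + 1 + P = (b + (P - p)) + (p + 1) by omega, pow_add]
        apply le_of_eq; ring
    rw [truncProd]
    refine (SumLE.sum _ _ _ h1).mono subset_rfl ?_
    rw [← Finset.sum_mul, mul_pow]
    gcongr
    have h2 : ∀ P : ℕ, ∑ p ∈ Finset.range (P + 1), 2 * 4 ^ (b + (P - p)) ≤ 4 ^ (b + 1 + P) := by
      intro P
      have h3 := Finset.sum_range_reflect (fun p => 2 * 4 ^ (b + p)) (P + 1)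
      simp only [Nat.add_sub_cancel] at h3
      rw [show (∑ p ∈ Finset.range (P + 1), 2 * 4 ^ (b + (P - p)))
        = ∑ p ∈ Finset.range (P + 1), 2 * 4 ^ (b + p) from h3]
      clear h3
      induction P with
      | zero =>
        simp [pow_succ]; omega
      | succ P ih2 =>
        rw [Finset.sum_range_succ]
        have e1 : 4 ^ (b + 1 + (P + 1)) = 4 * 4 ^ (b + 1 + P) := by ring
        have e2 : 4 ^ (b + (P + 1)) = 4 ^ (b + 1 + P) := by congr 1; omega
        rw [e1, e2]
        omega
    exact h2 P

end Truncation

/-! ### Recursion from short row blocks to all rows. -/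

section Recursion

variable {U A : Type*} [NormedRing A] [NormedAlgebra ℂ A]

/-- A family `G a m` of projections for the intervals `[a, a + m)` that merge with an error
exponentially small in the overlap. -/
structure MergingFamily (G : ℕ → ℕ → A) (θ : ℝ) : Prop where
  norm_le : ∀ a m, ‖G a m‖ ≤ 1
  mul_left : ∀ a m a' m', a' ≤ a → a + m ≤ a' + m' → G a m * G a' m' = G a' m'
  mul_right : ∀ a m a' m', a' ≤ a → a + m ≤ a' + m' → G a' m' * G a m = G a' m'
  merge : ∀ a x k y, ‖G a (x + k) * G (a + x) (k + y) - G a (x + k + y)‖ ≤ θ ^ k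

/-- Every `G a (2 * l)` is within `δ` of a sum of `N` words of length `m` in the `B u` that
fixes it. -/
def HasApprox (B : U → A) (G : ℕ → ℕ → A) (l m N : ℕ) (δ : ℝ) : Prop :=
  ∀ a, ∃ x, SumLE (words B m) N x ∧ x * G a (2 * l) = G a (2 * l) ∧
    G a (2 * l) * x = G a (2 * l) ∧ ‖x - G a (2 * l)‖ ≤ δ

variable {B : U → A} {G : ℕ → ℕ → A} {θ : ℝ}

theorem MergingFamily.norm_orderedProd_sub_le [NormOneClass A] (hG : MergingFamily G θ)
    (a l b : ℕ) :
    ‖orderedProd (fun i => G (a + i * l) (2 * l)) (b + 1) - G a ((b + 2) * l)‖ ≤ b * θ ^ l := by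
  induction b with
  | zero => simp [orderedProd]
  | succ b ih =>
    set Q := orderedProd (fun i => G (a + i * l) (2 * l)) (b + 1)
    have h1 := hG.merge a ((b + 1) * l) l l
    rw [show (b + 1) * l + l = (b + 2) * l by ring, show l + l = 2 * l by ring,
      show (b + 2) * l + l = (b + 1 + 2) * l by ring] at h1
    have e : orderedProd (fun i => G (a + i * l) (2 * l)) (b + 1 + 1) - G a ((b + 1 + 2) * l)
        = (Q - G a ((b + 2) * l)) * G (a + (b + 1) * l) (2 * l)
          + (G a ((b + 2) * l) * G (a + (b + 1) * l) (2 * l) - G a ((b + 1 + 2) * l)) := by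
      change Q * G (a + (b + 1) * l) (2 * l) - _ = _
      rw [sub_mul]; abel
    rw [e]
    calc _ ≤ ‖(Q - G a ((b + 2) * l)) * G (a + (b + 1) * l) (2 * l)‖ + θ ^ l :=
          (norm_add_le _ _).trans (add_le_add le_rfl h1)
      _ ≤ b * θ ^ l * 1 + θ ^ l := by
          gcongr
          exact (norm_mul_le _ _).trans
            (mul_le_mul ih (hG.norm_le _ _) (norm_nonneg _) ((norm_nonneg _).trans ih))
      _ = _ := by push_cast; ring

/-- An interval of length `2 κ l` is covered by `2 κ - 1` intervals of length `2 l` with overlaps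
`l`. Truncating at order `2 κ - 1` gives length below `4 κ` and error exponent `2 κ`, next to the
merging error of at most `2 κ` terms `θ ^ l`. -/
theorem HasApprox.step [NormOneClass A] (hG : MergingFamily G θ) {l m N κ : ℕ} (hκ : 1 ≤ κ)
    (hN : 1 ≤ N) {δ : ℝ} (hδ0 : 0 ≤ δ) (hδ : δ ≤ 1 / 16) (hB : HasApprox B G l m N δ) :
    HasApprox B G (κ * l) (4 * κ * m) ((4 * N) ^ (4 * κ))
      (2 * κ * θ ^ l + 2 ^ (2 * κ) * (4 * δ) ^ (2 * κ)) := by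
  intro a
  choose x hx1 hx2 hx3 hx4 using hB
  set y : ℕ → A := fun i => x (a + i * l)
  obtain ⟨b, hb⟩ : ∃ b, 2 * κ = b + 2 := ⟨2 * κ - 2, by omega⟩
  have hlen : 2 * (κ * l) = (b + 2) * l := by rw [← hb]; ring
  have hθl : 0 ≤ θ ^ l := (norm_nonneg _).trans (hG.merge 0 0 l 0)
  have hsub : ∀ i, i < b + 1 → G (a + i * l) (2 * l) * G a ((b + 2) * l) = G a ((b + 2) * l) ∧
      G a ((b + 2) * l) * G (a + i * l) (2 * l) = G a ((b + 2) * l) := by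
    intro i hi
    have : a + i * l + 2 * l ≤ a + (b + 2) * l := by
      have : (i + 2) * l ≤ (b + 2) * l := Nat.mul_le_mul_right _ (by omega)
      nlinarith
    exact ⟨hG.mul_left _ _ _ _ (by omega) this, hG.mul_right _ _ _ _ (by omega) this⟩
  -- The invariance lemmas quantify over all factors, but only the first `b + 1` blocks lie inside
  -- the large interval; the others are replaced by `1`.
  set z : ℕ → A := fun i => if i < b + 1 then y i else 1
  have hz : ∀ n ≤ b + 1, ∀ P, truncProd z n P = truncProd y n P := by
    intro n
    induction n with
    | zero => intro _ P; rfl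
    | succ n ih =>
      intro hn P
      have : z n = y n := if_pos (by omega)
      simp only [truncProd, this]
      exact Finset.sum_congr rfl fun p _ => by rw [ih (by omega)]
  refine ⟨truncProd y (b + 1) (b + 1), ?_, ?_, ?_, ?_⟩
  · refine (sumLE_truncProd hN (fun i => hx1 _) _ _).mono (words_mono ?_) ?_
    · rw [mul_comm (4 * κ)]; gcongr; omega
    · exact Nat.pow_le_pow_right (by omega) (by omega)
  · rw [hlen, ← hz _ le_rfl]
    refine truncProd_mul_of_fixed (fun i => ?_) _ _
    simp only [z]
    split_ifs with hi
    · rw [← (hsub i hi).1, ← mul_assoc, hx2]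
    · simp
  · rw [hlen, ← hz _ le_rfl]
    refine mul_truncProd_of_fixed (fun i => ?_) _ _
    simp only [z]
    split_ifs with hi
    · rw [← (hsub i hi).2, mul_assoc, hx3]
    · simp
  · rw [hlen]
    have h1 := norm_truncProd_sub_le (x := y) (g := fun i => G (a + i * l) (2 * l))
      (fun i => hx2 _) (fun i => hx3 _) (fun i => hG.mul_left _ _ _ _ le_rfl le_rfl)
      (fun i => hG.norm_le _ _) hδ0 hδ (fun i => hx4 _) (b + 1) (b + 1)
    have h2 := hG.norm_orderedProd_sub_le a l b
    calc _ ≤ ‖truncProd y (b + 1) (b + 1) - orderedProd (fun i => G (a + i * l) (2 * l)) (b + 1)‖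
          + ‖orderedProd (fun i => G (a + i * l) (2 * l)) (b + 1) - G a ((b + 2) * l)‖ :=
          norm_sub_le_norm_sub_add_norm_sub _ _ _
      _ ≤ 2 ^ (b + 1) * (4 * δ) ^ (b + 1 + 1) + b * θ ^ l := add_le_add h1 h2
      _ ≤ 2 ^ (2 * κ) * (4 * δ) ^ (2 * κ) + 2 * κ * θ ^ l := by
          rw [show b + 1 + 1 = 2 * κ by omega]
          have hbκ : (b : ℝ) ≤ 2 * κ := by
            have : b ≤ 2 * κ := by omega
            exact_mod_cast this
          have : (2:ℝ) ^ (b + 1) ≤ 2 ^ (2 * κ) := pow_le_pow_right₀ (by norm_num) (by omega)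
          gcongr
      _ = _ := add_comm _ _

theorem HasApprox.mono {l m N m' N' : ℕ} {δ δ' : ℝ} (hB : HasApprox B G l m N δ) (hm : m ≤ m')
    (hN : N ≤ N') (hδ : δ ≤ δ') : HasApprox B G l m' N' δ' := by
  intro a
  obtain ⟨x, h1, h2, h3, h4⟩ := hB a
  exact ⟨x, h1.mono (words_mono hm) hN, h2, h3, h4.trans hδ⟩

/-- The normalisations `δ = u / 16` and `16 N` make the recursion close. The truncation error is `(u
/ 2) ^ (2 κ) ≤ u ^ (2 κ) / 64` and the merging error at most `u ^ (2 κ) / 32`, below `u ^ (2 κ) /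
16` together; and `16 (4 N) ^ (4 κ) ≤ (16 N) ^ (4 κ)`. -/
theorem HasApprox.iterate [NormOneClass A] (hG : MergingFamily G θ) {l r κ : ℕ} (hκ : 3 ≤ κ)
    (hB : HasApprox B G l 1 1 ((1 / 2) ^ r / 16)) (j : ℕ)
    (hj : ∀ i < j, 64 * κ * θ ^ (κ ^ i * l) ≤ (1 / 2) ^ (r * (2 * κ) ^ (i + 1))) :
    ∃ N, 1 ≤ N ∧ 16 * N ≤ 16 ^ (4 * κ) ^ j ∧
      HasApprox B G (κ ^ j * l) ((4 * κ) ^ j) N ((1 / 2) ^ (r * (2 * κ) ^ j) / 16) := by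
  induction j with
  | zero => exact ⟨1, le_rfl, by simp, by simpa using hB⟩
  | succ j ih =>
    obtain ⟨N, hN1, hN2, hA⟩ := ih fun i hi => hj i (hi.trans (Nat.lt_succ_self j))
    refine ⟨(4 * N) ^ (4 * κ), Nat.one_le_pow _ _ (by omega), ?_, ?_⟩
    · have h1 : (16 * N) ^ (4 * κ) ≤ 16 ^ ((4 * κ) ^ j * (4 * κ)) := by
        rw [pow_mul 16]; exact Nat.pow_le_pow_left hN2 _
      have h2 : (16 * N) ^ (4 * κ) = 4 ^ (4 * κ) * (4 * N) ^ (4 * κ) := by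
        rw [← mul_pow]; congr 1; ring
      have h3 : 16 ≤ 4 ^ (4 * κ) := by
        calc 16 = 4 ^ 2 := by norm_num
          _ ≤ _ := Nat.pow_le_pow_right (by norm_num) (by omega)
      rw [pow_succ (4 * κ) j]
      calc _ ≤ 4 ^ (4 * κ) * (4 * N) ^ (4 * κ) := Nat.mul_le_mul_right _ h3
        _ ≤ _ := by rw [← h2]; exact h1
    · set u : ℝ := (1 / 2) ^ (r * (2 * κ) ^ j) with hu
      have hu0 : 0 < u := by positivity
      have hu1 : u ≤ 1 := pow_le_one₀ (by norm_num) (by norm_num)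
      have hA' := hA.step (κ := κ) hG (by omega) hN1 (by positivity) (by linarith)
      have e1 : κ ^ (j + 1) * l = κ * (κ ^ j * l) := by ring
      have e2 : (4 * κ) ^ (j + 1) = 4 * κ * (4 * κ) ^ j := by ring
      have e3 : (1 / 2 : ℝ) ^ (r * (2 * κ) ^ (j + 1)) = u ^ (2 * κ) := by
        rw [hu, ← pow_mul]; congr 1; ring
      rw [e1, e2]
      refine hA'.mono le_rfl le_rfl ?_
      have h1 := hj j (Nat.lt_succ_self j)
      rw [e3] at h1 ⊢
      have h2 : (2:ℝ) ^ (2 * κ) * (4 * (u / 16)) ^ (2 * κ) = (1 / 2) ^ (2 * κ) * u ^ (2 * κ) := by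
        rw [← mul_pow, ← mul_pow]; congr 1; ring
      have h3 : (1 / 2 : ℝ) ^ (2 * κ) ≤ 1 / 64 := by
        calc (1 / 2 : ℝ) ^ (2 * κ) ≤ (1 / 2) ^ 6 :=
              pow_le_pow_of_le_one (by norm_num) (by norm_num) (by omega)
          _ = 1 / 64 := by norm_num
      rw [h2]
      have h4 : 0 ≤ u ^ (2 * κ) := by positivity
      nlinarith

end Recursion

/-! ### Operators with commuting markers that record letter multiplicities. -/

section Graded

open AddMonoidAlgebra Classical

variable {A : Type*} [Ring A] [Algebra ℂ A]

/-- Operators with formal markers that count the occurrences of each letter. -/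
abbrev Marked (A : Type*) [Ring A] : Type _ := AddMonoidAlgebra A (ℕ →₀ ℕ)

/-- The sum of the coefficients whose exponent satisfies `C`. -/
noncomputable def coeffSum (C : (ℕ →₀ ℕ) → Prop) : Marked A →ₗ[ℂ] A :=
  (Finsupp.lsum ℂ fun e => if C e then LinearMap.id else 0) ∘ₗ
    (AddMonoidAlgebra.coeffLinearEquiv ℂ).toLinearMap

theorem coeffSum_single (C : (ℕ →₀ ℕ) → Prop) (e : ℕ →₀ ℕ) (x : A) :
    coeffSum C (single e x) = if C e then x else 0 := by
  have : coeffSum C (single e x)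
      = (Finsupp.lsum ℂ fun e => if C e then LinearMap.id else 0) (Finsupp.single e x) := rfl
  rw [this, Finsupp.lsum_single]
  split_ifs <;> simp

/-- The part of degree `q` in the letter `s`. -/
noncomputable def letterPart (s q : ℕ) : Marked A →ₗ[ℂ] Marked A :=
  (Finsupp.lsum ℂ fun e => if e s = q then AddMonoidAlgebra.lsingle e else 0) ∘ₗ
    (AddMonoidAlgebra.coeffLinearEquiv ℂ).toLinearMap

theorem letterPart_single (s q : ℕ) (e : ℕ →₀ ℕ) (x : A) :
    letterPart s q (single e x) = if e s = q then single e x else 0 := by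
  have : letterPart s q (single e x)
      = (Finsupp.lsum ℂ fun e => if e s = q then AddMonoidAlgebra.lsingle e else 0)
        (Finsupp.single e x) := rfl
  rw [this, Finsupp.lsum_single]
  split_ifs <;> simp

theorem letterPart_mul (s q : ℕ) (F F' : Marked A) :
    letterPart s q (F * F') = ∑ p ∈ Finset.HasAntidiagonal.antidiagonal q,
      letterPart s p.1 F * letterPart s p.2 F' := by
  induction F using AddMonoidAlgebra.induction_linear with
  | zero => simp
  | add f g hf hg => simp [add_mul, hf, hg, Finset.sum_add_distrib]
  | single e x =>
    induction F' using AddMonoidAlgebra.induction_linear with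
    | zero => simp
    | add f g hf hg => simp [mul_add, hf, hg, Finset.sum_add_distrib]
    | single e' x' =>
      simp only [single_mul_single, letterPart_single, ite_mul, zero_mul, mul_ite, mul_zero]
      have hadd : (e + e') s = e s + e' s := rfl
      by_cases h : (e + e') s = q
      · rw [if_pos h, Finset.sum_eq_single (e s, e' s)]
        · simp
        · rintro ⟨i, j⟩ _ hij
          split_ifs with h1 h2 <;> simp_all
        · intro h'; simp at h'; omega
      · rw [if_neg h]
        symm
        refine Finset.sum_eq_zero ?_
        rintro ⟨i, j⟩ hij
        simp at hij
        split_ifs with h1 h2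
        · simp at h1 h2; omega
        · rfl
        · rfl

/-- Marked operators with coefficients in `S` and exponents in `N`. -/
noncomputable def markedSubalgebra (S : Subalgebra ℂ A) (N : AddSubmonoid (ℕ →₀ ℕ)) :
    Subalgebra ℂ (Marked A) where
  carrier := {F | ∀ e, F.coeff e ∈ S ∧ (e ∉ N → F.coeff e = 0)}
  mul_mem' := by
    intro a b ha hb e
    rw [AddMonoidAlgebra.coeff_mul]
    constructor
    · refine Subalgebra.sum_mem _ fun i _ => Subalgebra.sum_mem _ fun j _ => ?_
      simp only
      split_ifs
      · exact S.mul_mem (ha i).1 (hb j).1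
      · exact S.zero_mem
    · intro he
      refine Finset.sum_eq_zero fun i _ => Finset.sum_eq_zero fun j _ => ?_
      simp only
      split_ifs with hij
      · by_cases hi : i ∈ N
        · by_cases hj : j ∈ N
          · exact absurd (hij ▸ N.add_mem hi hj) he
          · rw [(hb j).2 hj, mul_zero]
        · rw [(ha i).2 hi, zero_mul]
      · rfl
  add_mem' := by
    intro a b ha hb e
    refine ⟨S.add_mem (ha e).1 (hb e).1, fun he => ?_⟩
    rw [AddMonoidAlgebra.coeff_add, Finsupp.add_apply, (ha e).2 he, (hb e).2 he, add_zero]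
  algebraMap_mem' := by
    intro r e
    have : (algebraMap ℂ (Marked A) r) = single 0 (algebraMap ℂ A r) := rfl
    rw [this, AddMonoidAlgebra.coeff_single, Finsupp.single_apply]
    split_ifs with h
    · exact ⟨S.algebraMap_mem r, fun he => absurd (h ▸ N.zero_mem) he⟩
    · exact ⟨S.zero_mem, fun _ => rfl⟩

theorem single_mem_markedSubalgebra {S : Subalgebra ℂ A} {N : AddSubmonoid (ℕ →₀ ℕ)}
    {e : ℕ →₀ ℕ} (he : e ∈ N) {x : A} (hx : x ∈ S) : single e x ∈ markedSubalgebra S N := by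
  intro e'
  rw [AddMonoidAlgebra.coeff_single, Finsupp.single_apply]
  split_ifs with h
  · exact ⟨hx, fun h' => absurd (h ▸ he) h'⟩
  · exact ⟨S.zero_mem, fun _ => rfl⟩

theorem eq_sum_single (F : Marked A) : F = ∑ e ∈ F.coeff.support, single e (F.coeff e) :=
  (AddMonoidAlgebra.sum_coeff_single F).symm

theorem commute_of_mem_markedSubalgebra {S S' : Subalgebra ℂ A} {N N' : AddSubmonoid (ℕ →₀ ℕ)}
    (hc : ∀ a ∈ S, ∀ b ∈ S', Commute a b) {F F' : Marked A} (hF : F ∈ markedSubalgebra S N)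
    (hF' : F' ∈ markedSubalgebra S' N') : Commute F F' := by
  rw [eq_sum_single F, eq_sum_single F']
  refine Commute.sum_left _ _ _ fun e _ => Commute.sum_right _ _ _ fun e' _ => ?_
  exact AddMonoidAlgebra.single_commute_single (AddCommute.all _ _) (hc _ (hF e).1 _ (hF' e').1)

theorem coeffSum_mem {S : Subalgebra ℂ A} {N : AddSubmonoid (ℕ →₀ ℕ)} (C : (ℕ →₀ ℕ) → Prop)
    {F : Marked A} (hF : F ∈ markedSubalgebra S N) : coeffSum C F ∈ S := by
  rw [eq_sum_single F, map_sum]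
  refine Subalgebra.sum_mem _ fun e _ => ?_
  rw [coeffSum_single]
  split_ifs
  · exact (hF e).1
  · exact S.zero_mem

/-- A selection rule blind to the markers of the right factor acts on the left factor alone. So
selecting monomials does not destroy a product across a cut. -/
theorem coeffSum_mul {S : Subalgebra ℂ A} {N : AddSubmonoid (ℕ →₀ ℕ)} {C : (ℕ →₀ ℕ) → Prop}
    (hC : ∀ e, ∀ e' ∈ N, C (e + e') ↔ C e) (F : Marked A) {F' : Marked A}
    (hF' : F' ∈ markedSubalgebra S N) :
    coeffSum C (F * F') = coeffSum C F * coeffSum (fun _ => True) F' := by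
  rw [eq_sum_single F']
  simp only [Finset.mul_sum, map_sum]
  refine Finset.sum_congr rfl fun e' he' => ?_
  have hN : e' ∈ N := by
    by_contra h
    exact (Finsupp.mem_support_iff.1 he') ((hF' e').2 h)
  induction F using AddMonoidAlgebra.induction_linear with
  | zero => simp
  | add f g hf hg => simp [add_mul, hf, hg]
  | single e x =>
    rw [single_mul_single, coeffSum_single, coeffSum_single, coeffSum_single]
    simp [hC e e' hN]

/-- The augmentation: forget the markers. -/
noncomputable def unmark : Marked A →ₐ[ℂ] A :=
  AlgHom.ofLinearMap (coeffSum fun _ => True)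
    (by rw [AddMonoidAlgebra.one_def, coeffSum_single]; simp)
    (fun F F' => coeffSum_mul (S := ⊤) (N := ⊤) (by simp) F (fun _ => ⟨trivial, by simp⟩))

theorem unmark_single (e : ℕ →₀ ℕ) (x : A) : unmark (single e x) = x := by
  have : unmark (single e x) = coeffSum (fun _ => True) (single e x) := rfl
  rw [this, coeffSum_single]; simp

end Graded

/-! ### Sums of products of elements of two commuting subalgebras. -/

section Ranks

variable {A : Type*} [Ring A] [Algebra ℂ A]

/-- Products of an element of `S` and an element of `T`. -/
def productSet (S T : Subalgebra ℂ A) : Set A := {x | ∃ a ∈ S, ∃ b ∈ T, x = a * b}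

theorem mem_productSet_left {S T : Subalgebra ℂ A} {a : A} (ha : a ∈ S) : a ∈ productSet S T :=
  ⟨a, ha, 1, T.one_mem, (mul_one a).symm⟩

theorem SumLE.mul_productSet {S T : Subalgebra ℂ A} (hc : ∀ a ∈ S, ∀ b ∈ T, Commute a b)
    {D D' : ℕ} {x y : A} (hx : SumLE (productSet S T) D x) (hy : SumLE (productSet S T) D' y) :
    SumLE (productSet S T) (D * D') (x * y) := by
  refine hx.mul hy ?_
  rintro _ ⟨a, ha, b, hb, rfl⟩ _ ⟨a', ha', b', hb', rfl⟩
  refine ⟨a * a', S.mul_mem ha ha', b * b', T.mul_mem hb hb', ?_⟩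
  have := (hc a' ha' b hb).eq
  rw [mul_assoc, ← mul_assoc b, ← this, mul_assoc, mul_assoc]

theorem SumLE.smul_productSet {S T : Subalgebra ℂ A} {D : ℕ} {x : A} (c : ℂ)
    (hx : SumLE (productSet S T) D x) : SumLE (productSet S T) D (c • x) := by
  refine hx.map (DistribSMul.toAddMonoidHom A c) ?_
  rintro _ ⟨a, ha, b, hb, rfl⟩
  exact ⟨c • a, S.smul_mem ha c, b, hb, by simp⟩

theorem SumLE.add_pow_productSet {S T : Subalgebra ℂ A} (hc : ∀ a ∈ S, ∀ b ∈ T, Commute a b)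
    {a b : A} (ha : a ∈ S) (hb : b ∈ T) (p : ℕ) :
    SumLE (productSet S T) (p + 1) ((a + b) ^ p) := by
  rw [(hc a ha b hb).add_pow]
  have := SumLE.sum (S := productSet S T) (Finset.range (p + 1)) (fun _ => 1)
    (fun m => a ^ m * b ^ (p - m) * (p.choose m : A)) (fun m _ => SumLE.of_mem
      ⟨a ^ m, S.pow_mem ha m, b ^ (p - m) * (p.choose m : A),
        T.mul_mem (T.pow_mem hb _) (natCast_mem T _), by rw [mul_assoc]⟩)
  simpa using this

end Ranks

/-! ### Rank bounds graded by the degree in one letter. -/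

section LetterRank

open AddMonoidAlgebra

variable {A : Type*} [Ring A] [Algebra ℂ A] {S T : Subalgebra ℂ (Marked A)} {s τ β : ℕ}

/-- The part of degree `q ≤ τ` in the letter `s` is a sum of at most `α * β ^ q` products. -/
def LetterRankLE (S T : Subalgebra ℂ (Marked A)) (s τ β α : ℕ) (F : Marked A) : Prop :=
  ∀ q ≤ τ, SumLE (productSet S T) (α * β ^ q) (letterPart s q F)

theorem LetterRankLE.one : LetterRankLE S T s τ β 1 (1 : Marked A) := by
  intro q _
  have : (1 : Marked A) = single 0 1 := rfl
  rw [this, letterPart_single]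
  split_ifs with h
  · simp only [Finsupp.coe_zero, Pi.zero_apply] at h
    subst h
    exact SumLE.of_mem (mem_productSet_left S.one_mem)
  · exact SumLE.zero _ _

/-- Degrees in `s` add, so the powers of `β` combine to `β ^ q`, and a degree `q ≤ τ` splits in at
most `τ + 1` ways. Thus `β` is paid once per occurrence of the letter, not once per factor. -/
theorem LetterRankLE.mul (hc : ∀ a ∈ S, ∀ b ∈ T, Commute a b) {α α' : ℕ} {F F' : Marked A}
    (hF : LetterRankLE S T s τ β α F) (hF' : LetterRankLE S T s τ β α' F') :
    LetterRankLE S T s τ β ((τ + 1) * (α * α')) (F * F') := by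
  intro q hq
  rw [letterPart_mul]
  refine (SumLE.sum _ (fun _ => α * α' * β ^ q) _ fun p hp => ?_).mono subset_rfl ?_
  · have hpq := Finset.HasAntidiagonal.mem_antidiagonal.1 hp
    refine (((hF p.1 (by omega)).mul_productSet hc (hF' p.2 (by omega)))).mono subset_rfl ?_
    rw [← hpq, pow_add]
    apply le_of_eq; ring
  · rw [Finset.sum_const, Finset.Nat.card_antidiagonal, smul_eq_mul, mul_assoc (τ + 1)]
    gcongr

theorem LetterRankLE.sum {κ : Type*} (J : Finset κ) {α : κ → ℕ} {F : κ → Marked A}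
    (hF : ∀ i ∈ J, LetterRankLE S T s τ β (α i) (F i)) :
    LetterRankLE S T s τ β (∑ i ∈ J, α i) (∑ i ∈ J, F i) := by
  intro q hq
  rw [map_sum, Finset.sum_mul]
  exact SumLE.sum _ _ _ fun i hi => hF i hi q hq

theorem LetterRankLE.smul {α : ℕ} {F : Marked A} (c : ℂ) (hF : LetterRankLE S T s τ β α F) :
    LetterRankLE S T s τ β α (c • F) := by
  intro q hq
  rw [map_smul]
  exact (hF q hq).smul_productSet c

theorem LetterRankLE.mono {α α' : ℕ} {F : Marked A} (hF : LetterRankLE S T s τ β α F)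
    (hα : α ≤ α') : LetterRankLE S T s τ β α' F := fun q hq =>
  (hF q hq).mono subset_rfl (Nat.mul_le_mul_right _ hα)

theorem LetterRankLE.list_prod (hc : ∀ a ∈ S, ∀ b ∈ T, Commute a b) {α : ℕ}
    (l : List (Marked A)) (hl : ∀ F ∈ l, LetterRankLE S T s τ β α F) :
    LetterRankLE S T s τ β (((τ + 1) * α) ^ l.length) l.prod := by
  induction l with
  | nil => simpa using LetterRankLE.one
  | cons F l ih =>
    rw [List.prod_cons, List.length_cons]
    refine ((hl F List.mem_cons_self).mul hc
      (ih fun F hF => hl F (List.mem_cons_of_mem _ hF))).mono ?_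
    rw [pow_succ]; apply le_of_eq; ring

/-- `F` is homogeneous of degree `k` in the letter `s`. -/
def LetterHomogeneous (s k : ℕ) (F : Marked A) : Prop :=
  ∀ q, letterPart s q F = if q = k then F else 0

theorem LetterHomogeneous.single {k : ℕ} {e : ℕ →₀ ℕ} (he : e s = k) (x : A) :
    LetterHomogeneous s k (single e x) := by
  intro q
  rw [letterPart_single, he]
  simp [eq_comm]

theorem letterHomogeneous_one (s : ℕ) : LetterHomogeneous s 0 (1 : Marked A) :=
  LetterHomogeneous.single (e := 0) rfl 1

theorem LetterHomogeneous.add {k : ℕ} {F F' : Marked A} (hF : LetterHomogeneous s k F)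
    (hF' : LetterHomogeneous s k F') : LetterHomogeneous s k (F + F') := by
  intro q
  rw [map_add, hF q, hF' q]
  split_ifs <;> simp

theorem LetterHomogeneous.sum {κ : Type*} (J : Finset κ) {k : ℕ} {F : κ → Marked A}
    (hF : ∀ i ∈ J, LetterHomogeneous s k (F i)) : LetterHomogeneous s k (∑ i ∈ J, F i) := by
  intro q
  rw [map_sum, Finset.sum_congr rfl fun i hi => hF i hi q]
  split_ifs <;> simp

theorem letterPart_mul_zero_right {F B : Marked A} (hB : LetterHomogeneous s 0 B) (q : ℕ) :
    letterPart s q (F * B) = letterPart s q F * B := by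
  rw [letterPart_mul, Finset.sum_eq_single (q, 0)]
  · simp [hB 0]
  · rintro ⟨i, j⟩ hij hne
    have : j ≠ 0 := by
      rintro rfl
      simp at hij hne
      exact hne hij
    simp [hB j, this]
  · simp

theorem letterPart_mul_one_right_succ {F X : Marked A} (hX : LetterHomogeneous s 1 X) (q : ℕ) :
    letterPart s (q + 1) (F * X) = letterPart s q F * X := by
  rw [letterPart_mul, Finset.sum_eq_single (q, 1)]
  · simp [hX 1]
  · rintro ⟨i, j⟩ hij hne
    have : j ≠ 1 := by
      rintro rfl
      simp at hij hne
      exact hne (by omega)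
    simp [hX j, this]
  · simp

theorem letterPart_mul_one_right_zero {F X : Marked A} (hX : LetterHomogeneous s 1 X) :
    letterPart s 0 (F * X) = 0 := by
  rw [letterPart_mul]
  simp [hX 0]

theorem letterPart_add_pow_zero {B X : Marked A} (hB : LetterHomogeneous s 0 B)
    (hX : LetterHomogeneous s 1 X) (p : ℕ) : letterPart s 0 ((B + X) ^ p) = B ^ p := by
  induction p with
  | zero =>
    simpa using letterHomogeneous_one s 0
  | succ p ih =>
    rw [pow_succ, mul_add, map_add, letterPart_mul_zero_right hB,
      letterPart_mul_one_right_zero hX, ih, add_zero, pow_succ]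

/-- Each monomial is cut at the last occurrence of `X`; what follows it is a pure power of `B`. -/
theorem letterPart_add_pow_succ {B X : Marked A} (hB : LetterHomogeneous s 0 B)
    (hX : LetterHomogeneous s 1 X) (p q : ℕ) :
    letterPart s (q + 1) ((B + X) ^ p)
      = ∑ i ∈ Finset.range p, letterPart s q ((B + X) ^ i) * X * B ^ (p - 1 - i) := by
  induction p with
  | zero =>
    simpa using letterHomogeneous_one s (q + 1)
  | succ p ih =>
    rw [pow_succ, mul_add, map_add, letterPart_mul_zero_right hB,
      letterPart_mul_one_right_succ hX, ih, Finset.sum_range_succ, Finset.sum_mul]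
    congr 1
    · refine Finset.sum_congr rfl fun i hi => ?_
      rw [mul_assoc _ _ B, ← pow_succ]
      congr 2
      have := Finset.mem_range.1 hi
      omega
    · simp

/-- Between occurrences of `X` only powers of the commuting sum `a + b` appear, and the binomial
theorem writes each of these with at most `t + 1` products. Every occurrence of `X` costs its own
rank `D`, a choice of position and one such power. -/
theorem LetterRankLE.add_pow (hc : ∀ a ∈ S, ∀ b ∈ T, Commute a b) {a b X : Marked A}
    (ha : a ∈ S) (hb : b ∈ T) (ha0 : LetterHomogeneous s 0 a) (hb0 : LetterHomogeneous s 0 b)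
    (hX1 : LetterHomogeneous s 1 X) {D t : ℕ} (hX : SumLE (productSet S T) D X)
    (p : ℕ) (hp : p ≤ t) :
    LetterRankLE S T s τ ((t + 1) ^ 2 * D) (p + 1) ((a + b + X) ^ p) := by
  have hB := ha0.add hb0
  intro q _
  induction q generalizing p with
  | zero =>
    rw [letterPart_add_pow_zero hB hX1]
    simpa using SumLE.add_pow_productSet hc ha hb p
  | succ q ih =>
    rw [letterPart_add_pow_succ hB hX1]
    refine (SumLE.sum _ (fun i => (t + 1) * ((t + 1) ^ 2 * D) ^ q * D * (t + 1)) _ fun i hi => ?_).mono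
      subset_rfl ?_
    · have hi' := Finset.mem_range.1 hi
      have h1 := ih i (by omega)
      refine ((h1 (by omega)).mul_productSet hc hX).mul_productSet hc
        (SumLE.add_pow_productSet hc ha hb (p - 1 - i)) |>.mono subset_rfl ?_
      gcongr <;> omega
    · rw [Finset.sum_const, Finset.card_range, smul_eq_mul]
      calc p * ((t + 1) * ((t + 1) ^ 2 * D) ^ q * D * (t + 1))
          = p * ((t + 1) ^ 2 * D) ^ (q + 1) := by ring
        _ ≤ (p + 1) * ((t + 1) ^ 2 * D) ^ (q + 1) := by gcongr; omega

end LetterRank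

/-! ### Splitting by the first column that is used rarely. -/

section LightLetter

open AddMonoidAlgebra Polynomial

variable {A : Type*} [Ring A] [Algebra ℂ A]

/-- `s` is the first of the letters `1, 2, …` that occurs at most `τ` times. -/
def FirstLight (τ s : ℕ) (e : ℕ →₀ ℕ) : Prop := e s ≤ τ ∧ ∀ i, 1 ≤ i → i < s → τ < e i

/-- Pigeonhole: if all `w` letters occurred more than `τ` times, the degree would be at least `w (τ
+ 1)`. Taking the first rarely used letter assigns every monomial to exactly one `s`. -/
theorem sum_coeffSum_firstLight {w τ t : ℕ} (ht : t < w * (τ + 1)) {F : Marked A}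
    (hF : ∀ e ∈ F.coeff.support, ∑ i ∈ Finset.Icc 1 w, e i ≤ t) :
    unmark F = ∑ s ∈ Finset.Icc 1 w, coeffSum (FirstLight τ s) F := by
  classical
  rw [eq_sum_single F]
  simp only [map_sum]
  rw [Finset.sum_comm]
  refine Finset.sum_congr rfl fun e he => ?_
  rw [unmark_single]
  simp only [coeffSum_single]
  have hex : ∃ s, s ∈ Finset.Icc 1 w ∧ e s ≤ τ := by
    by_contra hcon
    push Not at hcon
    have h1 : ∑ i ∈ Finset.Icc 1 w, (τ + 1) ≤ ∑ i ∈ Finset.Icc 1 w, e i :=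
      Finset.sum_le_sum fun i hi => hcon i hi
    have h2 := hF e he
    simp at h1
    omega
  have hs := Nat.find_spec hex
  have hmin := fun m => Nat.find_min hex (m := m)
  set s := Nat.find hex
  have hs1 := Finset.mem_Icc.1 hs.1
  rw [Finset.sum_eq_single s]
  · rw [if_pos]
    refine ⟨hs.2, fun i hi his => ?_⟩
    have := hmin i his
    by_contra hcon
    exact this ⟨Finset.mem_Icc.2 ⟨hi, by omega⟩, by omega⟩
  · intro s' hs' hne
    rw [if_neg]
    rintro ⟨h1, h2⟩
    have hs1' := Finset.mem_Icc.1 hs'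
    rcases lt_or_gt_of_ne hne with h | h
    · exact hmin s' h ⟨hs', h1⟩
    · have := h2 s hs1.1 h
      omega
  · intro h; exact absurd hs.1 h

/-- Exponents in which no letter up to `s` occurs. -/
def lateExponents (s : ℕ) : AddSubmonoid (ℕ →₀ ℕ) where
  carrier := {e | ∀ i ≤ s, e i = 0}
  add_mem' := by
    intro a b ha hb i hi
    rw [Finsupp.add_apply, ha i hi, hb i hi]
  zero_mem' := by intro i _; rfl

/-- The reason for choosing the first light letter: the condition looks only at letters up to `s`,
so it does not couple to the factor on the far side of the cut. -/
theorem firstLight_add {τ s : ℕ} (e : ℕ →₀ ℕ) {e' : ℕ →₀ ℕ} (he' : e' ∈ lateExponents s) :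
    FirstLight τ s (e + e') ↔ FirstLight τ s e := by
  have h : ∀ i ≤ s, (e + e') i = e i := fun i hi => by
    rw [Finsupp.add_apply, he' i hi, add_zero]
  unfold FirstLight
  rw [h s le_rfl]
  refine and_congr_right fun _ => forall_congr' fun i => forall_congr' fun _ => ?_
  refine forall_congr' fun hi => ?_
  rw [h i hi.le]

theorem coeffSum_firstLight_eq {τ s : ℕ} (F : Marked A) :
    coeffSum (FirstLight τ s) F
      = ∑ q ∈ Finset.range (τ + 1), coeffSum (FirstLight τ s) (letterPart s q F) := by
  classical
  rw [eq_sum_single F]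
  simp only [map_sum]
  rw [Finset.sum_comm]
  refine Finset.sum_congr rfl fun e _ => ?_
  rw [coeffSum_single]
  by_cases h : FirstLight τ s e
  · rw [if_pos h, Finset.sum_eq_single (e s)]
    · rw [letterPart_single, if_pos rfl, coeffSum_single, if_pos h]
    · intro q _ hq
      rw [letterPart_single, if_neg (Ne.symm hq), map_zero]
    · intro hq
      have := h.1
      simp at hq; omega
  · rw [if_neg h]
    symm
    refine Finset.sum_eq_zero fun q _ => ?_
    rw [letterPart_single]
    split_ifs
    · rw [coeffSum_single, if_neg h]
    · rw [map_zero]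

theorem sumLE_coeffSum_firstLight {S T : Subalgebra ℂ A} {s τ β α : ℕ} (hβ : 1 ≤ β)
    {F : Marked A}
    (hF : LetterRankLE (markedSubalgebra S ⊤) (markedSubalgebra T (lateExponents s)) s τ β α F) :
    SumLE (productSet S T) ((τ + 1) * (α * β ^ τ)) (coeffSum (FirstLight τ s) F) := by
  rw [coeffSum_firstLight_eq]
  refine (SumLE.sum _ (fun _ => α * β ^ τ) _ fun q hq => ?_).mono subset_rfl (by simp)
  have hq' : q ≤ τ := by simpa [Nat.lt_succ_iff] using hq
  refine (SumLE.map (coeffSum (FirstLight τ s)).toAddMonoidHom (hF q hq') ?_).mono subset_rfl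
    (Nat.mul_le_mul_left _ (Nat.pow_le_pow_right hβ hq'))
  rintro _ ⟨a, ha, b, hb, rfl⟩
  exact ⟨coeffSum (FirstLight τ s) a, coeffSum_mem _ ha, coeffSum (fun _ => True) b,
    coeffSum_mem _ hb, coeffSum_mul (fun e e' he' => firstLight_add e he') a hb⟩

/-- Exponents of total degree at most `t` in the letters `1, …, w`. -/
def DegreeLE (w t : ℕ) (F : Marked A) : Prop :=
  ∀ e ∈ F.coeff.support, ∑ i ∈ Finset.Icc 1 w, e i ≤ t

theorem DegreeLE.mul {w t t' : ℕ} {F F' : Marked A} (hF : DegreeLE w t F)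
    (hF' : DegreeLE w t' F') : DegreeLE w (t + t') (F * F') := by
  classical
  intro e he
  rw [Finsupp.mem_support_iff, AddMonoidAlgebra.coeff_mul] at he
  obtain ⟨i, hi, h1⟩ := Finset.exists_ne_zero_of_sum_ne_zero he
  obtain ⟨j, hj, h2⟩ := Finset.exists_ne_zero_of_sum_ne_zero h1
  simp only at h2
  have hij : i + j = e := by
    by_contra h; rw [if_neg h] at h2; exact h2 rfl
  rw [← hij]
  simp only [Finsupp.add_apply, Finset.sum_add_distrib]
  exact add_le_add (hF i hi) (hF' j hj)

theorem DegreeLE.single {w t : ℕ} {e : ℕ →₀ ℕ} (he : ∑ i ∈ Finset.Icc 1 w, e i ≤ t) (x : A) :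
    DegreeLE w t (single e x) := by
  intro e' he'
  rw [AddMonoidAlgebra.coeff_single, Finsupp.mem_support_iff, Finsupp.single_apply] at he'
  split_ifs at he' with h
  · rw [← h]; exact he
  · exact absurd rfl he'

theorem DegreeLE.one {w t : ℕ} : DegreeLE w t (1 : Marked A) :=
  DegreeLE.single (e := 0) (by simp) 1

theorem DegreeLE.mono {w t t' : ℕ} {F : Marked A} (hF : DegreeLE w t F) (h : t ≤ t') :
    DegreeLE w t' F := fun e he => (hF e he).trans h

theorem DegreeLE.sum {κ : Type*} {w t : ℕ} (J : Finset κ) {F : κ → Marked A}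
    (hF : ∀ i ∈ J, DegreeLE w t (F i)) : DegreeLE w t (∑ i ∈ J, F i) := by
  classical
  intro e he
  rw [AddMonoidAlgebra.coeff_sum, Finsupp.mem_support_iff, Finsupp.finsetSum_apply] at he
  obtain ⟨i, hi, h1⟩ := Finset.exists_ne_zero_of_sum_ne_zero he
  exact hF i hi e (Finsupp.mem_support_iff.2 h1)

theorem DegreeLE.smul {w t : ℕ} {F : Marked A} (c : ℂ) (hF : DegreeLE w t F) :
    DegreeLE w t (c • F) := by
  intro e he
  refine hF e (Finsupp.mem_support_iff.2 fun h => Finsupp.mem_support_iff.1 he ?_)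
  rw [AddMonoidAlgebra.coeff_smul_apply, h, smul_zero]

theorem DegreeLE.pow {w t : ℕ} {F : Marked A} (hF : DegreeLE w t F) (p : ℕ) :
    DegreeLE w (p * t) (F ^ p) := by
  induction p with
  | zero => exact DegreeLE.one
  | succ p ih => rw [pow_succ, add_mul, one_mul]; exact ih.mul hF

theorem DegreeLE.list_prod {w t : ℕ} (l : List (Marked A)) (hl : ∀ F ∈ l, DegreeLE w t F) :
    DegreeLE w (l.length * t) l.prod := by
  induction l with
  | nil => exact DegreeLE.one
  | cons F l ih =>
    rw [List.prod_cons, List.length_cons]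
    exact ((hl F List.mem_cons_self).mul (ih fun F hF => hl F (List.mem_cons_of_mem _ hF))).mono
      (by ring_nf; rfl)

/-- The sum of the letters `0, …, w + 1`, with markers. -/
noncomputable def markedSum (w : ℕ) (X : ℕ → A) : Marked A :=
  ∑ i ∈ Finset.range (w + 2), single (Finsupp.single i 1) (X i)

theorem unmark_markedSum (w : ℕ) (X : ℕ → A) :
    unmark (markedSum w X) = ∑ i ∈ Finset.range (w + 2), X i := by
  simp [markedSum, unmark_single]

theorem degreeLE_markedSum (w : ℕ) (X : ℕ → A) : DegreeLE w 1 (markedSum w X) := by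
  classical
  refine DegreeLE.sum _ fun i _ => DegreeLE.single ?_ _
  simp only [Finsupp.single_apply]
  rw [Finset.sum_ite_eq]
  split_ifs <;> simp

theorem degreeLE_aeval {w t : ℕ} {F : Marked A} (hF : DegreeLE w 1 F) {p : ℂ[X]}
    (hp : p.natDegree ≤ t) : DegreeLE w t (aeval F p) := by
  rw [aeval_eq_sum_range]
  refine DegreeLE.sum _ fun i hi => ((hF.pow i).smul _).mono ?_
  have := Finset.mem_range.1 hi
  omega

variable {w τ D t : ℕ}

/-- Two commuting subalgebras such that the letters before `s` lie in `S`, those after `s` lie in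
`T`, and the letter `s` is a sum of at most `D` products. -/
structure LetterCut (S T : Subalgebra ℂ A) (w s D : ℕ) (X : ℕ → A) : Prop where
  before : ∀ i < s, X i ∈ S
  after : ∀ i, s < i → i < w + 2 → X i ∈ T
  rank : SumLE (productSet S T) D (X s)

theorem letterRankLE_aeval_markedSum {S T : Subalgebra ℂ A} (hc : ∀ a ∈ S, ∀ b ∈ T, Commute a b)
    {s : ℕ} (hs : s < w + 2) {X : ℕ → A} (hX : LetterCut S T w s D X) {p : ℂ[X]}
    (hp : p.natDegree ≤ t) :
    LetterRankLE (markedSubalgebra S ⊤) (markedSubalgebra T (lateExponents s)) s τ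
      ((t + 1) ^ 2 * D) ((t + 1) ^ 2) (aeval (markedSum w X) p) := by
  classical
  have hc' : ∀ a ∈ markedSubalgebra S ⊤, ∀ b ∈ markedSubalgebra T (lateExponents s),
      Commute a b := fun a ha b hb => commute_of_mem_markedSubalgebra hc ha hb
  set a : Marked A := ∑ i ∈ Finset.range s, single (Finsupp.single i 1) (X i) with ha
  set b : Marked A := ∑ i ∈ Finset.Ico (s + 1) (w + 2), single (Finsupp.single i 1) (X i) with hb
  set x : Marked A := single (Finsupp.single s 1) (X s) with hx
  have hsum : markedSum w X = a + b + x := by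
    rw [markedSum, ← Finset.sum_range_add_sum_Ico _ hs.le,
      Finset.sum_eq_sum_Ico_succ_bot hs]
    simp only [ha, hb, hx]
    abel
  have haS : a ∈ markedSubalgebra S ⊤ := Subalgebra.sum_mem _ fun i hi =>
    single_mem_markedSubalgebra (AddSubmonoid.mem_top _) (hX.before i (Finset.mem_range.1 hi))
  have hbT : b ∈ markedSubalgebra T (lateExponents s) := Subalgebra.sum_mem _ fun i hi => by
    have := Finset.mem_Ico.1 hi
    refine single_mem_markedSubalgebra ?_ (hX.after i (by omega) this.2)
    intro k hk
    rw [Finsupp.single_apply, if_neg (by omega)]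
  have ha0 : LetterHomogeneous s 0 a := LetterHomogeneous.sum _ fun i hi =>
    LetterHomogeneous.single (by
      have := Finset.mem_range.1 hi
      rw [Finsupp.single_apply, if_neg (by omega)]) _
  have hb0 : LetterHomogeneous s 0 b := LetterHomogeneous.sum _ fun i hi =>
    LetterHomogeneous.single (by
      have := Finset.mem_Ico.1 hi
      rw [Finsupp.single_apply, if_neg (by omega)]) _
  have hx1 : LetterHomogeneous s 1 x := LetterHomogeneous.single (by simp) _
  -- The marker of the letter `s` is put on the left factor, so that right factors carry only
  -- letters after `s`.
  have hxD : SumLE (productSet (markedSubalgebra S ⊤) (markedSubalgebra T (lateExponents s))) D x := by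
    refine SumLE.map (AddMonoidAlgebra.singleAddHom (Finsupp.single s 1)) hX.rank ?_
    rintro _ ⟨y, hy, z, hz, rfl⟩
    refine ⟨single (Finsupp.single s 1) y,
      single_mem_markedSubalgebra (AddSubmonoid.mem_top _) hy, single 0 z,
      single_mem_markedSubalgebra (AddSubmonoid.zero_mem _) hz, ?_⟩
    rw [single_mul_single, add_zero]; rfl
  rw [aeval_eq_sum_range, hsum]
  refine (LetterRankLE.sum (α := fun i => i + 1) _ fun i hi => LetterRankLE.smul _
    (LetterRankLE.add_pow hc' haS hbT ha0 hb0 hx1 hxD i ?_)).mono ?_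
  · have := Finset.mem_range.1 hi
    omega
  · calc ∑ i ∈ Finset.range (p.natDegree + 1), (i + 1)
        ≤ ∑ i ∈ Finset.range (p.natDegree + 1), (t + 1) :=
          Finset.sum_le_sum fun i hi => by
            have := Finset.mem_range.1 hi
            omega
      _ ≤ (t + 1) ^ 2 := by
          rw [Finset.sum_const, Finset.card_range, smul_eq_mul, sq]
          gcongr

/-- A product of polynomials in sums of letters splits into one part for each letter
`s = 1, …, w`, each of low rank with respect to the subalgebras before and after `s`. -/
theorem exists_light_decomposition {U : Type*} (X : U → ℕ → A) (S T : ℕ → Subalgebra ℂ A)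
    (hc : ∀ s, ∀ a ∈ S s, ∀ b ∈ T s, Commute a b)
    (hX : ∀ u, ∀ s ∈ Finset.Icc 1 w, LetterCut (S s) (T s) w s D (X u)) (hD : 1 ≤ D)
    {p : ℂ[X]} (hp : p.natDegree ≤ t) (us : List U) (hτ : us.length * t < w * (τ + 1)) :
    ∃ K : ℕ → A, (us.map fun u => aeval (∑ i ∈ Finset.range (w + 2), X u i) p).prod
        = ∑ s ∈ Finset.Icc 1 w, K s ∧
      ∀ s ∈ Finset.Icc 1 w, SumLE (productSet (S s) (T s))
        ((τ + 1) * (((τ + 1) * (t + 1) ^ 2) ^ us.length * ((t + 1) ^ 2 * D) ^ τ)) (K s) := by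
  set F : Marked A := (us.map fun u => aeval (markedSum w (X u)) p).prod
  have hF : unmark F = (us.map fun u => aeval (∑ i ∈ Finset.range (w + 2), X u i) p).prod := by
    simp only [F, map_list_prod, List.map_map]
    congr 1
    refine List.map_congr_left fun u _ => ?_
    simp only [Function.comp_apply]
    rw [← aeval_algHom_apply, unmark_markedSum]
  have hdeg : DegreeLE w (us.length * t) F := by
    have := DegreeLE.list_prod (w := w) (t := t) (us.map fun u => aeval (markedSum w (X u)) p) (by
      intro G hG
      obtain ⟨u, -, rfl⟩ := List.mem_map.1 hG
      exact degreeLE_aeval (degreeLE_markedSum w (X u)) hp)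
    rwa [List.length_map] at this
  refine ⟨fun s => coeffSum (FirstLight τ s) F, ?_, fun s hs => ?_⟩
  · rw [← hF]
    exact sum_coeffSum_firstLight hτ hdeg
  · refine sumLE_coeffSum_firstLight (Nat.one_le_iff_ne_zero.2 (by positivity)) ?_
    have hs' := Finset.mem_Icc.1 hs
    have := LetterRankLE.list_prod (S := markedSubalgebra (S s) ⊤)
      (T := markedSubalgebra (T s) (lateExponents s)) (s := s) (τ := τ) (β := (t + 1) ^ 2 * D)
      (α := (t + 1) ^ 2)
      (fun a ha b hb => commute_of_mem_markedSubalgebra (hc s) ha hb)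
      (us.map fun u => aeval (markedSum w (X u)) p) (by
        intro G hG
        obtain ⟨u, -, rfl⟩ := List.mem_map.1 hG
        exact letterRankLE_aeval_markedSum (hc s) (by omega) (hX u s hs) hp)
    rwa [List.length_map] at this

end LightLetter

/-! ### Entropy of probability vectors concentrated on small sets. -/

section EntropyBound

/-- Gibbs' inequality, termwise. -/
theorem negMulLog_le_of_pos {p q : ℝ} (hp : 0 ≤ p) (hq : 0 < q) :
    Real.negMulLog p ≤ -(p * Real.log q) + q - p := by
  rcases hp.eq_or_lt with rfl | hp
  · simpa using hq.le
  · have h1 := Real.log_le_sub_one_of_pos (div_pos hq hp)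
    rw [Real.log_div hq.ne' hp.ne'] at h1
    have h2 : p * (Real.log q - Real.log p) ≤ p * (q / p - 1) := by gcongr
    have h3 : p * (q / p - 1) = q - p := by field_simp
    rw [Real.negMulLog]
    nlinarith

theorem sum_negMulLog_le_log_card {κ : Type*} [Fintype κ] {p : κ → ℝ} (hp : ∀ k, 0 ≤ p k)
    (hp1 : ∑ k, p k = 1) : ∑ k, Real.negMulLog (p k) ≤ Real.log (Fintype.card κ) := by
  have hne : Nonempty κ := by
    by_contra h
    rw [not_nonempty_iff] at h
    simp at hp1
  have hc : (0:ℝ) < Fintype.card κ := by exact_mod_cast Fintype.card_pos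
  calc ∑ k, Real.negMulLog (p k)
      ≤ ∑ k, (-(p k * Real.log (Fintype.card κ : ℝ)⁻¹) + (Fintype.card κ : ℝ)⁻¹ - p k) :=
        Finset.sum_le_sum fun k _ => negMulLog_le_of_pos (hp k) (by positivity)
    _ = Real.log (Fintype.card κ) := by
        rw [Finset.sum_sub_distrib, Finset.sum_add_distrib, Finset.sum_neg_distrib,
          ← Finset.sum_mul, hp1, Real.log_inv]
        simp [hc.ne']

/-- A probability vector that is mostly carried by sets of effective size `D ^ m`, with an
error decaying geometrically in `m`, has entropy `O(log D)`. -/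
theorem sum_negMulLog_le_of_concentrated {κ : Type*} [Fintype κ] {p : κ → ℝ} (hp : ∀ k, 0 ≤ p k)
    (hp1 : ∑ k, p k = 1) {D : ℕ} (hD : 2 ≤ D) (x : ℕ → κ → ℝ) (hx1 : ∀ m k, x m k ≤ 1)
    (hx0 : ∀ m k, 0 ≤ x m k)
    (hxD : ∀ m, ∑ k, x m k ≤ (D : ℝ) ^ m)
    (hxp : ∀ m, ∑ k, p k * (1 - x (m + 2) k) ≤ (1 / 4 : ℝ) ^ (m + 1)) :
    ∑ k, Real.negMulLog (p k) ≤ 8 * Real.log D := by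
  classical
  have hex : ∀ k, ∃ m, 0 < p k → 1 / 2 ≤ x m k := by
    intro k
    by_cases hk : 0 < p k
    · obtain ⟨n, hn⟩ := exists_pow_lt_of_lt_one (show 0 < p k / 2 by positivity)
        (show (1 / 4 : ℝ) < 1 by norm_num)
      refine ⟨n + 2, fun _ => ?_⟩
      have h1 : p k * (1 - x (n + 2) k) ≤ (1 / 4 : ℝ) ^ (n + 1) :=
        (Finset.single_le_sum (f := fun k => p k * (1 - x (n + 2) k))
          (fun i _ => mul_nonneg (hp i) (by linarith [hx1 (n + 2) i])) (Finset.mem_univ k)).trans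
          (hxp n)
      have h2 : (1 / 4 : ℝ) ^ (n + 1) ≤ (1 / 4 : ℝ) ^ n :=
        pow_le_pow_of_le_one (by norm_num) (by norm_num) (Nat.le_succ n)
      nlinarith
    · exact ⟨0, fun h => absurd h hk⟩
  -- The level of `k` is the first `m` at which at least half of `k` is captured. Gibbs' inequality
  -- is then applied with a reference weight depending only on the level.
  set ℓ : κ → ℕ := fun k => Nat.find (hex k)
  have hℓ : ∀ k, 0 < p k → 1 / 2 ≤ x (ℓ k) k := fun k => Nat.find_spec (hex k)
  have hmin : ∀ k, ∀ m < ℓ k, 0 < p k ∧ x m k < 1 / 2 := by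
    intro k m hm
    have := Nat.find_min (hex k) hm
    push Not at this
    exact this
  obtain ⟨L, hL⟩ : ∃ L, ∀ k, ℓ k < L := by
    refine ⟨Finset.univ.sup ℓ + 1, fun k => ?_⟩
    exact Nat.lt_succ_of_le (Finset.le_sup (Finset.mem_univ k))
  have hD0 : (0:ℝ) < D := by positivity
  have hD2 : (2:ℝ) ≤ D := by exact_mod_cast hD
  -- At level `m` the reference weight is at most `2⁻⁽ᵐ⁺¹⁾ D⁻ᵐ x m k`, where the extra factor `1/2`
  -- uses `x m k ≥ 1/2`; summing over `k` and then over `m` gives total weight at most `1`.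
  set q : κ → ℝ := fun k => (1 / 2) ^ (ℓ k + 1) * (1 / 2) * ((D : ℝ) ^ ℓ k)⁻¹ with hq
  have hq0 : ∀ k, 0 < q k := fun k => by positivity
  have hqs : ∑ k, (if 0 < p k then q k else 0) ≤ 1 := by
    have h1 : ∀ k, (if 0 < p k then q k else 0)
        ≤ ∑ m ∈ Finset.range L, (1 / 2 : ℝ) ^ (m + 1) * ((D : ℝ) ^ m)⁻¹ * x m k := by
      intro k
      have hnn : ∀ m ∈ Finset.range L, 0 ≤ (1 / 2 : ℝ) ^ (m + 1) * ((D : ℝ) ^ m)⁻¹ * x m k :=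
        fun m _ => mul_nonneg (by positivity) (hx0 m k)
      split_ifs with hk
      · refine le_trans ?_ (Finset.single_le_sum hnn (Finset.mem_range.2 (hL k)))
        have := hℓ k hk
        simp only [hq]
        have h0 : (0:ℝ) ≤ (1 / 2 : ℝ) ^ (ℓ k + 1) * ((D : ℝ) ^ ℓ k)⁻¹ := by positivity
        nlinarith
      · exact Finset.sum_nonneg hnn
    calc _ ≤ ∑ k, ∑ m ∈ Finset.range L, (1 / 2 : ℝ) ^ (m + 1) * ((D : ℝ) ^ m)⁻¹ * x m k :=
          Finset.sum_le_sum fun k _ => h1 k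
      _ = ∑ m ∈ Finset.range L, (1 / 2 : ℝ) ^ (m + 1) * ((D : ℝ) ^ m)⁻¹ * ∑ k, x m k := by
          rw [Finset.sum_comm]
          exact Finset.sum_congr rfl fun m _ => by rw [Finset.mul_sum]
      _ ≤ ∑ m ∈ Finset.range L, (1 / 2 : ℝ) ^ (m + 1) := by
          refine Finset.sum_le_sum fun m _ => ?_
          have h2 : ((D : ℝ) ^ m)⁻¹ * ∑ k, x m k ≤ 1 := by
            rw [inv_mul_le_iff₀ (by positivity), mul_one]
            exact hxD m
          rw [mul_assoc]
          exact mul_le_of_le_one_right (by positivity) h2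
      _ ≤ 1 := by
          have h3 : ∀ n : ℕ, ∑ m ∈ Finset.range n, (1 / 2 : ℝ) ^ (m + 1) = 1 - (1 / 2) ^ n := by
            intro n
            induction n with
            | zero => simp
            | succ n ih => rw [Finset.sum_range_succ, ih]; ring
          rw [h3]
          have : (0:ℝ) ≤ (1 / 2) ^ L := by positivity
          linarith
  have hlogD : Real.log 2 ≤ Real.log D := Real.log_le_log (by norm_num) hD2
  have hlog2 : 0 < Real.log 2 := Real.log_pos (by norm_num)
  have hterm : ∀ k, Real.negMulLog (p k)
      ≤ p k * ((2 * ℓ k + 2) * Real.log D) + ((if 0 < p k then q k else 0) - p k) := by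
    intro k
    split_ifs with hk
    · have h1 := negMulLog_le_of_pos (hp k) (hq0 k)
      have h2 : Real.log (q k) = -((ℓ k + 2) * Real.log 2 + ℓ k * Real.log D) := by
        simp only [hq]
        rw [Real.log_mul (by positivity) (by positivity), Real.log_mul (by positivity) (by norm_num),
          Real.log_inv, Real.log_pow, Real.log_pow, one_div, Real.log_inv]
        push_cast; ring
      have h3 : (ℓ k + 2) * Real.log 2 + ℓ k * Real.log D ≤ (2 * ℓ k + 2) * Real.log D := by
        have : (ℓ k + 2 : ℝ) * Real.log 2 ≤ (ℓ k + 2) * Real.log D := by gcongr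
        linarith
      have h4 := mul_le_mul_of_nonneg_left h3 (hp k)
      rw [h2] at h1
      linarith
    · have : p k = 0 := le_antisymm (not_lt.1 hk) (hp k)
      simp [this]
  -- Every level `m + 2` below `ℓ k` has `1 - x (m + 2) k > 1/2`, so the mean level is at most `2 +
  -- 2 ∑ 4⁻⁽ᵐ⁺¹⁾ ≤ 3`.
  have hEℓ : ∑ k, p k * ℓ k ≤ 3 := by
    have h1 : ∀ k, p k * ℓ k ≤ p k * 2 + ∑ m ∈ Finset.range L, 2 * (p k * (1 - x (m + 2) k)) := by
      intro k
      have hnn : ∀ m ∈ Finset.range L, 0 ≤ 1 - x (m + 2) k := fun m _ => by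
        linarith [hx1 (m + 2) k]
      have h2 : (ℓ k : ℝ) ≤ 2 + ∑ m ∈ Finset.range L, 2 * (1 - x (m + 2) k) := by
        have h3 : ((ℓ k - 2 : ℕ) : ℝ) ≤ ∑ m ∈ Finset.range (ℓ k - 2), 2 * (1 - x (m + 2) k) := by
          calc ((ℓ k - 2 : ℕ) : ℝ) = ∑ m ∈ Finset.range (ℓ k - 2), (1 : ℝ) := by simp
            _ ≤ _ := Finset.sum_le_sum fun m hm => by
              have h4 := (hmin k (m + 2) (by have := Finset.mem_range.1 hm; omega)).2
              linarith
        have h5 : ∑ m ∈ Finset.range (ℓ k - 2), 2 * (1 - x (m + 2) k)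
            ≤ ∑ m ∈ Finset.range L, 2 * (1 - x (m + 2) k) :=
          Finset.sum_le_sum_of_subset_of_nonneg
            (Finset.range_mono (by have := hL k; omega))
            (fun m hm _ => mul_nonneg (by norm_num) (hnn m hm))
        have h6 : (ℓ k : ℝ) ≤ ((ℓ k - 2 : ℕ) : ℝ) + 2 := by
          have : ℓ k ≤ (ℓ k - 2) + 2 := by omega
          exact_mod_cast this
        linarith
      have h7 := mul_le_mul_of_nonneg_left h2 (hp k)
      rw [mul_add, Finset.mul_sum] at h7
      refine h7.trans (le_of_eq ?_)
      congr 1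
      exact Finset.sum_congr rfl fun m _ => by ring
    calc ∑ k, p k * ℓ k
        ≤ ∑ k, (p k * 2 + ∑ m ∈ Finset.range L, 2 * (p k * (1 - x (m + 2) k))) :=
          Finset.sum_le_sum fun k _ => h1 k
      _ = 2 + ∑ m ∈ Finset.range L, 2 * ∑ k, p k * (1 - x (m + 2) k) := by
          rw [Finset.sum_add_distrib, ← Finset.sum_mul, hp1, one_mul, Finset.sum_comm]
          congr 1
          exact Finset.sum_congr rfl fun m _ => by rw [Finset.mul_sum]
      _ ≤ 2 + ∑ m ∈ Finset.range L, 2 * (1 / 4 : ℝ) ^ (m + 1) := by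
          gcongr with m
          exact hxp m
      _ ≤ 3 := by
          have h3 : ∀ n : ℕ, ∑ m ∈ Finset.range n, 2 * (1 / 4 : ℝ) ^ (m + 1)
              = 2 / 3 * (1 - (1 / 4) ^ n) := by
            intro n
            induction n with
            | zero => simp
            | succ n ih => rw [Finset.sum_range_succ, ih]; ring
          rw [h3]
          have : (0:ℝ) ≤ (1 / 4) ^ L := by positivity
          linarith
  calc ∑ k, Real.negMulLog (p k)
      ≤ ∑ k, (p k * ((2 * ℓ k + 2) * Real.log D) + ((if 0 < p k then q k else 0) - p k)) :=
        Finset.sum_le_sum fun k _ => hterm k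
    _ = (2 * ∑ k, p k * ℓ k + 2) * Real.log D + (∑ k, (if 0 < p k then q k else 0) - 1) := by
        rw [Finset.sum_add_distrib, Finset.sum_sub_distrib, hp1]
        congr 1
        have : ∀ k, p k * ((2 * ℓ k + 2) * Real.log D)
            = 2 * Real.log D * (p k * ℓ k) + 2 * Real.log D * p k := fun k => by ring
        rw [Finset.sum_congr rfl fun k _ => this k, Finset.sum_add_distrib, ← Finset.mul_sum,
          ← Finset.mul_sum, hp1]
        ring
    _ ≤ (2 * 3 + 2) * Real.log D + 0 := by
        gcongr
        linarith
    _ = 8 * Real.log D := by ring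

end EntropyBound

/-! ### The spectrum of the reduced state and projections of columns. -/

section Spectrum

open scoped Matrix

variable {P Q : Type*} [Fintype P] [Fintype Q] [DecidableEq P]

/-- The columns of a matrix, as vectors of a Euclidean space. -/
noncomputable def euclideanColumn (M : Matrix P Q ℂ) (b : Q) : EuclideanSpace ℂ P :=
  WithLp.toLp 2 fun a => M a b

/-- Both sides are the quadratic form of `M * Mᴴ` at `y`, computed from the columns of `M` and from
an eigenbasis. -/
theorem sum_norm_inner_column_sq (M : Matrix P Q ℂ) (hM : (M * Mᴴ).IsHermitian)
    (y : EuclideanSpace ℂ P) :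
    ∑ b, ‖inner ℂ y (euclideanColumn M b)‖ ^ 2
      = ∑ k, hM.eigenvalues k * ‖inner ℂ y (hM.eigenvectorBasis k)‖ ^ 2 := by
  set e := hM.eigenvectorBasis
  have hcol : ∀ z : EuclideanSpace ℂ P, ∑ b, inner ℂ y (euclideanColumn M b) *
      inner ℂ (euclideanColumn M b) z
        = inner ℂ y (WithLp.toLp 2 ((M * Mᴴ) *ᵥ z) : EuclideanSpace ℂ P) := by
    intro z
    have h0 : (WithLp.toLp 2 ((M * Mᴴ) *ᵥ z) : EuclideanSpace ℂ P)
        = ∑ b, inner ℂ (euclideanColumn M b) z • euclideanColumn M b := by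
      ext a
      rw [← Matrix.mulVec_mulVec]
      simp only [Matrix.mulVec, dotProduct, Matrix.conjTranspose_apply, euclideanColumn,
        PiLp.inner_apply, RCLike.inner_apply, PiLp.smul_apply, smul_eq_mul, WithLp.ofLp_sum,
        Finset.sum_apply]
      refine Finset.sum_congr rfl fun b _ => ?_
      rw [mul_comm]
      refine congrArg (· * _) (Finset.sum_congr rfl fun i _ => ?_)
      rw [mul_comm]; rfl
    rw [h0, inner_sum]
    exact Finset.sum_congr rfl fun b _ => by rw [inner_smul_right, mul_comm]
  have h1 : ∀ k, ∑ b, inner ℂ y (euclideanColumn M b) * inner ℂ (euclideanColumn M b) (e k)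
      = hM.eigenvalues k * inner ℂ y (e k) := by
    intro k
    rw [hcol, hM.mulVec_eigenvectorBasis k]
    have : (WithLp.toLp 2 (hM.eigenvalues k • ⇑(hM.eigenvectorBasis k)) : EuclideanSpace ℂ P)
        = (hM.eigenvalues k : ℂ) • e k := by
      ext a; simp [e]
    rw [this, inner_smul_right]
  have h2 : ((∑ b, ‖inner ℂ y (euclideanColumn M b)‖ ^ 2 : ℝ) : ℂ)
      = ∑ k, (hM.eigenvalues k : ℂ) * (‖inner ℂ y (e k)‖ ^ 2 : ℝ) := by
    have h3 : ∀ b, ((‖inner ℂ y (euclideanColumn M b)‖ ^ 2 : ℝ) : ℂ)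
        = ∑ k, inner ℂ y (euclideanColumn M b) * inner ℂ (euclideanColumn M b) (e k)
          * inner ℂ (e k) y := by
      intro b
      simp only [mul_assoc]
      rw [← Finset.mul_sum, e.sum_inner_mul_inner, ← inner_conj_symm (euclideanColumn M b) y,
        Complex.mul_conj, Complex.normSq_eq_norm_sq]
    rw [Complex.ofReal_sum, Finset.sum_congr rfl fun b _ => h3 b, Finset.sum_comm]
    refine Finset.sum_congr rfl fun k _ => ?_
    rw [← Finset.sum_mul, h1, ← inner_conj_symm (e k) y, mul_assoc, Complex.mul_conj,
      Complex.normSq_eq_norm_sq]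
  exact_mod_cast h2

theorem norm_starProjection_sq_eq {E : Type*} [NormedAddCommGroup E] [InnerProductSpace ℂ E]
    [FiniteDimensional ℂ E] (W : Submodule ℂ E) (v : E) :
    ‖W.starProjection v‖ ^ 2 = ∑ r, ‖inner ℂ (stdOrthonormalBasis ℂ W r : E) v‖ ^ 2 := by
  have h1 := (stdOrthonormalBasis ℂ W).sum_sq_norm_inner_right (W.orthogonalProjectionOnto v)
  have h2 : ‖W.starProjection v‖ = ‖W.orthogonalProjectionOnto v‖ := rfl
  rw [h2, ← h1]
  refine Finset.sum_congr rfl fun r _ => ?_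
  rw [Submodule.coe_inner]
  have h3 := Submodule.inner_starProjection_left_eq_right W (stdOrthonormalBasis ℂ W r : E) v
  rw [Submodule.starProjection_eq_self_iff.2 (stdOrthonormalBasis ℂ W r).2] at h3
  rw [h3]; rfl

theorem sum_norm_starProjection_column_sq (M : Matrix P Q ℂ) (hM : (M * Mᴴ).IsHermitian)
    (W : Submodule ℂ (EuclideanSpace ℂ P)) :
    ∑ b, ‖W.starProjection (euclideanColumn M b)‖ ^ 2
      = ∑ k, hM.eigenvalues k * ‖W.starProjection (hM.eigenvectorBasis k)‖ ^ 2 := by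
  simp only [norm_starProjection_sq_eq]
  rw [Finset.sum_comm, Finset.sum_congr rfl fun r _ => sum_norm_inner_column_sq M hM _,
    Finset.sum_comm]
  exact Finset.sum_congr rfl fun k _ => by rw [Finset.mul_sum]

/-- Both sides are the trace of the projection. -/
theorem sum_norm_starProjection_basis_sq {E κ : Type*} [NormedAddCommGroup E]
    [InnerProductSpace ℂ E] [FiniteDimensional ℂ E] [Fintype κ] (e : OrthonormalBasis κ ℂ E)
    (W : Submodule ℂ E) : ∑ k, ‖W.starProjection (e k)‖ ^ 2 = Module.finrank ℂ W := by
  simp only [norm_starProjection_sq_eq]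
  rw [Finset.sum_comm]
  have h1 : ∀ r, ∑ k, ‖inner ℂ (stdOrthonormalBasis ℂ W r : E) (e k)‖ ^ 2 = 1 := by
    intro r
    rw [e.sum_sq_norm_inner_left]
    have := (stdOrthonormalBasis ℂ W).orthonormal.1 r
    rw [← Submodule.coe_norm] at *
    simp [this]
  simp [h1]

end Spectrum

/-! ### States as families of left vectors, and their Schmidt rank. -/

section Columns

variable {L n d : ℕ} (c : ℕ)

/-- The columns of the amplitude matrix of a state, as vectors of the left Hilbert space. -/
noncomputable def column (b : RightSite L n c → Fin d) :
    State L n d →ₗ[ℂ] EuclideanSpace ℂ (LeftSite L n c → Fin d) where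
  toFun ψ := euclideanColumn (amplitudeMatrix c ψ) b
  map_add' ψ φ := by ext a; rfl
  map_smul' r ψ := by ext a; rfl

theorem sum_inner_column (φ ψ : State L n d) :
    ∑ b, inner ℂ (column c b φ) (column c b ψ) = inner ℂ φ ψ := by
  simp only [PiLp.inner_apply]
  rw [← Equiv.sum_comp (Equiv.piEquivPiSubtypeProd (fun s : Site L n => s.1.val < c)
    (fun _ => Fin d)).symm, Fintype.sum_prod_type_right]
  rfl

theorem sum_norm_column_sq (ψ : State L n d) : ∑ b, ‖column c b ψ‖ ^ 2 = ‖ψ‖ ^ 2 := by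
  have h := sum_inner_column c ψ ψ
  simp only [inner_self_eq_norm_sq_to_K] at h
  exact_mod_cast h

/-- `ψ` is a product of a vector on the sites in `X` and a vector on the other sites. -/
def productVectors (L n d : ℕ) (X : Set (Site L n)) : Set (State L n d) :=
  {ψ | ∃ f g : Config L n d → ℂ, DependsOn f X ∧ DependsOn g Xᶜ ∧ ∀ σ, ψ σ = f σ * g σ}

/-- The sites in the first `c` columns. -/
def leftSites (L n c : ℕ) : Set (Site L n) := {s | s.1.val < c}

/-- All columns of a product vector are multiples of one left vector, so each summand adds at most
one dimension. -/
theorem exists_column_mem_of_sumLE {D : ℕ} {ψ : State L n d}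
    (hψ : SumLE (productVectors L n d (leftSites L n c)) D ψ) :
    ∃ W : Submodule ℂ (EuclideanSpace ℂ (LeftSite L n c → Fin d)),
      Module.finrank ℂ W ≤ D ∧ ∀ b, column c b ψ ∈ W := by
  obtain ⟨l, h1, h2, rfl⟩ := hψ
  suffices ∃ W : Submodule ℂ (EuclideanSpace ℂ (LeftSite L n c → Fin d)),
      Module.finrank ℂ W ≤ l.length ∧ ∀ b, column c b l.sum ∈ W by
    obtain ⟨W, hW, hm⟩ := this
    exact ⟨W, hW.trans h1, hm⟩
  clear h1
  induction l with
  | nil => exact ⟨⊥, by simp, by simp⟩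
  | cons ψ l ih =>
    obtain ⟨W, hW, hm⟩ := ih fun a ha => h2 a (List.mem_cons_of_mem _ ha)
    obtain ⟨f, g, hf, hg, hfg⟩ := h2 ψ List.mem_cons_self
    have hex : ∃ u : EuclideanSpace ℂ (LeftSite L n c → Fin d), ∀ b, ∃ r : ℂ,
        column c b ψ = r • u := by
      set e := Equiv.piEquivPiSubtypeProd (fun s : Site L n => s.1.val < c) (fun _ => Fin d)
      rcases isEmpty_or_nonempty (RightSite L n c → Fin d) with hb | ⟨⟨b₀⟩⟩
      · exact ⟨0, fun b => hb.elim b⟩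
      rcases isEmpty_or_nonempty (LeftSite L n c → Fin d) with ha | ⟨⟨a₀⟩⟩
      · exact ⟨0, fun b => ⟨0, by ext a; exact ha.elim a⟩⟩
      refine ⟨WithLp.toLp 2 fun a => f (e.symm (a, b₀)), fun b => ⟨g (e.symm (a₀, b)), ?_⟩⟩
      ext a
      have h3 : column c b ψ a = ψ (e.symm (a, b)) := rfl
      have h4 : f (e.symm (a, b)) = f (e.symm (a, b₀)) := hf fun s hs => by
        have hs' : s.1.val < c := hs
        simp [e, Equiv.piEquivPiSubtypeProd, hs']
      have h5 : g (e.symm (a, b)) = g (e.symm (a₀, b)) := hg fun s hs => by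
        have hs' : ¬ s.1.val < c := hs
        simp [e, Equiv.piEquivPiSubtypeProd, hs']
      rw [h3, hfg, h4, h5, mul_comm]
      rfl
    obtain ⟨u, hu⟩ := hex
    refine ⟨ℂ ∙ u ⊔ W, ?_, fun b => ?_⟩
    · refine (Submodule.finrank_add_le_finrank_add_finrank _ _).trans ?_
      rw [List.length_cons, add_comm]
      exact add_le_add hW ((finrank_span_le_card ({u} : Set _)).trans (by simp))
    · obtain ⟨r, hr⟩ := hu b
      rw [List.sum_cons, map_add, hr]
      exact Submodule.add_mem_sup (Submodule.smul_mem _ _ (Submodule.mem_span_singleton_self u))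
        (hm b)

theorem exists_column_eq_smul (u : EuclideanSpace ℂ (LeftSite L n c → Fin d))
    (g : (RightSite L n c → Fin d) → ℂ) :
    ∃ φ ∈ productVectors L n d (leftSites L n c), ∀ b, column c b φ = g b • u := by
  set e := Equiv.piEquivPiSubtypeProd (fun s : Site L n => s.1.val < c) (fun _ => Fin d) with he
  refine ⟨WithLp.toLp 2 fun σ => u (e σ).1 * g (e σ).2,
    ⟨fun σ => u (e σ).1, fun σ => g (e σ).2, ?_, ?_, fun σ => rfl⟩, fun b => ?_⟩
  · intro σ τ h
    have : (e σ).1 = (e τ).1 := funext fun s => h s.1 s.2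
    simp only [this]
  · intro σ τ h
    have : (e σ).2 = (e τ).2 := funext fun s => h s.1 s.2
    simp only [this]
  · ext a
    have : column c b (WithLp.toLp 2 fun σ => u (e σ).1 * g (e σ).2) a
      = u (e (e.symm (a, b))).1 * g (e (e.symm (a, b))).2 := rfl
    rw [this, Equiv.apply_symm_apply]
    simp [mul_comm]

end Columns

/-! ### From an approximate ground state projection to an entropy bound. -/

section ApproximateProjection

open scoped Matrix ComplexOrder

variable {L n d : ℕ}

/-- The entropy is at most the logarithm of the dimension. -/
theorem entanglementEntropy_le_log_card (c : ℕ) {Ω : State L n d} (hΩ : ‖Ω‖ = 1) :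
    entanglementEntropy c Ω ≤ Real.log (Fintype.card (LeftSite L n c → Fin d)) ∧
      (∀ k, 0 ≤ (reducedState_isHermitian c Ω).eigenvalues k) ∧
      ∑ k, (reducedState_isHermitian c Ω).eigenvalues k = 1 := by
  have h0 : ∀ k, 0 ≤ (reducedState_isHermitian c Ω).eigenvalues k :=
    (Matrix.posSemidef_self_mul_conjTranspose (amplitudeMatrix c Ω)).eigenvalues_nonneg
  have h1 : ∑ k, (reducedState_isHermitian c Ω).eigenvalues k = 1 := by
    have h := sum_norm_starProjection_column_sq (amplitudeMatrix c Ω)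
      (reducedState_isHermitian c Ω) ⊤
    have h2 := sum_norm_column_sq c Ω
    simp only [Submodule.starProjection_top, ContinuousLinearMap.id_apply,
      OrthonormalBasis.norm_eq_one, one_pow, mul_one] at h
    rw [hΩ, one_pow] at h2
    exact h.symm.trans h2
  exact ⟨sum_negMulLog_le_log_card h0 h1, h0, h1⟩

set_option maxHeartbeats 1000000 in
/-- An approximate ground state projection that shrinks the orthogonal complement of `Ω`
by `ε` and multiplies Schmidt ranks by at most `D`, with `2 D ε² ≤ 1`, bounds the entropy. -/
theorem entanglementEntropy_le_of_approximate_projection (c : ℕ) {Ω : State L n d}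
    (hΩ : ‖Ω‖ = 1) (K : State L n d →L[ℂ] State L n d) (hK : K Ω = Ω)
    (hKo : ∀ v, inner ℂ Ω v = 0 → inner ℂ Ω (K v) = 0) {ε : ℝ}
    (hKε : ∀ v, inner ℂ Ω v = 0 → ‖K v‖ ≤ ε * ‖v‖) (hε : 0 ≤ ε) {D : ℕ} (hD : 2 ≤ D)
    (hKD : ∀ ψ ∈ productVectors L n d (leftSites L n c),
      SumLE (productVectors L n d (leftSites L n c)) D (K ψ))
    (hDε : 2 * D * ε ^ 2 ≤ 1) : entanglementEntropy c Ω ≤ 8 * Real.log D := by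
  obtain ⟨-, hp0, hp1⟩ := entanglementEntropy_le_log_card c hΩ
  set M := amplitudeMatrix c Ω with hMdef
  have hM := reducedState_isHermitian c Ω
  set p := (reducedState_isHermitian c Ω).eigenvalues with hp
  set e := (reducedState_isHermitian c Ω).eigenvectorBasis with he
  have hsum : ∀ W : Submodule ℂ (EuclideanSpace ℂ (LeftSite L n c → Fin d)),
      ∑ b, ‖W.starProjection (column c b Ω)‖ ^ 2 = ∑ k, p k * ‖W.starProjection (e k)‖ ^ 2 :=
    fun W => sum_norm_starProjection_column_sq M hM W
  have hsumi : ∀ y, ∑ b, ‖inner ℂ y (column c b Ω)‖ ^ 2 = ∑ k, p k * ‖inner ℂ y (e k)‖ ^ 2 :=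
    fun y => sum_norm_inner_column_sq M hM y
  have hent : entanglementEntropy c Ω = ∑ k, Real.negMulLog (p k) := rfl
  clear_value p e M
  have hδ : ∀ k l, ‖inner ℂ (e k) (e l)‖ ^ 2 = if k = l then 1 else (0 : ℝ) := by
    intro k l
    rw [e.inner_eq_ite]
    split_ifs <;> simp
  have hne : Nonempty (LeftSite L n c → Fin d) := by
    by_contra h
    rw [not_nonempty_iff] at h
    simp at hp1
  obtain ⟨k₀, hk₀⟩ := exists_eq_ciSup_of_finite (f := p)
  have hmax : ∀ k, p k ≤ p k₀ := fun k => hk₀ ▸ le_ciSup (Finite.bddAbove_range p) k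
  have hpos : 0 < p k₀ := by
    by_contra h
    have : ∑ k, p k ≤ 0 := Finset.sum_nonpos fun k _ => (hmax k).trans (not_lt.1 h)
    linarith
  -- The leading Schmidt term of `Ω`, left unnormalised so that both `⟨Ω, φ⟩` and `‖φ‖²` equal the
  -- largest eigenvalue `p k₀`.
  obtain ⟨φ, hφ, hφc⟩ := exists_column_eq_smul c (e k₀) fun b => inner ℂ (e k₀) (column c b Ω)
  have hΩφ : inner ℂ Ω φ = ((p k₀ : ℝ) : ℂ) := by
    rw [← sum_inner_column c]
    have h1 : ∀ b, inner ℂ (column c b Ω) (column c b φ)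
        = ((‖inner ℂ (e k₀) (column c b Ω)‖ ^ 2 : ℝ) : ℂ) := by
      intro b
      rw [hφc, inner_smul_right, ← inner_conj_symm (column c b Ω) (e k₀), Complex.mul_conj,
        Complex.normSq_eq_norm_sq]
    rw [Finset.sum_congr rfl fun b _ => h1 b, ← Complex.ofReal_sum, hsumi]
    simp [hδ]
  have hφn : ‖φ‖ ^ 2 = p k₀ := by
    rw [← sum_norm_column_sq c]
    simp only [hφc, norm_smul, e.norm_eq_one, mul_one]
    rw [hsumi]
    simp [hδ]
  have hp01 : p k₀ ≤ 1 := hp1 ▸ Finset.single_le_sum (fun k _ => hp0 k) (Finset.mem_univ k₀)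
  set P : ℂ := ((p k₀ : ℝ) : ℂ) with hP
  have hPn : ‖P‖ = p k₀ := by rw [hP, Complex.norm_real, Real.norm_of_nonneg hpos.le]
  have hP0 : P ≠ 0 := by simpa [hP] using hpos.ne'
  set φ' := φ - P • Ω with hφ'
  have hΩΩ : inner ℂ Ω Ω = (1 : ℂ) := by rw [inner_self_eq_norm_sq_to_K, hΩ]; simp
  have hφ'o : inner ℂ Ω φ' = 0 := by
    rw [hφ', inner_sub_right, inner_smul_right, hΩΩ, hΩφ]; ring
  have hpyth : ∀ v, inner ℂ Ω v = 0 → ‖P • Ω + v‖ ^ 2 = p k₀ ^ 2 + ‖v‖ ^ 2 := by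
    intro v hv
    have := norm_add_sq_eq_norm_sq_add_norm_sq_of_inner_eq_zero (𝕜 := ℂ) (P • Ω) v
      (by rw [inner_smul_left, hv, mul_zero])
    rw [norm_smul, hΩ, mul_one, hPn] at this
    nlinarith
  have hφ'n : ‖φ'‖ ^ 2 = p k₀ - p k₀ ^ 2 := by
    have h1 := hpyth φ' hφ'o
    rw [hφ', add_sub_cancel, hφn] at h1
    rw [hφ']; linarith
  have hiter : ∀ m : ℕ, inner ℂ Ω ((K ^ m) φ') = 0 ∧ ‖(K ^ m) φ'‖ ≤ ε ^ m * ‖φ'‖ ∧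
      (K ^ m) φ = P • Ω + (K ^ m) φ' ∧
      SumLE (productVectors L n d (leftSites L n c)) (D ^ m) ((K ^ m) φ) := by
    intro m
    induction m with
    | zero =>
      refine ⟨by simpa using hφ'o, by simp, by simp [hφ'], ?_⟩
      simpa using SumLE.of_mem hφ
    | succ m ih =>
      obtain ⟨h1, h2, h3, h4⟩ := ih
      have hs : ∀ v, (K ^ (m + 1)) v = K ((K ^ m) v) := fun v => by
        rw [pow_succ']; rfl
      refine ⟨?_, ?_, ?_, ?_⟩
      · rw [hs]; exact hKo _ h1
      · rw [hs, pow_succ', mul_assoc]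
        exact (hKε _ h1).trans (mul_le_mul_of_nonneg_left h2 hε)
      · rw [hs, h3, map_add, map_smul, hK, hs]
      · rw [hs, pow_succ]
        exact h4.bind (K : State L n d →ₗ[ℂ] State L n d).toAddMonoidHom hKD
  have hD0 : (0:ℝ) < D := by positivity
  have hDinv : 1 / (2 * (D:ℝ)) ≤ 1 / 4 := by
    have : (2:ℝ) ≤ D := by exact_mod_cast hD
    rw [div_le_div_iff₀ (by positivity) (by norm_num)]; linarith
  -- the largest Schmidt coefficient is not too small
  have hoverlap : 1 / (2 * D) ≤ p k₀ := by
    obtain ⟨h1, h2, h3, h4⟩ := hiter 1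
    obtain ⟨W, hW, hWm⟩ := exists_column_mem_of_sumLE c h4
    rw [pow_one] at h1 h2 h3 h4 hW hWm
    rw [pow_one] at h2
    have h5 : inner ℂ Ω (K φ) = P := by
      rw [h3, inner_add_right, inner_smul_right, hΩΩ, h1]; ring
    have h6 : ‖inner ℂ Ω (K φ)‖ ≤ ∑ b, ‖W.starProjection (column c b Ω)‖ * ‖column c b (K φ)‖ := by
      rw [← sum_inner_column c]
      refine (norm_sum_le _ _).trans (Finset.sum_le_sum fun b _ => ?_)
      have h7 := Submodule.inner_starProjection_left_eq_right W (column c b Ω) (column c b (K φ))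
      rw [Submodule.starProjection_eq_self_iff.2 (hWm b)] at h7
      rw [← h7]
      exact norm_inner_le_norm _ _
    -- A subspace of dimension at most `D` captures at most `D * p k₀` of the weight of `Ω`.
    have h8 : (∑ b, ‖W.starProjection (column c b Ω)‖ * ‖column c b (K φ)‖) ^ 2
        ≤ (p k₀ * D) * ‖K φ‖ ^ 2 := by
      refine (Finset.sum_mul_sq_le_sq_mul_sq _ _ _).trans ?_
      rw [sum_norm_column_sq, hsum]
      gcongr
      calc ∑ k, p k * ‖W.starProjection (e k)‖ ^ 2
          ≤ ∑ k, p k₀ * ‖W.starProjection (e k)‖ ^ 2 := by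
            gcongr with k
            exact hmax k
        _ ≤ p k₀ * D := by
            rw [← Finset.mul_sum, sum_norm_starProjection_basis_sq]
            gcongr
    rw [h5, hPn] at h6
    have h9 : ‖K φ‖ ^ 2 ≤ p k₀ ^ 2 + ε ^ 2 * (p k₀ - p k₀ ^ 2) := by
      rw [h3, hpyth _ h1, ← hφ'n, ← mul_pow]
      gcongr
    have h10 : p k₀ ^ 2 ≤ (p k₀ * D) * (p k₀ ^ 2 + ε ^ 2 * (p k₀ - p k₀ ^ 2)) :=
      ((pow_le_pow_left₀ hpos.le h6 2).trans h8).trans (by gcongr)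
    have h11 : 1 ≤ D * (p k₀ + ε ^ 2 * (1 - p k₀)) := by
      have : p k₀ ^ 2 * 1 ≤ p k₀ ^ 2 * (D * (p k₀ + ε ^ 2 * (1 - p k₀))) := by
        refine (mul_one _).le.trans (h10.trans (le_of_eq ?_)); ring
      exact le_of_mul_le_mul_left this (by positivity)
    rw [div_le_iff₀ (by positivity)]
    nlinarith [mul_nonneg hD0.le (mul_nonneg (sq_nonneg ε) hpos.le)]
  have hcol : ∀ m, ∃ W : Submodule ℂ (EuclideanSpace ℂ (LeftSite L n c → Fin d)),
      Module.finrank ℂ W ≤ D ^ m ∧ ∀ b, column c b ((K ^ m) φ) ∈ W :=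
    fun m => exists_column_mem_of_sumLE c (hiter m).2.2.2
  choose W hWd hWm using hcol
  rw [hent]
  refine sum_negMulLog_le_of_concentrated hp0 hp1 hD
    (fun m k => ‖(W m).starProjection (e k)‖ ^ 2) ?_ (fun m k => by positivity) ?_ ?_
  · intro m k
    have h1 := starProjection_norm_le (isStarProjection_starProjection (U := W m)) (e k)
    rw [e.norm_eq_one] at h1
    exact pow_le_one₀ (norm_nonneg _) h1
  · intro m
    rw [sum_norm_starProjection_basis_sq]
    exact_mod_cast hWd m
  · intro m
    obtain ⟨h1, h2, h3, h4⟩ := hiter (m + 2)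
    have h5 : ∑ k, p k * (1 - ‖(W (m + 2)).starProjection (e k)‖ ^ 2)
        = ∑ b, ‖column c b Ω - (W (m + 2)).starProjection (column c b Ω)‖ ^ 2 := by
      have h6 : ∀ b, ‖column c b Ω - (W (m + 2)).starProjection (column c b Ω)‖ ^ 2
          = ‖column c b Ω‖ ^ 2 - ‖(W (m + 2)).starProjection (column c b Ω)‖ ^ 2 := by
        intro b
        have := starProjection_norm_sq_add (isStarProjection_starProjection (U := W (m + 2)))
          (column c b Ω)
        linarith
      simp only [mul_sub, mul_one, Finset.sum_sub_distrib, h6]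
      rw [hp1, hsum, sum_norm_column_sq, hΩ, one_pow]
    -- Projection onto `W` gives the best approximation from `W`, so it does at least as well as the
    -- rescaled vector `K ^ (m + 2) φ`.
    have h7 : ∀ b, ‖column c b Ω - (W (m + 2)).starProjection (column c b Ω)‖
        ≤ ‖column c b (Ω - P⁻¹ • (K ^ (m + 2)) φ)‖ := by
      intro b
      set y := P⁻¹ • column c b ((K ^ (m + 2)) φ) with hy
      have hyW : (W (m + 2)).starProjection y = y :=
        Submodule.starProjection_eq_self_iff.2 (Submodule.smul_mem _ _ (hWm _ b))
      have h8 := starProjection_norm_compl_le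
        (isStarProjection_starProjection (U := W (m + 2))) (column c b Ω - y)
      rw [map_sub, hyW, sub_sub_sub_cancel_right] at h8
      rwa [map_sub, map_smul]
    have h9 : Ω - P⁻¹ • (K ^ (m + 2)) φ = -(P⁻¹ • (K ^ (m + 2)) φ') := by
      rw [h3, smul_add, smul_smul, inv_mul_cancel₀ hP0, one_smul]; abel
    have hε2 : ε ^ 2 ≤ 1 / (2 * D) := by
      rw [le_div_iff₀ (by positivity)]; linarith
    calc ∑ k, p k * (1 - ‖(W (m + 2)).starProjection (e k)‖ ^ 2)
        ≤ ∑ b, ‖column c b (Ω - P⁻¹ • (K ^ (m + 2)) φ)‖ ^ 2 := by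
          rw [h5]
          gcongr with b
          exact h7 b
      _ = ‖P⁻¹ • (K ^ (m + 2)) φ'‖ ^ 2 := by rw [sum_norm_column_sq, h9, norm_neg]
      _ ≤ (p k₀)⁻¹ ^ 2 * (ε ^ (m + 2) * ‖φ'‖) ^ 2 := by
          rw [norm_smul, norm_inv, hPn, mul_pow]
          gcongr
      _ = (ε ^ 2) ^ (m + 2) * ((p k₀)⁻¹ ^ 2 * ‖φ'‖ ^ 2) := by ring
      _ ≤ (ε ^ 2) ^ (m + 2) * (p k₀)⁻¹ := by
          gcongr
          rw [hφ'n]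
          have : (p k₀)⁻¹ ^ 2 * (p k₀ - p k₀ ^ 2) = (p k₀)⁻¹ * (1 - p k₀) := by field_simp
          rw [this]
          exact mul_le_of_le_one_right (by positivity) (by linarith)
      -- The normalisation costs `(p k₀)⁻¹ ≤ 2 D`, hence one power of `1 / (2 D)`; this is why the
      -- error is measured two levels up.
      _ ≤ (1 / (2 * D)) ^ (m + 2) * (2 * D) := by
          have : (p k₀)⁻¹ ≤ 2 * D := by
            rw [inv_le_comm₀ hpos (by positivity), ← one_div]; exact hoverlap
          gcongr
      _ = (1 / (2 * (D:ℝ))) ^ (m + 1) := by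
          rw [pow_succ _ (m + 1)]; field_simp
      _ ≤ (1 / 4) ^ (m + 1) := by gcongr

end ApproximateProjection

/-! ### Operators supported on a set of sites and their effect on Schmidt rank. -/

section Support

variable {L n d : ℕ}

/-- Entrywise form of acting nontrivially only on the sites in `X`. -/
structure SupportedOn (X : Set (Site L n)) (M : Op L n d) : Prop where
  eq_zero : ∀ σ τ, (∃ s ∉ X, σ s ≠ τ s) → M σ τ = 0
  congr : ∀ σ τ σ' τ', (∀ s ∉ X, σ s = τ s) → (∀ s ∉ X, σ' s = τ' s) →
    (∀ s ∈ X, σ s = σ' s) → (∀ s ∈ X, τ s = τ' s) → M σ τ = M σ' τ'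

theorem ActsOnlyOn.supportedOn {X : Set (Site L n)} {M : Op L n d} (h : ActsOnlyOn M X) :
    SupportedOn X M := by
  obtain ⟨A, hA⟩ := h
  constructor
  · rintro σ τ ⟨s, hs, hst⟩
    rw [hA, if_neg fun h => hst (h s hs)]
  · intro σ τ σ' τ' h1 h2 h3 h4
    rw [hA, hA, if_pos h1, if_pos h2]
    congr 1
    · exact funext fun s => h3 s s.2
    · exact funext fun s => h4 s s.2

theorem SupportedOn.mono {X Y : Set (Site L n)} {M : Op L n d} (h : SupportedOn X M)
    (hXY : X ⊆ Y) : SupportedOn Y M := by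
  constructor
  · rintro σ τ ⟨s, hs, hst⟩
    exact h.eq_zero _ _ ⟨s, fun h' => hs (hXY h'), hst⟩
  · intro σ τ σ' τ' h1 h2 h3 h4
    by_cases hc : ∀ s ∉ X, σ s = τ s
    · refine h.congr _ _ _ _ hc ?_ (fun s hs => h3 s (hXY hs)) fun s hs => h4 s (hXY hs)
      intro s hs
      by_cases hsY : s ∈ Y
      · rw [← h3 s hsY, ← h4 s hsY, hc s hs]
      · exact h2 s hsY
    · push Not at hc
      obtain ⟨s, hs, hst⟩ := hc
      have hsY : s ∈ Y := by
        by_contra hsY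
        exact hst (h1 s hsY)
      rw [h.eq_zero σ τ ⟨s, hs, hst⟩,
        h.eq_zero σ' τ' ⟨s, hs, by rwa [← h3 s hsY, ← h4 s hsY]⟩]

-- The intermediate configuration is forced: `M` cannot change sites outside `X`, and `N` cannot
-- change sites of `X`.
open Classical in
theorem SupportedOn.mul_apply {X Y : Set (Site L n)} (hXY : Disjoint X Y) {M N : Op L n d}
    (hM : SupportedOn X M) (hN : SupportedOn Y N) (σ τ : Config L n d) :
    (M * N) σ τ = M σ (X.piecewise τ σ) * N (X.piecewise τ σ) τ := by
  rw [Matrix.mul_apply]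
  refine Finset.sum_eq_single _ (fun ρ _ hρ => ?_) (fun h => absurd (Finset.mem_univ _) h)
  by_contra hne
  refine hρ (funext fun s => ?_)
  by_cases hs : s ∈ X
  · rw [Set.piecewise_eq_of_mem _ _ _ hs]
    by_contra hst
    exact hne (by rw [hN.eq_zero ρ τ ⟨s, Set.disjoint_left.1 hXY hs, hst⟩, mul_zero])
  · rw [Set.piecewise_eq_of_notMem _ _ _ hs]
    by_contra hst
    exact hne (by rw [hM.eq_zero σ ρ ⟨s, hs, Ne.symm hst⟩, zero_mul])

theorem SupportedOn.commute {X Y : Set (Site L n)} (hXY : Disjoint X Y) {M N : Op L n d}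
    (hM : SupportedOn X M) (hN : SupportedOn Y N) : Commute M N := by
  classical
  ext σ τ
  rw [hM.mul_apply hXY hN, hN.mul_apply hXY.symm hM, mul_comm]
  have hX : ∀ s ∈ X, s ∉ Y := fun s hs => Set.disjoint_left.1 hXY hs
  have hY : ∀ s ∈ Y, s ∉ X := fun s hs hs' => hX s hs' hs
  by_cases hc : ∀ s, s ∉ X → s ∉ Y → σ s = τ s
  · congr 1
    · refine hN.congr _ _ _ _ ?_ ?_ ?_ ?_
      · intro s hs
        by_cases hsX : s ∈ X <;> simp [hsX]
        exact hc s hsX hs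
      · intro s hs; simp [hs]
      · intro s hs; simp [hY s hs]
      · intro s hs; simp [hs]
    · refine hM.congr _ _ _ _ ?_ ?_ ?_ ?_
      · intro s hs; simp [hs]
      · intro s hs
        by_cases hsY : s ∈ Y <;> simp [hsY]
        exact hc s hs hsY
      · intro s hs; simp [hX s hs]
      · intro s hs; simp [hs]
  · push Not at hc
    obtain ⟨s, hsX, hsY, hst⟩ := hc
    rw [hN.eq_zero _ _ ⟨s, hsY, by simpa [hsX] using hst⟩,
      hM.eq_zero (Y.piecewise τ σ) τ ⟨s, hsX, by simpa [hsY] using hst⟩]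
    exact (zero_mul _).trans (mul_zero _).symm

/-- The operators generated by those acting nontrivially only on the sites in `X`. -/
noncomputable def supportAlgebra (d : ℕ) (X : Set (Site L n)) :
    Subalgebra ℂ (State L n d →L[ℂ] State L n d) :=
  Algebra.adjoin ℂ (Matrix.toEuclideanCLM (n := Config L n d) (𝕜 := ℂ) '' {M | SupportedOn X M})

theorem SupportedOn.mem_supportAlgebra {X : Set (Site L n)} {M : Op L n d}
    (hM : SupportedOn X M) :
    Matrix.toEuclideanCLM (n := Config L n d) (𝕜 := ℂ) M ∈ supportAlgebra d X :=
  Algebra.subset_adjoin ⟨M, hM, rfl⟩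

theorem supportAlgebra_mono {X Y : Set (Site L n)} (hXY : X ⊆ Y) :
    supportAlgebra d X ≤ supportAlgebra d Y :=
  Algebra.adjoin_mono (Set.image_mono fun _ hM => hM.mono hXY)

theorem commute_of_mem_supportAlgebra {X Y : Set (Site L n)} (hXY : Disjoint X Y)
    {a b : State L n d →L[ℂ] State L n d} (ha : a ∈ supportAlgebra d X)
    (hb : b ∈ supportAlgebra d Y) : Commute a b := by
  refine Algebra.commute_of_mem_adjoin_of_forall_mem_commute hb ?_
  rintro _ ⟨N, hN, rfl⟩
  refine (Algebra.commute_of_mem_adjoin_of_forall_mem_commute ha ?_).symm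
  rintro _ ⟨M, hM, rfl⟩
  exact ((hM.commute hXY hN).map
    (Matrix.toEuclideanCLM (n := Config L n d) (𝕜 := ℂ))).symm

open Classical in
/-- An operator supported on `X` maps `f * g` to `f' * g` when `g` does not depend on `X`. -/
theorem exists_apply_eq_mul {X : Set (Site L n)} {a : State L n d →L[ℂ] State L n d}
    (ha : a ∈ supportAlgebra d X) :
    ∀ f : Config L n d → ℂ, DependsOn f X → ∃ f' : Config L n d → ℂ, DependsOn f' X ∧
      ∀ (g : Config L n d → ℂ), DependsOn g Xᶜ → ∀ ψ : State L n d, (∀ σ, ψ σ = f σ * g σ) →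
        ∀ σ, a ψ σ = f' σ * g σ := by
  induction ha using Algebra.adjoin_induction with
  | mem x hx =>
    obtain ⟨M, hM, rfl⟩ := hx
    intro f hf
    refine ⟨fun σ => ∑ x : X → Fin d, M σ (fun s => if hs : s ∈ X then x ⟨s, hs⟩ else σ s)
      * f (fun s => if hs : s ∈ X then x ⟨s, hs⟩ else σ s), ?_, ?_⟩
    · intro σ σ' hσ
      refine Finset.sum_congr rfl fun x _ => ?_
      congr 1
      · refine hM.congr _ _ _ _ ?_ ?_ hσ ?_
        · intro s hs; simp [hs]
        · intro s hs; simp [hs]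
        · intro s hs; simp [hs]
      · exact hf fun s hs => by simp [hs]
    · intro g hg ψ hψ σ
      have h1 : (Matrix.toEuclideanCLM (n := Config L n d) (𝕜 := ℂ) M ψ) σ
          = ∑ τ, M σ τ * ψ τ := rfl
      rw [h1, Finset.sum_mul]
      symm
      refine Fintype.sum_of_injective
        (fun (x : X → Fin d) s => if hs : s ∈ X then x ⟨s, hs⟩ else σ s) ?_ _ _ ?_ ?_
      · intro x y hxy
        funext s
        have := congrFun hxy s.1
        simpa using this
      · intro τ hτ
        rw [hM.eq_zero, zero_mul]
        by_contra hcon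
        push Not at hcon
        refine hτ ⟨fun s => τ s, funext fun s => ?_⟩
        by_cases hs : s ∈ X <;> simp [hs]
        exact hcon s hs
      · intro x
        rw [hψ, mul_assoc]
        congr 2
        exact hg fun s hs => by simp [show s ∉ X from hs]
  | algebraMap r =>
    intro f hf
    refine ⟨fun σ => r * f σ, fun σ τ h => by simp only [hf h], fun g _ ψ hψ σ => ?_⟩
    rw [Algebra.algebraMap_eq_smul_one]
    simp [hψ, mul_assoc]
  | add x y _ _ hx hy =>
    intro f hf
    obtain ⟨f₁, hf₁, h₁⟩ := hx f hf
    obtain ⟨f₂, hf₂, h₂⟩ := hy f hf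
    refine ⟨fun σ => f₁ σ + f₂ σ, fun σ τ h => by simp only [hf₁ h, hf₂ h],
      fun g hg ψ hψ σ => ?_⟩
    rw [add_mul, ← h₁ g hg ψ hψ, ← h₂ g hg ψ hψ]
    rfl
  | mul x y _ _ hx hy =>
    intro f hf
    obtain ⟨f₁, hf₁, h₁⟩ := hy f hf
    obtain ⟨f₂, hf₂, h₂⟩ := hx f₁ hf₁
    exact ⟨f₂, hf₂, fun g hg ψ hψ σ => h₂ g hg (y ψ) (h₁ g hg ψ hψ) σ⟩

theorem productVectors_compl (X : Set (Site L n)) :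
    productVectors L n d Xᶜ = productVectors L n d X := by
  ext ψ
  constructor
  · rintro ⟨f, g, hf, hg, h⟩
    exact ⟨g, f, by rwa [compl_compl] at hg, hf, fun σ => by rw [h, mul_comm]⟩
  · rintro ⟨f, g, hf, hg, h⟩
    exact ⟨g, f, hg, by rwa [compl_compl], fun σ => by rw [h, mul_comm]⟩

theorem apply_mem_productVectors {X : Set (Site L n)} {a : State L n d →L[ℂ] State L n d}
    (ha : a ∈ supportAlgebra d X) {ψ : State L n d} (hψ : ψ ∈ productVectors L n d X) :
    a ψ ∈ productVectors L n d X := by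
  obtain ⟨f, g, hf, hg, h⟩ := hψ
  obtain ⟨f', hf', h'⟩ := exists_apply_eq_mul ha f hf
  exact ⟨f', g, hf', hg, h' g hg ψ h⟩

theorem productSet_apply_mem_productVectors {X : Set (Site L n)}
    {a : State L n d →L[ℂ] State L n d}
    (ha : a ∈ productSet (supportAlgebra d X) (supportAlgebra d Xᶜ)) {ψ : State L n d}
    (hψ : ψ ∈ productVectors L n d X) : a ψ ∈ productVectors L n d X := by
  obtain ⟨b, hb, c, hc, rfl⟩ := ha
  refine apply_mem_productVectors hb ?_
  rw [← productVectors_compl] at hψ ⊢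
  exact apply_mem_productVectors hc hψ

open Classical in
/-- Changing the cut by the sites in `Z` costs a factor `d ^ |Z|` in the Schmidt rank. -/
theorem sumLE_productVectors_of_symmDiff {X Y Z : Set (Site L n)} (hZ : symmDiff X Y ⊆ Z)
    {m : ℕ} (hm : Nat.card Z ≤ m) (hd : 1 ≤ d) {ψ : State L n d}
    (hψ : ψ ∈ productVectors L n d X) :
    SumLE (productVectors L n d Y) (d ^ m) ψ := by
  obtain ⟨f, g, hf, hg, h⟩ := hψ
  set ov : (Z → Fin d) → Config L n d → Config L n d :=
    fun z σ s => if hs : s ∈ Z then z ⟨s, hs⟩ else σ s with hov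
  -- The values on `Z` are frozen to `z`. The factors `f` and `g` then no longer see `Z`, and the
  -- indicator of `z` splits between the two sides of the new cut.
  set ψz : (Z → Fin d) → State L n d := fun z => WithLp.toLp 2 fun σ =>
    ((if ∀ s : Z, s.1 ∈ Y → σ s = z s then 1 else 0) * f (ov z σ)) *
      ((if ∀ s : Z, s.1 ∉ Y → σ s = z s then 1 else 0) * g (ov z σ)) with hψz
  have hsum : ψ = ∑ z, ψz z := by
    ext σ
    rw [WithLp.ofLp_sum, Finset.sum_apply, Finset.sum_eq_single (fun s : Z => σ s)]
    · have h1 : ov (fun s => σ s) σ = σ := by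
        funext s
        by_cases hs : s ∈ Z <;> simp [hov, hs]
      simp [hψz, h1, h]
    · intro z _ hz
      have : ∃ s : Z, σ s ≠ z s := by
        by_contra hcon
        push Not at hcon
        exact hz (funext fun s => (hcon s).symm)
      obtain ⟨s, hs⟩ := this
      by_cases hsY : s.1 ∈ Y
      · have : ¬ ∀ s : Z, s.1 ∈ Y → σ s = z s := fun h => hs (h s hsY)
        simp only [hψz, if_neg this, zero_mul]
      · have : ¬ ∀ s : Z, s.1 ∉ Y → σ s = z s := fun h => hs (h s hsY)
        simp only [hψz, if_neg this, zero_mul, mul_zero]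
    · simp
  have hXY : ∀ s, s ∉ Z → (s ∈ X ↔ s ∈ Y) := by
    intro s hs
    have : s ∉ symmDiff X Y := fun h => hs (hZ h)
    rw [Set.mem_symmDiff] at this
    tauto
  have hmem : ∀ z, ψz z ∈ productVectors L n d Y := by
    intro z
    refine ⟨_, _, ?_, ?_, fun σ => rfl⟩
    · intro σ τ hστ
      have h1 : (∀ s : Z, s.1 ∈ Y → σ s = z s) ↔ ∀ s : Z, s.1 ∈ Y → τ s = z s :=
        forall_congr' fun s => forall_congr' fun hs => by rw [hστ s hs]
      have h2 : f (ov z σ) = f (ov z τ) := hf fun s hs => by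
        by_cases hsZ : s ∈ Z
        · simp [hov, hsZ]
        · simp [hov, hsZ, hστ s ((hXY s hsZ).1 hs)]
      simp only [h1, h2]
    · intro σ τ hστ
      have h1 : (∀ s : Z, s.1 ∉ Y → σ s = z s) ↔ ∀ s : Z, s.1 ∉ Y → τ s = z s :=
        forall_congr' fun s => forall_congr' fun hs => by rw [hστ s hs]
      have h2 : g (ov z σ) = g (ov z τ) := hg fun s hs => by
        by_cases hsZ : s ∈ Z
        · simp [hov, hsZ]
        · simp [hov, hsZ, hστ s (fun h' => hs ((hXY s hsZ).2 h'))]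
      simp only [h1, h2]
  rw [hsum]
  refine (SumLE.sum Finset.univ (fun _ => 1) ψz fun z _ => SumLE.of_mem (hmem z)).mono
    subset_rfl ?_
  rw [Finset.sum_const, smul_eq_mul, mul_one, Finset.card_univ, Fintype.card_fun, Fintype.card_fin,
    ← Nat.card_eq_fintype_card]
  exact Nat.pow_le_pow_right hd hm

open Classical in
/-- An operator on `Y ∪ Z` is a sum of `d ^ (2 |Y|)` products of operators on `Y` and on `Z`. -/
theorem SupportedOn.sumLE_productSet {Y Z : Set (Site L n)} (hYZ : Disjoint Y Z) {M : Op L n d}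
    (hM : SupportedOn (Y ∪ Z) M) {m : ℕ} (hm : Nat.card Y ≤ m) (hd : 1 ≤ d) :
    SumLE (productSet (supportAlgebra d Y) (supportAlgebra d Z)) (d ^ (2 * m))
      (Matrix.toEuclideanCLM (n := Config L n d) (𝕜 := ℂ) M) := by
  set ov : (Y → Fin d) → Config L n d → Config L n d :=
    fun z σ s => if hs : s ∈ Y then z ⟨s, hs⟩ else σ s with hov
  -- Expansion in matrix units on `Y`: `U u` is the matrix unit and `V u` is the block of `M` with
  -- its `Y` indices frozen to `u`.
  set U : (Y → Fin d) × (Y → Fin d) → Op L n d := fun u => Matrix.of fun σ τ =>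
    if (∀ s, s ∉ Y → σ s = τ s) ∧ (∀ s : Y, σ s = u.1 s) ∧ (∀ s : Y, τ s = u.2 s) then 1 else 0
    with hU
  set V : (Y → Fin d) × (Y → Fin d) → Op L n d := fun u => Matrix.of fun σ τ =>
    if ∀ s, s ∉ Z → σ s = τ s then M (ov u.1 σ) (ov u.2 τ) else 0 with hV
  have hUs : ∀ u, SupportedOn Y (U u) := by
    intro u
    constructor
    · rintro σ τ ⟨s, hs, hst⟩
      simp only [hU, Matrix.of_apply]
      exact if_neg fun h => hst (h.1 s hs)
    · intro σ τ σ' τ' h1 h2 h3 h4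
      have e1 : (∀ s : Y, σ s = u.1 s) ↔ ∀ s : Y, σ' s = u.1 s :=
        forall_congr' fun s => by rw [h3 s s.2]
      have e2 : (∀ s : Y, τ s = u.2 s) ↔ ∀ s : Y, τ' s = u.2 s :=
        forall_congr' fun s => by rw [h4 s s.2]
      have e3 : (∀ s, s ∉ Y → σ s = τ s) ↔ ∀ s, s ∉ Y → σ' s = τ' s := iff_of_true h1 h2
      simp only [hU, Matrix.of_apply, e1, e2, e3]
  have hVs : ∀ u, SupportedOn Z (V u) := by
    intro u
    constructor
    · rintro σ τ ⟨s, hs, hst⟩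
      simp only [hV, Matrix.of_apply]
      exact if_neg fun h => hst (h s hs)
    · intro σ τ σ' τ' h1 h2 h3 h4
      simp only [hV, Matrix.of_apply]
      rw [if_pos h1, if_pos h2]
      refine hM.congr _ _ _ _ ?_ ?_ ?_ ?_
      · intro s hs
        simp only [Set.mem_union, not_or] at hs
        simp [hov, hs.1, h1 s hs.2]
      · intro s hs
        simp only [Set.mem_union, not_or] at hs
        simp [hov, hs.1, h2 s hs.2]
      · intro s hs
        by_cases hsY : s ∈ Y
        · simp [hov, hsY]
        · simp [hov, hsY, h3 s (hs.resolve_left hsY)]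
      · intro s hs
        by_cases hsY : s ∈ Y
        · simp [hov, hsY]
        · simp [hov, hsY, h4 s (hs.resolve_left hsY)]
  have hsum : M = ∑ u, U u * V u := by
    ext σ τ
    rw [Matrix.sum_apply, Finset.sum_eq_single ((fun s : Y => σ s), (fun s : Y => τ s))]
    · rw [(hUs _).mul_apply hYZ (hVs _)]
      have h1 : U ((fun s : Y => σ s), (fun s : Y => τ s)) σ (Y.piecewise τ σ) = 1 := by
        simp only [hU, Matrix.of_apply]
        refine if_pos ⟨fun s hs => by simp [hs], fun s => by trivial, fun s => by simp⟩
      have h2 : ov (fun s : Y => σ s) (Y.piecewise τ σ) = σ := by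
        funext s
        by_cases hs : s ∈ Y <;> simp [hov, hs]
      have h3 : ov (fun s : Y => τ s) τ = τ := by
        funext s
        by_cases hs : s ∈ Y <;> simp [hov, hs]
      rw [h1, one_mul]
      simp only [hV, Matrix.of_apply, h2, h3]
      split_ifs with hc
      · rfl
      · push Not at hc
        obtain ⟨s, hs, hst⟩ := hc
        have hsY : s ∉ Y := fun hsY => hst (by simp [hsY])
        exact hM.eq_zero _ _ ⟨s, by simp [hs, hsY], by simpa [hsY] using hst⟩
    · intro u _ hu
      rw [(hUs _).mul_apply hYZ (hVs _)]
      have h1 : U u σ (Y.piecewise τ σ) = 0 := by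
        simp only [hU, Matrix.of_apply]
        refine if_neg fun h => hu (Prod.ext (funext fun s => (h.2.1 s).symm) (funext fun s => ?_))
        have := h.2.2 s
        simpa using this.symm
      rw [h1, zero_mul]
    · simp
  rw [hsum, map_sum]
  refine (SumLE.sum Finset.univ (fun _ => 1) _ fun u _ => SumLE.of_mem ?_).mono subset_rfl ?_
  · exact ⟨_, (hUs u).mem_supportAlgebra, _, (hVs u).mem_supportAlgebra, map_mul _ _ _⟩
  · rw [Finset.sum_const, smul_eq_mul, mul_one, Finset.card_univ, Fintype.card_prod,
      Fintype.card_fun, Fintype.card_fin, ← Nat.card_eq_fintype_card, ← pow_add, ← two_mul]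
    exact Nat.pow_le_pow_right hd (by omega)

end Support

/-! ### Ground projections as kernel projections of sums of terms. -/

section KernelProjection

variable {E : Type*} [NormedAddCommGroup E] [InnerProductSpace ℂ E] [FiniteDimensional ℂ E]
  {ι : Type*} {h : ι → E →L[ℂ] E}

theorem inner_starProjection_re {P : E →L[ℂ] E} (hP : IsStarProjection P) (v : E) :
    (inner ℂ v (P v)).re = ‖P v‖ ^ 2 := by
  have h1 : inner ℂ v (P v) = inner ℂ (P v) (P v) := by
    have hsa := ContinuousLinearMap.isSelfAdjoint_iff'.1 hP.isSelfAdjoint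
    calc inner ℂ v (P v) = inner ℂ v (P (P v)) := by rw [starProjection_apply_apply hP]
      _ = inner ℂ (P v) (P v) := by rw [← ContinuousLinearMap.adjoint_inner_left, hsa]
  rw [h1, inner_self_eq_norm_sq_to_K]
  norm_cast

/-- Each term is positive, so a vector in the kernel of the sum has zero energy in every term. -/
theorem kerProj_sum_eq_groundProj (hp : ∀ a, IsStarProjection (h a)) (S : Finset ι) :
    kerProj (∑ a ∈ S, h a) = groundProj h (S : Set ι) := by
  have : LinearMap.ker ((∑ a ∈ S, h a : E →L[ℂ] E) : E →ₗ[ℂ] E) = groundSpace h (S : Set ι) := by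
    ext v
    rw [LinearMap.mem_ker, mem_groundSpace]
    constructor
    · intro hv
      have h1 : (inner ℂ v ((∑ a ∈ S, h a : E →L[ℂ] E) v)).re = ∑ a ∈ S, ‖h a v‖ ^ 2 := by
        rw [_root_.sum_apply, inner_sum, Complex.re_sum]
        exact Finset.sum_congr rfl fun a _ => inner_starProjection_re (hp a) v
      have hv' : (∑ a ∈ S, h a : E →L[ℂ] E) v = 0 := hv
      rw [hv', inner_zero_right, Complex.zero_re] at h1
      intro a ha
      have h2 := (Finset.sum_eq_zero_iff_of_nonneg fun a _ => sq_nonneg ‖h a v‖).1 h1.symm a ha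
      simpa using h2
    · intro hv
      change (∑ a ∈ S, h a : E →L[ℂ] E) v = 0
      rw [_root_.sum_apply]
      exact Finset.sum_eq_zero fun a ha => hv a ha
  simp only [kerProj, this, groundProj]

theorem isSelfAdjoint_sum_of_projections (hp : ∀ a, IsStarProjection (h a)) (S : Finset ι) :
    IsSelfAdjoint (∑ a ∈ S, h a) :=
  isSelfAdjoint_sum S fun a _ => (hp a).isSelfAdjoint

theorem groundProj_mem_subalgebra [Fintype ι] (hp : ∀ a, IsStarProjection (h a)) {S : Set ι}
    {B : Subalgebra ℂ (E →L[ℂ] E)} (hB : ∀ a ∈ S, h a ∈ B) : groundProj h S ∈ B := by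
  classical
  have h1 : (S.toFinset : Set ι) = S := Set.coe_toFinset S
  rw [← h1, ← kerProj_sum_eq_groundProj hp]
  have h2 : Algebra.adjoin ℂ {∑ a ∈ S.toFinset, h a} ≤ B := by
    rw [Algebra.adjoin_le_iff, Set.singleton_subset_iff]
    exact B.sum_mem fun a ha => hB a (by simpa using ha)
  exact h2 (kerProj_mem_adjoin (isSelfAdjoint_sum_of_projections hp _))

theorem commute_groundProj [Fintype ι] (hp : ∀ a, IsStarProjection (h a)) {S S' : Set ι}
    (hc : ∀ a ∈ S, ∀ b ∈ S', Commute (h a) (h b)) :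
    Commute (groundProj h S) (groundProj h S') := by
  have h1 : ∀ a ∈ S, Commute (h a) (groundProj h S') := by
    intro a ha
    have := groundProj_mem_subalgebra hp (S := S') (B := Subalgebra.centralizer ℂ {h a})
      fun b hb => by
        rw [Subalgebra.mem_centralizer_iff]
        rintro _ rfl
        exact (hc a ha b hb).eq
    exact (Subalgebra.mem_centralizer_iff ℂ).1 this _ rfl
  have := groundProj_mem_subalgebra hp (S := S)
    (B := Subalgebra.centralizer ℂ {groundProj h S'}) fun a ha => by
      rw [Subalgebra.mem_centralizer_iff]
      rintro _ rfl
      exact (h1 a ha).symm.eq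
  exact Commute.symm ((Subalgebra.mem_centralizer_iff ℂ).1 this _ rfl)

/-- A polynomial in `T` with constant term `1` acts trivially on the kernel of `T`. -/
theorem aeval_mul_kerProj {T : E →L[ℂ] E} (hT : IsSelfAdjoint T) {p : Polynomial ℂ}
    (hp0 : p.eval 0 = 1) : Polynomial.aeval T p * kerProj T = kerProj T ∧
      kerProj T * Polynomial.aeval T p = kerProj T := by
  have h1 : Polynomial.aeval T p * kerProj T = kerProj T := by
    ext v
    have h2 : T (kerProj T v) = (0 : ℂ) • kerProj T v := by
      rw [zero_smul]
      exact LinearMap.mem_ker.1 (Submodule.starProjection_apply_mem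
        (LinearMap.ker (T : E →ₗ[ℂ] E)) v)
    have := aeval_apply_of_apply_eq_smul h2 p
    rwa [hp0, one_smul] at this
  refine ⟨h1, ?_⟩
  have h3 : Commute (Polynomial.aeval T p) (kerProj T) := by
    refine Algebra.commute_of_mem_adjoin_singleton_of_commute (R := ℂ) (kerProj_mem_adjoin hT) ?_
    exact (Polynomial.aeval_mem_adjoin_singleton ℂ T (p := p)) |> fun hm =>
      (Algebra.commute_of_mem_adjoin_self hm).symm
  rw [← h3.eq, h1]

end KernelProjection

/-! ### The coarse-grained Hamiltonian of a row block and its spectral gap. -/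

section Strip

variable {E : Type*} [NormedAddCommGroup E] [InnerProductSpace ℂ E] [FiniteDimensional ℂ E]
  {ι : Type*} [Fintype ι] {h : ι → E →L[ℂ] E} {γ : ℝ}

/-- The loss in the two-set detectability inequality. -/
noncomputable def detectionConst (γ : ℝ) : ℝ := 5 / (1 - contraction γ) ^ 2

theorem detectionConst_pos (hγ : 0 < γ) : 0 < detectionConst γ := by
  have := contraction_lt_one hγ
  have h1 : 0 < 1 - contraction γ := by linarith
  unfold detectionConst; positivity

theorem LocallyGapped.norm_sub_groundProj_union_sq_le (H : LocallyGapped h γ) (hγ : 0 < γ)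
    {S₁ S₂ : Set ι} (hS : Disjoint S₁ S₂) (v : E) :
    ‖v - groundProj h (S₁ ∪ S₂) v‖ ^ 2 ≤ detectionConst γ *
      (‖v - groundProj h S₁ v‖ ^ 2 + ‖v - groundProj h S₂ v‖ ^ 2) := by
  have hθ := contraction_lt_one hγ
  have h0 : 0 < 1 - contraction γ := by linarith
  set G := groundProj h (S₁ ∪ S₂)
  have hG : ∀ S : Set ι, S ⊆ S₁ ∪ S₂ → v - G v - groundProj h S (v - G v) = v - groundProj h S v := by
    intro S hS'
    have : groundProj h S (G v) = G v := by
      rw [← mul_apply_eq_comp, groundProj_mul_of_subset h hS']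
    rw [map_sub, this]; abel
  have h1 := detect_of_norm_mul_sub_le (groundProj_isStarProjection h S₁) hθ
    (H.norm_groundProj_mul_sub_le hγ hS) (v := v - G v) (by
      rw [map_sub, starProjection_apply_apply (groundProj_isStarProjection h _), sub_self])
  rw [hG S₁ Set.subset_union_left, hG S₂ Set.subset_union_right] at h1
  rw [detectionConst, div_mul_eq_mul_div, le_div_iff₀ (by positivity)]
  linarith

theorem LocallyGapped.norm_sub_groundProj_sq_le (H : LocallyGapped h γ) (S : Finset ι) (v : E) :
    γ * ‖v - groundProj h (S : Set ι) v‖ ^ 2 ≤ ∑ a ∈ S, ‖h a v‖ ^ 2 := by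
  have h1 := H.gap S (v - groundProj h (S : Set ι) v) (by
    rw [map_sub, starProjection_apply_apply (groundProj_isStarProjection h _), sub_self])
  refine h1.trans (le_of_eq (Finset.sum_congr rfl fun a ha => ?_))
  rw [map_sub, term_groundProj_apply (Finset.mem_coe.2 ha), sub_zero]

variable (row col : ι → ℕ)

/-- The terms of row `j` in columns before `e`. -/
def rowLeft (e j : ℕ) : Set ι := {i | row i = j ∧ col i < e}

/-- The terms of row `j` in columns from `e` on. -/
def rowRight (e j : ℕ) : Set ι := {i | row i = j ∧ e ≤ col i}

open Classical in
/-- The terms in rows `[a, a + m)` and columns `[e, e + w)`. -/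
noncomputable def stripTerms (e w a m : ℕ) : Finset ι :=
  Finset.univ.filter fun i => (a ≤ row i ∧ row i < a + m) ∧ e ≤ col i ∧ col i < e + w

open Classical in
/-- The summands of the coarse-grained Hamiltonian of the rows `[a, a + m)`: everything left of
the strip of columns `[e, e + w)`, the columns of the strip, everything right of the strip. -/
noncomputable def stripLetter (h : ι → E →L[ℂ] E) (e w a m s : ℕ) : E →L[ℂ] E :=
  if s = 0 then ∑ j ∈ Finset.Ico a (a + m), (1 - groundProj h (rowLeft row col e j))
  else if s = w + 1 then
    ∑ j ∈ Finset.Ico a (a + m), (1 - groundProj h (rowRight row col (e + w) j))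
  else ∑ i with (a ≤ row i ∧ row i < a + m) ∧ col i + 1 = e + s, h i

/-- The coarse-grained Hamiltonian of the rows `[a, a + m)`. -/
noncomputable def stripHamiltonian (h : ι → E →L[ℂ] E) (e w a m : ℕ) : E →L[ℂ] E :=
  ∑ s ∈ Finset.range (w + 2), stripLetter row col h e w a m s

theorem stripHamiltonian_eq (e w a m : ℕ) : stripHamiltonian row col h e w a m
    = ∑ j ∈ Finset.Ico a (a + m), (1 - groundProj h (rowLeft row col e j))
      + ∑ j ∈ Finset.Ico a (a + m), (1 - groundProj h (rowRight row col (e + w) j))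
      + ∑ i ∈ stripTerms row col e w a m, h i := by
  classical
  rw [stripHamiltonian, Finset.sum_range_succ, Finset.sum_range_succ']
  have h1 : stripLetter row col h e w a m 0
    = ∑ j ∈ Finset.Ico a (a + m), (1 - groundProj h (rowLeft row col e j)) := by simp [stripLetter]
  have h2 : stripLetter row col h e w a m (w + 1)
      = ∑ j ∈ Finset.Ico a (a + m), (1 - groundProj h (rowRight row col (e + w) j)) := by
    simp [stripLetter]
  have h3 : ∑ s ∈ Finset.range w, stripLetter row col h e w a m (s + 1)
      = ∑ i ∈ stripTerms row col e w a m, h i := by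
    -- Letter `s + 1` is column `e + s` of plaquettes, since letter `0` stands for everything left
    -- of the strip.
    rw [← Finset.sum_fiberwise_of_maps_to (g := fun i => col i - e) (t := Finset.range w)]
    · refine Finset.sum_congr rfl fun s hs => ?_
      have hs := Finset.mem_range.1 hs
      rw [stripLetter, if_neg (by omega), if_neg (by omega)]
      refine Finset.sum_congr ?_ fun _ _ => rfl
      ext i
      simp only [stripTerms, Finset.mem_filter, Finset.mem_univ, true_and]
      omega
    · intro i hi
      simp only [stripTerms, Finset.mem_filter] at hi
      rw [Finset.mem_range]
      omega
  rw [h1, h2, h3]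
  abel

theorem inner_stripHamiltonian_re (hp : ∀ a, IsStarProjection (h a)) (e w a m : ℕ) (v : E) :
    (inner ℂ v (stripHamiltonian row col h e w a m v)).re
      = ∑ j ∈ Finset.Ico a (a + m), ‖v - groundProj h (rowLeft row col e j) v‖ ^ 2
        + ∑ j ∈ Finset.Ico a (a + m), ‖v - groundProj h (rowRight row col (e + w) j) v‖ ^ 2
        + ∑ i ∈ stripTerms row col e w a m, ‖h i v‖ ^ 2 := by
  have hc : ∀ S : Set ι, (inner ℂ v ((1 - groundProj h S) v)).re = ‖v - groundProj h S v‖ ^ 2 :=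
    fun S => inner_starProjection_re (groundProj_isStarProjection h S).one_sub v
  rw [stripHamiltonian_eq]
  simp only [add_apply, _root_.sum_apply, inner_add_right, inner_sum, Complex.add_re,
    Complex.re_sum, hc]
  rw [Finset.sum_congr rfl fun i _ => inner_starProjection_re (hp i) v]

theorem isSelfAdjoint_stripHamiltonian (hp : ∀ a, IsStarProjection (h a)) (e w a m : ℕ) :
    IsSelfAdjoint (stripHamiltonian row col h e w a m) := by
  have hc : ∀ S : Set ι, IsSelfAdjoint (1 - groundProj h S) :=
    fun S => (groundProj_isStarProjection h S).one_sub.isSelfAdjoint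
  rw [stripHamiltonian_eq]
  exact ((isSelfAdjoint_sum _ fun j _ => hc _).add (isSelfAdjoint_sum _ fun j _ => hc _)).add
    (isSelfAdjoint_sum_of_projections hp _)

/-- Terms at distance at least two in the grid commute. -/
def CommutesAtDistance (h : ι → E →L[ℂ] E) (row col : ι → ℕ) : Prop :=
  ∀ i j, row i + 1 < row j ∨ col i + 1 < col j → Commute (h i) (h j)

variable {row col}

/-- The left and right parts of a row are separated by the strip, hence commute when `w ≥ 1` and
merge without loss. The local gap handles the strip terms, and one use of detectability merges the
two. -/
theorem LocallyGapped.norm_sub_groundProj_row_sq_le (H : LocallyGapped h γ) (hγ : 0 < γ)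
    (hc : CommutesAtDistance h row col) {w : ℕ} (hw : 1 ≤ w) (e j : ℕ) (v : E) :
    ‖v - groundProj h (rowBlock row j 1) v‖ ^ 2 ≤ detectionConst γ * (1 + γ⁻¹) *
      (‖v - groundProj h (rowLeft row col e j) v‖ ^ 2
        + ‖v - groundProj h (rowRight row col (e + w) j) v‖ ^ 2
        + ∑ i ∈ stripTerms row col e w j 1, ‖h i v‖ ^ 2) := by
  classical
  have hC := detectionConst_pos hγ
  have hrow : rowBlock row j 1 = (rowLeft row col e j ∪ rowRight row col (e + w) j)
      ∪ (stripTerms row col e w j 1 : Set ι) := by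
    ext i
    simp only [rowBlock, rowLeft, rowRight, stripTerms, Set.mem_union, Set.mem_ofPred_eq,
      Finset.coe_filter, Finset.mem_univ, true_and]
    omega
  have hdisj : Disjoint (rowLeft row col e j ∪ rowRight row col (e + w) j)
      (stripTerms row col e w j 1 : Set ι) := by
    rw [Set.disjoint_left]
    intro i
    simp only [rowLeft, rowRight, stripTerms, Set.mem_union, Set.mem_ofPred_eq,
      Finset.coe_filter, Finset.mem_univ, true_and]
    omega
  have h1 := H.norm_sub_groundProj_union_sq_le hγ hdisj v
  have h2 := H.norm_sub_groundProj_sq_le (stripTerms row col e w j 1) v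
  have hcom : Commute (groundProj h (rowLeft row col e j))
      (groundProj h (rowRight row col (e + w) j)) := by
    refine commute_groundProj H.proj fun a ha b hb => hc a b (Or.inr ?_)
    have h1 := ha.2
    have h2 := hb.2
    omega
  have h3 := norm_sub_mul_sq_le (groundProj_isStarProjection h (rowLeft row col e j))
    (Q := groundProj h (rowRight row col (e + w) j)) v
  rw [← mul_apply_eq_comp, ← groundProj_union_of_commute hcom] at h3
  rw [← hrow] at h1
  have h4 : ‖v - groundProj h (stripTerms row col e w j 1 : Set ι) v‖ ^ 2
      ≤ γ⁻¹ * ∑ i ∈ stripTerms row col e w j 1, ‖h i v‖ ^ 2 := by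
    rwa [le_inv_mul_iff₀ hγ]
  have hγi : 0 < γ⁻¹ := by positivity
  refine h1.trans ?_
  rw [mul_assoc]
  refine mul_le_mul_of_nonneg_left ?_ hC.le
  have h5 : 0 ≤ ∑ i ∈ stripTerms row col e w j 1, ‖h i v‖ ^ 2 := by positivity
  nlinarith [sq_nonneg ‖v - groundProj h (rowLeft row col e j) v‖,
    sq_nonneg ‖v - groundProj h (rowRight row col (e + w) j) v‖]

/-- Distinct rows of equal parity are at distance at least two, so their projections merge without
loss. A single two-set merge of even and odd rows then gives a constant independent of the number of
rows. -/
theorem LocallyGapped.norm_sub_groundProj_rows_sq_le (H : LocallyGapped h γ) (hγ : 0 < γ)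
    (hc : CommutesAtDistance h row col) (a m : ℕ) (v : E) :
    ‖v - groundProj h (rowBlock row a m) v‖ ^ 2 ≤ detectionConst γ *
      ∑ j ∈ Finset.Ico a (a + m), ‖v - groundProj h (rowBlock row j 1) v‖ ^ 2 := by
  classical
  set J := Finset.Ico a (a + m)
  have key : ∀ q : ℕ, ‖v - groundProj h (⋃ j ∈ J.filter (· % 2 = q), rowBlock row j 1) v‖ ^ 2
      ≤ ∑ j ∈ J.filter (· % 2 = q), ‖v - groundProj h (rowBlock row j 1) v‖ ^ 2 := by
    intro q
    refine norm_sub_groundProj_biUnion_sq_le (fun j => rowBlock row j 1) _ ?_ v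
    intro T j hT hj hjT
    refine commute_groundProj H.proj fun i hi b hb => ?_
    simp only [Set.mem_iUnion] at hb
    obtain ⟨k, hk, hb⟩ := hb
    have h1 := (Finset.mem_filter.1 (hT hk)).2
    have h2 := (Finset.mem_filter.1 hj).2
    have h3 : k ≠ j := fun h => hjT (h ▸ hk)
    simp only [rowBlock, Set.mem_ofPred_eq] at hi hb
    rcases lt_or_gt_of_ne h3 with h4 | h4
    · exact (hc b i (Or.inl (by omega))).symm
    · exact hc i b (Or.inl (by omega))
  have hU : rowBlock row a m = (⋃ j ∈ J.filter (· % 2 = 0), rowBlock row j 1)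
      ∪ ⋃ j ∈ J.filter (· % 2 = 1), rowBlock row j 1 := by
    ext i
    simp only [rowBlock, Set.mem_union, Set.mem_iUnion, Set.mem_ofPred_eq, Finset.mem_filter,
      Finset.mem_Ico, J, exists_prop]
    constructor
    · intro hi
      rcases Nat.mod_two_eq_zero_or_one (row i) with h1 | h1
      · exact Or.inl ⟨row i, ⟨hi, h1⟩, by omega⟩
      · exact Or.inr ⟨row i, ⟨hi, h1⟩, by omega⟩
    · rintro (⟨j, h1, h2⟩ | ⟨j, h1, h2⟩) <;> omega
  have hdisj : Disjoint (⋃ j ∈ J.filter (· % 2 = 0), rowBlock row j 1)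
      (⋃ j ∈ J.filter (· % 2 = 1), rowBlock row j 1) := by
    rw [Set.disjoint_left]
    intro i
    simp only [rowBlock, Set.mem_iUnion, Set.mem_ofPred_eq, Finset.mem_filter, exists_prop]
    rintro ⟨j, h1, h2⟩ ⟨k, h3, h4⟩
    omega
  have h1 := H.norm_sub_groundProj_union_sq_le hγ hdisj v
  rw [← hU] at h1
  have h2 : ∑ j ∈ J.filter (· % 2 = 0), ‖v - groundProj h (rowBlock row j 1) v‖ ^ 2
      + ∑ j ∈ J.filter (· % 2 = 1), ‖v - groundProj h (rowBlock row j 1) v‖ ^ 2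
      = ∑ j ∈ J, ‖v - groundProj h (rowBlock row j 1) v‖ ^ 2 := by
    rw [← Finset.sum_filter_add_sum_filter_not J (· % 2 = 0)]
    congr 1
    refine Finset.sum_congr (Finset.filter_congr fun j _ => ?_) fun _ _ => rfl
    omega
  refine h1.trans (mul_le_mul_of_nonneg_left ?_ (detectionConst_pos hγ).le)
  rw [← h2]
  exact add_le_add (key 0) (key 1)

/-- A lower bound for the gap of the coarse-grained Hamiltonians. -/
noncomputable def stripGap (γ : ℝ) : ℝ := (detectionConst γ ^ 2 * (1 + γ⁻¹))⁻¹

theorem stripGap_pos (hγ : 0 < γ) : 0 < stripGap γ := by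
  have := detectionConst_pos hγ
  unfold stripGap; positivity

theorem LocallyGapped.stripGap_mul_le (H : LocallyGapped h γ) (hγ : 0 < γ)
    (hc : CommutesAtDistance h row col) {w : ℕ} (hw : 1 ≤ w) (e a m : ℕ) (v : E) :
    stripGap γ * ‖v - groundProj h (rowBlock row a m) v‖ ^ 2
      ≤ (inner ℂ v (stripHamiltonian row col h e w a m v)).re := by
  classical
  have hC := detectionConst_pos hγ
  have hγi : 0 < γ⁻¹ := by positivity
  rw [stripGap, inv_mul_le_iff₀ (by positivity), inner_stripHamiltonian_re row col H.proj]
  refine (H.norm_sub_groundProj_rows_sq_le hγ hc a m v).trans ?_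
  have h1 : ∑ i ∈ stripTerms row col e w a m, ‖h i v‖ ^ 2
      = ∑ j ∈ Finset.Ico a (a + m), ∑ i ∈ stripTerms row col e w j 1, ‖h i v‖ ^ 2 := by
    rw [← Finset.sum_fiberwise_of_maps_to (g := row) (t := Finset.Ico a (a + m))]
    · refine Finset.sum_congr rfl fun j hj => Finset.sum_congr ?_ fun _ _ => rfl
      have := Finset.mem_Ico.1 hj
      ext i
      simp only [stripTerms, Finset.mem_filter, Finset.mem_univ, true_and]
      omega
    · intro i hi
      simp only [stripTerms, Finset.mem_filter] at hi
      exact Finset.mem_Ico.2 hi.2.1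
  rw [h1, ← Finset.sum_add_distrib, ← Finset.sum_add_distrib, pow_two,
    mul_assoc (detectionConst γ) (detectionConst γ), mul_assoc (detectionConst γ) (_ * _)]
  refine mul_le_mul_of_nonneg_left ?_ hC.le
  rw [Finset.mul_sum]
  refine Finset.sum_le_sum fun j _ => ?_
  exact H.norm_sub_groundProj_row_sq_le hγ hc hw e j v

theorem LocallyGapped.inner_stripHamiltonian_le (H : LocallyGapped h γ)
    (hinj : Function.Injective fun i => (row i, col i)) (e w a m : ℕ) (v : E) :
    (inner ℂ v (stripHamiltonian row col h e w a m v)).re ≤ (m * (w + 2) : ℕ) * ‖v‖ ^ 2 := by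
  classical
  rw [inner_stripHamiltonian_re row col H.proj]
  have h1 : ∀ S : Set ι, ‖v - groundProj h S v‖ ^ 2 ≤ ‖v‖ ^ 2 := fun S =>
    pow_le_pow_left₀ (norm_nonneg _)
      (starProjection_norm_compl_le (groundProj_isStarProjection h S) v) 2
  have h2 : ∀ i, ‖h i v‖ ^ 2 ≤ ‖v‖ ^ 2 := fun i =>
    pow_le_pow_left₀ (norm_nonneg _) (starProjection_norm_le (H.proj i) v) 2
  have h3 : (stripTerms row col e w a m).card ≤ m * w := by
    have : (stripTerms row col e w a m).card
        ≤ (Finset.Ico a (a + m) ×ˢ Finset.Ico e (e + w)).card := by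
      refine Finset.card_le_card_of_injOn (fun i => (row i, col i)) ?_ hinj.injOn
      intro i hi
      simp only [stripTerms, Finset.coe_filter, Set.mem_ofPred_eq, Finset.mem_univ, true_and] at hi
      simpa using hi
    simpa using this
  calc _ ≤ ∑ j ∈ Finset.Ico a (a + m), ‖v‖ ^ 2 + ∑ j ∈ Finset.Ico a (a + m), ‖v‖ ^ 2
        + ∑ i ∈ stripTerms row col e w a m, ‖v‖ ^ 2 :=
        add_le_add (add_le_add (Finset.sum_le_sum fun j _ => h1 _)
          (Finset.sum_le_sum fun j _ => h1 _)) (Finset.sum_le_sum fun i _ => h2 i)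
    _ = (m + m + (stripTerms row col e w a m).card : ℝ) * ‖v‖ ^ 2 := by
        simp [Finset.sum_const]; ring
    _ ≤ (m * (w + 2) : ℕ) * ‖v‖ ^ 2 := by
        gcongr
        have : ((stripTerms row col e w a m).card : ℝ) ≤ m * w := by exact_mod_cast h3
        push_cast
        linarith

/-- The gap inequality puts the kernel inside the ground space of the block; conversely a ground
state of the block is fixed by every coarser projection. -/
theorem LocallyGapped.kerProj_stripHamiltonian (H : LocallyGapped h γ) (hγ : 0 < γ)
    (hc : CommutesAtDistance h row col) {w : ℕ} (hw : 1 ≤ w) (e a m : ℕ) :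
    kerProj (stripHamiltonian row col h e w a m) = groundProj h (rowBlock row a m) := by
  have : LinearMap.ker (stripHamiltonian row col h e w a m : E →ₗ[ℂ] E)
      = groundSpace h (rowBlock row a m) := by
    ext v
    rw [LinearMap.mem_ker]
    constructor
    · intro hv
      have hv' : stripHamiltonian row col h e w a m v = 0 := hv
      have h1 := H.stripGap_mul_le hγ hc hw e a m v
      rw [hv', inner_zero_right, Complex.zero_re] at h1
      have h2 : ‖v - groundProj h (rowBlock row a m) v‖ ^ 2 ≤ 0 := by
        by_contra hcon
        have := mul_pos (stripGap_pos hγ) (not_le.1 hcon)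
        linarith
      have h3 : v - groundProj h (rowBlock row a m) v = 0 := by
        rw [← norm_eq_zero]; nlinarith [norm_nonneg (v - groundProj h (rowBlock row a m) v)]
      rw [mem_groundSpace]
      exact groundProj_apply_eq_self_iff.1 (sub_eq_zero.1 h3).symm
    · intro hv
      rw [mem_groundSpace] at hv
      have h1 : ∀ S ⊆ rowBlock row a m, groundProj h S v = v := fun S hS =>
        groundProj_apply_eq_self_iff.2 fun i hi => hv i (hS hi)
      change stripHamiltonian row col h e w a m v = 0
      rw [stripHamiltonian_eq]
      simp only [add_apply, _root_.sum_apply]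
      rw [Finset.sum_eq_zero, Finset.sum_eq_zero, Finset.sum_eq_zero]
      · simp
      · intro i hi
        simp only [stripTerms, Finset.mem_filter] at hi
        exact hv i hi.2.1
      · intro j hj
        have hj := Finset.mem_Ico.1 hj
        rw [sub_apply, h1 _ fun i hi => by
          simp only [rowRight, rowBlock, Set.mem_ofPred_eq] at hi ⊢; omega]
        exact sub_self v
      · intro j hj
        have hj := Finset.mem_Ico.1 hj
        rw [sub_apply, h1 _ fun i hi => by
          simp only [rowLeft, rowBlock, Set.mem_ofPred_eq] at hi ⊢; omega]
        exact sub_self v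
  simp only [kerProj, this, groundProj]

theorem LocallyGapped.eigenvalue_stripHamiltonian (H : LocallyGapped h γ) (hγ : 0 < γ)
    (hc : CommutesAtDistance h row col) (hinj : Function.Injective fun i => (row i, col i))
    {w : ℕ} (hw : 1 ≤ w) (e a m : ℕ) {μ : ℝ} (hμ : μ ≠ 0)
    (hev : Module.End.HasEigenvalue (stripHamiltonian row col h e w a m : E →ₗ[ℂ] E) (μ : ℂ)) :
    stripGap γ ≤ μ ∧ μ ≤ (m * (w + 2) : ℕ) := by
  obtain ⟨v, hv⟩ := hev.exists_hasEigenvector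
  set T := stripHamiltonian row col h e w a m
  have hT : IsSelfAdjoint T := isSelfAdjoint_stripHamiltonian row col H.proj e w a m
  have h1 : T v = (μ : ℂ) • v := hv.apply_eq_smul
  have hv0 : 0 < ‖v‖ ^ 2 := by have := norm_pos_iff.2 hv.2; positivity
  have h2 : (inner ℂ v (T v)).re = μ * ‖v‖ ^ 2 := by
    rw [h1, inner_smul_right, inner_self_eq_norm_sq_to_K, Complex.re_ofReal_mul]
    norm_cast
  have h3 : groundProj h (rowBlock row a m) v = 0 := by
    rw [← H.kerProj_stripHamiltonian hγ hc hw e a m, kerProj,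
      Submodule.starProjection_apply_eq_zero_iff, Submodule.mem_orthogonal]
    intro u hu
    have h4 : T u = 0 := hu
    have h5 : inner ℂ u (T v) = 0 := by
      have hsa := ContinuousLinearMap.isSelfAdjoint_iff'.1 hT
      rw [← ContinuousLinearMap.adjoint_inner_left, hsa, h4, inner_zero_left]
    rw [h1, inner_smul_right] at h5
    exact (mul_eq_zero.1 h5).resolve_left (by exact_mod_cast hμ)
  constructor
  · have h4 := H.stripGap_mul_le hγ hc hw e a m v
    rw [h3, sub_zero, h2] at h4
    exact le_of_mul_le_mul_right h4 hv0
  · have h4 := H.inner_stripHamiltonian_le hinj e w a m v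
    rw [h2] at h4
    exact le_of_mul_le_mul_right h4 hv0

/-- Chebyshev polynomials of the coarse-grained Hamiltonians approximate the ground state
projections of blocks of rows. -/
theorem LocallyGapped.exists_polynomial_hasApprox (H : LocallyGapped h γ) (hγ : 0 < γ)
    (hc : CommutesAtDistance h row col) (hinj : Function.Injective fun i => (row i, col i))
    {w l s : ℕ} (hw : 1 ≤ w) (hl : 1 ≤ l) (e r : ℕ) (hγ1 : stripGap γ ≤ 1)
    (hs : (2 * l * (w + 2) : ℕ) ≤ s ^ 2 * stripGap γ) :
    ∃ p : Polynomial ℂ, p.natDegree ≤ s * (r + 4) ∧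
      HasApprox (fun a => Polynomial.aeval (stripHamiltonian row col h e w a (2 * l)) p)
        (fun a m => groundProj h (rowBlock row a m)) l 1 1 ((1 / 2) ^ r / 16) := by
  have hΛ : stripGap γ < (2 * l * (w + 2) : ℕ) := by
    refine hγ1.trans_lt ?_
    have : 1 < 2 * l * (w + 2) := by nlinarith
    exact_mod_cast this
  -- The four extra powers of `1/2` supply the factor `1/16` that starts the recursion.
  obtain ⟨p, hp1, hp2, hp3⟩ := exists_polynomial_small_on_interval (stripGap_pos hγ) hΛ s (r + 4) hs
  refine ⟨p, hp1, fun a => ?_⟩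
  set T := stripHamiltonian row col h e w a (2 * l)
  have hT : IsSelfAdjoint T := isSelfAdjoint_stripHamiltonian row col H.proj e w a (2 * l)
  have hG := H.kerProj_stripHamiltonian hγ hc hw e a (2 * l)
  obtain ⟨h1, h2⟩ := aeval_mul_kerProj hT hp2
  rw [hG] at h1 h2
  refine ⟨Polynomial.aeval T p, SumLE.of_mem ⟨1, [a], by simp, by simp [T]⟩, h1, h2, ?_⟩
  have h3 := norm_aeval_sub_kerProj_le hT hp2 (ε := (1 / 2) ^ (r + 4)) (by positivity)
    fun μ hμ hev => by
      obtain ⟨h4, h5⟩ := H.eigenvalue_stripHamiltonian hγ hc hinj hw e a (2 * l) hμ hev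
      exact hp3 μ h4 h5
  rw [hG] at h3
  refine h3.trans (le_of_eq ?_)
  rw [pow_add]; norm_num; ring

end Strip

/-! ### The plaquette Hamiltonian as an instance of the abstract setting. -/

section Grid

variable {L n d : ℕ}

/-- The local terms as operators on the Hilbert space. -/
noncomputable def localTerm (h : Fin (L - 1) → Fin n → Op L n d) (p : Fin (L - 1) × Fin n) :
    State L n d →L[ℂ] State L n d :=
  Matrix.toEuclideanCLM (n := Config L n d) (𝕜 := ℂ) (h p.1 p.2)

/-- The row of a plaquette. -/
def plaquetteRow (p : Fin (L - 1) × Fin n) : ℕ := p.2.val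

/-- The column of a plaquette. -/
def plaquetteCol (p : Fin (L - 1) × Fin n) : ℕ := p.1.val

theorem injective_plaquetteRow_plaquetteCol : Function.Injective
    fun p : Fin (L - 1) × Fin n => (plaquetteRow p, plaquetteCol p) := by
  rintro ⟨i, j⟩ ⟨i', j'⟩ hp
  simp only [plaquetteRow, plaquetteCol, Prod.mk.injEq] at hp
  exact Prod.ext (Fin.ext hp.2) (Fin.ext hp.1)

variable {h : Fin (L - 1) → Fin n → Op L n d}

theorem IsPlaquetteProjectors.supportedOn (hh : IsPlaquetteProjectors h)
    (p : Fin (L - 1) × Fin n) :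
    SupportedOn (plaquette L n (plaquetteCol p) (plaquetteRow p)) (h p.1 p.2) :=
  (hh.actsOnlyOn p.1 p.2).supportedOn

theorem IsPlaquetteProjectors.isStarProjection (hh : IsPlaquetteProjectors h)
    (p : Fin (L - 1) × Fin n) : IsStarProjection (localTerm h p) := by
  constructor
  · change localTerm h p * localTerm h p = localTerm h p
    rw [localTerm, ← map_mul, hh.mul_self]
  · change star (localTerm h p) = localTerm h p
    rw [localTerm, ← map_star, Matrix.star_eq_conjTranspose, (hh.isHermitian p.1 p.2).eq]

theorem IsPlaquetteProjectors.commutesAtDistance (hh : IsPlaquetteProjectors h) :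
    CommutesAtDistance (localTerm h) plaquetteRow plaquetteCol := by
  intro p q hpq
  refine ((hh.supportedOn p).commute ?_ (hh.supportedOn q)).map
    (Matrix.toEuclideanCLM (n := Config L n d) (𝕜 := ℂ))
  rw [Set.disjoint_left]
  intro s
  simp only [plaquette, Set.mem_ofPred_eq]
  omega

theorem hasEigenvalue_sum_localTerm {S : Finset (Fin (L - 1) × Fin n)} {μ : ℂ}
    (hμ : Module.End.HasEigenvalue
      ((∑ p ∈ S, localTerm h p : State L n d →L[ℂ] State L n d) : State L n d →ₗ[ℂ] State L n d) μ) :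
    Module.End.HasEigenvalue (Matrix.toEuclideanLin (partialHamiltonian h S) :
      State L n d →ₗ[ℂ] State L n d) μ := by
  have : (∑ p ∈ S, localTerm h p)
      = Matrix.toEuclideanCLM (n := Config L n d) (𝕜 := ℂ) (partialHamiltonian h S) := by
    rw [partialHamiltonian, map_sum]; rfl
  rwa [this, Matrix.coe_toEuclideanCLM_eq_toEuclideanLin] at hμ

theorem IsPlaquetteProjectors.locallyGapped (hh : IsPlaquetteProjectors h) {γ₀ : ℝ}
    (hγ : (γ₀ : EReal) ≤ localGap h) : LocallyGapped (localTerm h) γ₀ where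
  proj := hh.isStarProjection
  gap S v hv := by
    have hT := isSelfAdjoint_sum_of_projections hh.isStarProjection S
    rw [← kerProj_sum_eq_groundProj hh.isStarProjection] at hv
    have h1 := mul_norm_sq_le_of_eigenvalues hT (γ := γ₀) (fun μ hμ hev => by
      have h2 : localGap h ≤ (μ : EReal) := (iInf_le _ S).trans
        (iInf_le_of_le μ (iInf_le_of_le hμ (iInf_le _ (hasEigenvalue_sum_localTerm hev))))
      exact_mod_cast hγ.trans h2) hv
    rw [_root_.sum_apply, inner_sum, Complex.re_sum,
      Finset.sum_congr rfl fun p _ => inner_starProjection_re (hh.isStarProjection p) v] at h1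
    exact h1
  degree_le p S hS := by
    have h1 : ∀ q ∈ S, plaquetteRow q < plaquetteRow p + 2 ∧ plaquetteRow p < plaquetteRow q + 2 ∧
        plaquetteCol q < plaquetteCol p + 2 ∧ plaquetteCol p < plaquetteCol q + 2 := by
      intro q hq
      have h2 : ¬ (plaquetteRow p + 1 < plaquetteRow q ∨ plaquetteCol p + 1 < plaquetteCol q) :=
        fun h' => hS q hq (hh.commutesAtDistance p q h')
      have h3 : ¬ (plaquetteRow q + 1 < plaquetteRow p ∨ plaquetteCol q + 1 < plaquetteCol p) :=
        fun h' => hS q hq (hh.commutesAtDistance q p h').symm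
      omega
    -- Non-commuting plaquettes lie in the three by three window around `p`.
    have h4 : S.card ≤ (Finset.range 3 ×ˢ Finset.range 3).card := by
      refine Finset.card_le_card_of_injOn
        (fun q => (plaquetteRow q + 1 - plaquetteRow p, plaquetteCol q + 1 - plaquetteCol p)) ?_ ?_
      · intro q hq
        have := h1 q hq
        simp only [Finset.coe_product, Finset.coe_range, Set.mem_prod, Set.mem_Iio]
        omega
      · intro q hq q' hq' heq
        have e1 := h1 q hq
        have e2 := h1 q' hq'
        simp only [Prod.mk.injEq] at heq
        refine injective_plaquetteRow_plaquetteCol (Prod.ext ?_ ?_)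
        · change plaquetteRow q = plaquetteRow q'; omega
        · change plaquetteCol q = plaquetteCol q'; omega
    simpa using h4

theorem LocallyGapped.mergingFamily {E ι : Type*} [NormedAddCommGroup E] [InnerProductSpace ℂ E]
    [FiniteDimensional ℂ E] [Fintype ι] {h : ι → E →L[ℂ] E} {γ : ℝ} (H : LocallyGapped h γ)
    (hγ : 0 < γ) {row : ι → ℕ} (hc : ∀ i j, row i + 1 < row j → Commute (h i) (h j)) :
    MergingFamily (fun a m => groundProj h (rowBlock row a m)) (contraction γ) where
  norm_le _ _ := norm_groundProj_le h _
  mul_left _ _ _ _ h1 h2 := groundProj_mul_of_subset h (rowBlock_subset row h1 h2)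
  mul_right _ _ _ _ h1 h2 := groundProj_mul_of_superset h (rowBlock_subset row h1 h2)
  merge a x k y := H.norm_rowBlock_merge_le hγ hc a x k y

/-- A block that contains all rows projects onto the ground state. -/
theorem IsUniqueZeroEnergyGroundState.groundProj_rowBlock (hh : IsPlaquetteProjectors h)
    {Ω : State L n d} (hΩ : IsUniqueZeroEnergyGroundState (hamiltonian h) Ω) {m : ℕ} (hm : n ≤ m) :
    groundProj (localTerm h) (rowBlock plaquetteRow 0 m) Ω = Ω ∧
      ∀ v, inner ℂ Ω v = 0 → groundProj (localTerm h) (rowBlock plaquetteRow 0 m) v = 0 := by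
  have h0 : rowBlock plaquetteRow 0 m = ((Finset.univ : Finset (Fin (L - 1) × Fin n)) :
      Set (Fin (L - 1) × Fin n)) := by
    ext p
    have : p.2.val < n := p.2.2
    simp only [rowBlock, plaquetteRow, Set.mem_ofPred_eq, Finset.coe_univ, Set.mem_univ, iff_true]
    omega
  have h1 : (∑ p : Fin (L - 1) × Fin n, localTerm h p)
      = Matrix.toEuclideanCLM (n := Config L n d) (𝕜 := ℂ) (hamiltonian h) := by
    simp only [hamiltonian, map_sum, Fintype.sum_prod_type]; rfl
  have h2 : LinearMap.ker ((∑ p : Fin (L - 1) × Fin n, localTerm h p :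
      State L n d →L[ℂ] State L n d) : State L n d →ₗ[ℂ] State L n d) = Submodule.span ℂ {Ω} := by
    rw [h1, Matrix.coe_toEuclideanCLM_eq_toEuclideanLin]
    exact hΩ.2
  have h3 : groundProj (localTerm h) (rowBlock plaquetteRow 0 m)
      = (Submodule.span ℂ {Ω}).starProjection := by
    rw [h0, ← kerProj_sum_eq_groundProj hh.isStarProjection]
    simp only [kerProj, h2]
  rw [h3]
  refine ⟨Submodule.starProjection_eq_self_iff.2 (Submodule.mem_span_singleton_self Ω),
    fun v hv => ?_⟩
  rw [Submodule.starProjection_apply_eq_zero_iff]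
  exact Submodule.mem_orthogonal_singleton_iff_inner_right.2 hv

theorem IsPlaquetteProjectors.localTerm_mem_left (hh : IsPlaquetteProjectors h)
    {p : Fin (L - 1) × Fin n} {c : ℕ} (hp : plaquetteCol p + 1 < c) :
    localTerm h p ∈ supportAlgebra d (leftSites L n c) := by
  refine supportAlgebra_mono ?_ (hh.supportedOn p).mem_supportAlgebra
  intro s hs
  simp only [plaquette, Set.mem_ofPred_eq] at hs
  simp only [leftSites, Set.mem_ofPred_eq]
  omega

theorem IsPlaquetteProjectors.localTerm_mem_right (hh : IsPlaquetteProjectors h)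
    {p : Fin (L - 1) × Fin n} {c : ℕ} (hp : c ≤ plaquetteCol p) :
    localTerm h p ∈ supportAlgebra d (leftSites L n c)ᶜ := by
  refine supportAlgebra_mono ?_ (hh.supportedOn p).mem_supportAlgebra
  intro s hs
  simp only [plaquette, Set.mem_ofPred_eq] at hs
  simp only [leftSites, Set.mem_compl_iff, Set.mem_ofPred_eq]
  omega

theorem productSet_mono {A : Type*} [Ring A] [Algebra ℂ A] {S S' T T' : Subalgebra ℂ A}
    (hS : S ≤ S') (hT : T ≤ T') : productSet S T ⊆ productSet S' T' := by
  rintro _ ⟨a, ha, b, hb, rfl⟩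
  exact ⟨a, hS ha, b, hT hb, rfl⟩

/-- At most two of the four sites of a straddling plaquette lie left of the cut, which gives `d ^ (2
* 2)` products. -/
theorem IsPlaquetteProjectors.sumLE_localTerm (hh : IsPlaquetteProjectors h) (hd : 1 ≤ d)
    {p : Fin (L - 1) × Fin n} {c : ℕ} (hp : plaquetteCol p + 1 = c) :
    SumLE (productSet (supportAlgebra d (leftSites L n c)) (supportAlgebra d (leftSites L n c)ᶜ))
      (d ^ 4) (localTerm h p) := by
  set P := plaquette L n (plaquetteCol p) (plaquetteRow p)
  set Y := P ∩ leftSites L n c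
  set Z := P ∩ (leftSites L n c)ᶜ
  have hYZ : Disjoint Y Z := Set.disjoint_left.2 fun s h1 h2 => h2.2 h1.2
  have hU : Y ∪ Z = P := Set.inter_union_compl P _
  have hY : ∀ s : Y, s.1.1.val = plaquetteCol p ∧
      (s.1.2.val = plaquetteRow p ∨ s.1.2.val = plaquetteRow p + 1) := by
    intro s
    have hs := s.2.1
    have hs' := s.2.2
    simp only [P, plaquette, leftSites, Set.mem_ofPred_eq] at hs hs'
    exact ⟨by omega, by omega⟩
  have hcard : Nat.card Y ≤ 2 := by
    have := Nat.card_le_card_of_injective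
      (fun s : Y => (⟨s.1.2.val - plaquetteRow p, by have := (hY s).2; omega⟩ : Fin 2)) (by
        intro s t hst
        have e1 := hY s
        have e2 := hY t
        simp only [Fin.mk.injEq] at hst
        exact Subtype.ext (Prod.ext (Fin.ext (by omega)) (Fin.ext (by omega))))
    simpa using this
  have h1 := SupportedOn.sumLE_productSet hYZ (M := h p.1 p.2) (by
    rw [hU]; exact hh.supportedOn p) hcard hd
  exact h1.mono (productSet_mono (supportAlgebra_mono Set.inter_subset_right)
    (supportAlgebra_mono Set.inter_subset_right)) le_rfl

/-- Letter `s` consists of the plaquettes on site columns `e + s - 1` and `e + s`, so it alone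
straddles the cut at `e + s`; there is at most one such plaquette per row. -/
theorem IsPlaquetteProjectors.letterCut (hh : IsPlaquetteProjectors h) (hd : 1 ≤ d)
    (e w a m : ℕ) {s : ℕ} (hs : s ∈ Finset.Icc 1 w) :
    LetterCut (supportAlgebra d (leftSites L n (e + s)))
      (supportAlgebra d (leftSites L n (e + s))ᶜ) w s (m * d ^ 4)
      (stripLetter plaquetteRow plaquetteCol (localTerm h) e w a m) := by
  classical
  have hs := Finset.mem_Icc.1 hs
  refine ⟨fun i hi => ?_, fun i hi hiw => ?_, ?_⟩
  · rw [stripLetter]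
    split_ifs with h1 h2
    · refine Subalgebra.sum_mem _ fun j _ => Subalgebra.sub_mem _ (Subalgebra.one_mem _) ?_
      refine groundProj_mem_subalgebra hh.isStarProjection fun p hp => hh.localTerm_mem_left ?_
      have := hp.2
      omega
    · omega
    · refine Subalgebra.sum_mem _ fun p hp => hh.localTerm_mem_left ?_
      have := (Finset.mem_filter.1 hp).2.2
      omega
  · rw [stripLetter, if_neg (by omega)]
    split_ifs with h2
    · refine Subalgebra.sum_mem _ fun j _ => Subalgebra.sub_mem _ (Subalgebra.one_mem _) ?_
      refine groundProj_mem_subalgebra hh.isStarProjection fun p hp => hh.localTerm_mem_right ?_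
      have := hp.2
      omega
    · refine Subalgebra.sum_mem _ fun p hp => hh.localTerm_mem_right ?_
      have := (Finset.mem_filter.1 hp).2.2
      omega
  · rw [stripLetter, if_neg (by omega), if_neg (by omega)]
    refine (SumLE.sum _ (fun _ => d ^ 4) _ fun p hp => hh.sumLE_localTerm hd
      (Finset.mem_filter.1 hp).2.2).mono subset_rfl ?_
    rw [Finset.sum_const, smul_eq_mul]
    refine Nat.mul_le_mul_right _ ?_
    refine (Finset.card_le_card_of_injOn plaquetteRow (t := Finset.Ico a (a + m)) ?_ ?_).trans
      (by simp)
    · intro p hp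
      exact Finset.mem_coe.2 (Finset.mem_Ico.2 (Finset.mem_filter.1 hp).2.1)
    · intro p hp q hq hpq
      have h1 := (Finset.mem_filter.1 hp).2.2
      have h2 := (Finset.mem_filter.1 hq).2.2
      refine injective_plaquetteRow_plaquetteCol (Prod.ext hpq ?_)
      change plaquetteCol p = plaquetteCol q
      omega

/-- Moving the vertical cut within a strip of width `w`. -/
theorem sumLE_productVectors_of_cut (hd : 1 ≤ d) {e w c c' : ℕ} (hc : e ≤ c ∧ c ≤ e + w)
    (hc' : e ≤ c' ∧ c' ≤ e + w) {ψ : State L n d}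
    (hψ : ψ ∈ productVectors L n d (leftSites L n c)) :
    SumLE (productVectors L n d (leftSites L n c')) (d ^ (w * (n + 1))) ψ := by
  refine sumLE_productVectors_of_symmDiff (Z := {s | e ≤ s.1.val ∧ s.1.val < e + w}) ?_ ?_ hd hψ
  · intro s hs
    rw [Set.mem_symmDiff] at hs
    simp only [leftSites, Set.mem_ofPred_eq] at hs ⊢
    omega
  · have := Nat.card_le_card_of_injective
      (fun s : {s : Site L n | e ≤ s.1.val ∧ s.1.val < e + w} =>
        ((⟨s.1.1.val - e, by have := s.2.1; have := s.2.2; omega⟩ : Fin w), s.1.2)) (by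
        intro s t hst
        have e1 := s.2.1
        have e2 := t.2.1
        simp only [Prod.mk.injEq, Fin.mk.injEq] at hst
        exact Subtype.ext (Prod.ext (Fin.ext (by omega)) hst.2))
    simpa [Nat.card_prod] using this

/-- An operator that is a sum of `D` products across the cut `c'` multiplies the Schmidt rank
across the nearby cut `c` by at most `d ^ (w (n + 1)) * (D * d ^ (w (n + 1)))`. -/
theorem sumLE_apply_of_cut (hd : 1 ≤ d) {e w c c' : ℕ} (hc : e ≤ c ∧ c ≤ e + w)
    (hc' : e ≤ c' ∧ c' ≤ e + w) {K : State L n d →L[ℂ] State L n d} {D : ℕ}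
    (hK : SumLE (productSet (supportAlgebra d (leftSites L n c'))
      (supportAlgebra d (leftSites L n c')ᶜ)) D K) {ψ : State L n d}
    (hψ : ψ ∈ productVectors L n d (leftSites L n c)) :
    SumLE (productVectors L n d (leftSites L n c))
      (d ^ (w * (n + 1)) * (D * d ^ (w * (n + 1)))) (K ψ) := by
  refine (sumLE_productVectors_of_cut hd hc hc' hψ).bind
    (K : State L n d →ₗ[ℂ] State L n d).toAddMonoidHom fun φ hφ => ?_
  have h1 : SumLE (productVectors L n d (leftSites L n c')) D (K φ) := by
    refine hK.map (AddMonoidHom.mk' (fun T : State L n d →L[ℂ] State L n d => T φ)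
      fun _ _ => rfl) fun T hT => ?_
    exact productSet_apply_mem_productVectors hT hφ
  exact h1.bind (AddMonoidHom.id _) fun χ hχ => sumLE_productVectors_of_cut hd hc' hc hχ

end Grid

/-! ### Schmidt rank of words and the parametric entropy bound. -/

section Words

variable {L n d : ℕ} {h : Fin (L - 1) → Fin n → Op L n d}

theorem smul_mem_productVectors {X : Set (Site L n)} (r : ℂ) {ψ : State L n d}
    (hψ : ψ ∈ productVectors L n d X) : r • ψ ∈ productVectors L n d X := by
  obtain ⟨f, g, hf, hg, h⟩ := hψ
  refine ⟨fun σ => r * f σ, g, fun σ τ hστ => by simp only [hf hστ], hg, fun σ => ?_⟩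
  rw [mul_assoc, ← h]
  rfl

/-- The Schmidt rank of a word of length at most `M` across a cut inside the strip, when each
letter is a polynomial of degree at most `t` and some column of the strip is used at most `τ`
times. -/
def wordRank (n d w l t τ M : ℕ) : ℕ :=
  w * (d ^ (w * (n + 1)) * ((τ + 1) * (((τ + 1) * (t + 1) ^ 2) ^ M *
    ((t + 1) ^ 2 * (2 * l * d ^ 4)) ^ τ) * d ^ (w * (n + 1))))

/-- Each part of the word has low rank across its own light column, not across the given cut. A
product vector is therefore moved to that column and back, paying `d ^ (w (n + 1))` in each
direction. -/
theorem IsPlaquetteProjectors.sumLE_word_apply (hh : IsPlaquetteProjectors h) (hd : 1 ≤ d)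
    {e w l t τ M : ℕ} (hl : 1 ≤ l) {p : Polynomial ℂ} (hp : p.natDegree ≤ t)
    (hτ : M * t < w * (τ + 1)) {T : State L n d →L[ℂ] State L n d}
    (hT : T ∈ words (fun a => Polynomial.aeval (stripHamiltonian plaquetteRow plaquetteCol
      (localTerm h) e w a (2 * l)) p) M) {ψ : State L n d}
    (hψ : ψ ∈ productVectors L n d (leftSites L n (e + w))) :
    SumLE (productVectors L n d (leftSites L n (e + w))) (wordRank n d w l t τ M) (T ψ) := by
  obtain ⟨r, us, hus, rfl⟩ := hT
  have hD : 1 ≤ 2 * l * d ^ 4 := Nat.mul_pos (by omega) (Nat.pow_pos hd)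
  obtain ⟨K, hK, hKr⟩ := exists_light_decomposition
    (fun a => stripLetter plaquetteRow plaquetteCol (localTerm h) e w a (2 * l))
    (fun s => supportAlgebra d (leftSites L n (e + s)))
    (fun s => supportAlgebra d (leftSites L n (e + s))ᶜ)
    (fun s a ha b hb => commute_of_mem_supportAlgebra disjoint_compl_right ha hb)
    (fun a s hs => hh.letterCut hd e w a (2 * l) hs) hD hp us
    ((Nat.mul_le_mul_right t hus).trans_lt hτ)
  have h1 : (r • (us.map fun a => Polynomial.aeval (stripHamiltonian plaquetteRow plaquetteCol
      (localTerm h) e w a (2 * l)) p).prod) ψ = ∑ s ∈ Finset.Icc 1 w, K s (r • ψ) := by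
    have h2 := congrArg (fun T : State L n d →L[ℂ] State L n d => T (r • ψ)) hK
    simp only [_root_.sum_apply] at h2
    rw [← h2, map_smul]
    rfl
  rw [h1]
  refine (SumLE.sum _ (fun _ => d ^ (w * (n + 1)) * ((τ + 1) * (((τ + 1) * (t + 1) ^ 2) ^ M *
    ((t + 1) ^ 2 * (2 * l * d ^ 4)) ^ τ) * d ^ (w * (n + 1)))) _ fun s hs => ?_).mono subset_rfl ?_
  · have hs' := Finset.mem_Icc.1 hs
    refine (sumLE_apply_of_cut hd (e := e) (w := w) ⟨by omega, by omega⟩ ⟨by omega, by omega⟩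
      (hKr s hs) (smul_mem_productVectors r hψ)).mono subset_rfl ?_
    gcongr
    exact Nat.mul_pos (Nat.succ_pos _) (Nat.pow_pos (Nat.succ_pos _))
  · rw [Finset.sum_const, smul_eq_mul, Nat.card_Icc, Nat.add_sub_cancel, wordRank]

/-- The entropy bound, for any choice of the parameters of the construction. -/
theorem IsPlaquetteProjectors.entanglementEntropy_le_of_parameters (hh : IsPlaquetteProjectors h)
    {Ω : State L n d} (hΩ : IsUniqueZeroEnergyGroundState (hamiltonian h) Ω) {γ : ℝ} (hγ : 0 < γ)
    (hgap : (γ : EReal) ≤ localGap h) (hγ1 : stripGap γ ≤ 1) (hd : 1 ≤ d)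
    {c κ j l r w s q τ D : ℕ} (hκ : 3 ≤ κ) (hl : 1 ≤ l) (hw : 1 ≤ w) (hwc : w ≤ c)
    (hs : (2 * l * (w + 2) : ℕ) ≤ s ^ 2 * stripGap γ)
    (hj : ∀ i < j, 64 * κ * contraction γ ^ (κ ^ i * l) ≤ (1 / 2) ^ (r * (2 * κ) ^ (i + 1)))
    (hn : n ≤ 2 * (κ ^ j * l)) (hτ : (4 * κ) ^ j * q * (s * (r + 4)) < w * (τ + 1))
    (hD : 16 ^ ((4 * κ) ^ j * q) * wordRank n d w l (s * (r + 4)) τ ((4 * κ) ^ j * q) ≤ D)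
    (hD2 : 2 ≤ D) (hε : 2 * D * (((1 / 2 : ℝ) ^ (r * (2 * κ) ^ j) / 16) ^ q) ^ 2 ≤ 1) :
    entanglementEntropy c Ω ≤ 8 * Real.log D := by
  have H := hh.locallyGapped hgap
  have hc := hh.commutesAtDistance
  -- The strip ends exactly at the cut, so room is needed only to its left.
  obtain ⟨e, rfl⟩ : ∃ e, c = e + w := ⟨c - w, by omega⟩
  have hnt : Nontrivial (State L n d) := by
    refine ⟨⟨Ω, 0, fun h0 => ?_⟩⟩
    have := hΩ.1
    rw [h0, norm_zero] at this
    exact zero_ne_one this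
  obtain ⟨p, hp, hA⟩ := H.exists_polynomial_hasApprox hγ hc injective_plaquetteRow_plaquetteCol hw
    hl e r hγ1 hs
  have hG := H.mergingFamily hγ fun i j hij => hc i j (Or.inl hij)
  obtain ⟨N, hN1, hN, hAj⟩ := hA.iterate hG hκ j hj
  -- The block starting at row `0` contains all rows by `hn`, so its ground projection is that onto
  -- `Ω`.
  obtain ⟨x, hx, hxG, hGx, hxn⟩ := hAj 0
  obtain ⟨hGΩ, hGo⟩ := hΩ.groundProj_rowBlock hh hn
  set G := groundProj (localTerm h) (rowBlock plaquetteRow 0 (2 * (κ ^ j * l))) with hGdef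
  have hsa : ContinuousLinearMap.adjoint G = G := ContinuousLinearMap.isSelfAdjoint_iff'.1
    (groundProj_isStarProjection (localTerm h) _).isSelfAdjoint
  change x * G = G at hxG
  change G * x = G at hGx
  change ‖x - G‖ ≤ _ at hxn
  clear_value G
  set δ : ℝ := (1 / 2) ^ (r * (2 * κ) ^ j) / 16
  have hδ : 0 ≤ δ := by positivity
  have hxΩ : x Ω = Ω := by
    have := congrArg (fun T : State L n d →L[ℂ] State L n d => T Ω) hxG
    simpa [hGΩ] using this
  have hortho : ∀ v, inner ℂ Ω v = 0 → inner ℂ Ω (x v) = 0 := by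
    intro v hv
    have h1 : G (x v) = 0 := by
      rw [← mul_apply_eq_comp, hGx]; exact hGo v hv
    calc inner ℂ Ω (x v) = inner ℂ (G Ω) (x v) := by rw [hGΩ]
      _ = inner ℂ Ω (G (x v)) := by
        rw [← ContinuousLinearMap.adjoint_inner_left G, hsa]
      _ = 0 := by rw [h1, inner_zero_right]
  have hshrink : ∀ v, inner ℂ Ω v = 0 → ‖x v‖ ≤ δ * ‖v‖ := by
    intro v hv
    have h1 := (x - G).le_of_opNorm_le hxn v
    rwa [sub_apply, hGo v hv, sub_zero] at h1
  have hpow : ∀ q : ℕ, (x ^ q) Ω = Ω ∧ ∀ v, inner ℂ Ω v = 0 →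
      inner ℂ Ω ((x ^ q) v) = 0 ∧ ‖(x ^ q) v‖ ≤ δ ^ q * ‖v‖ := by
    intro q
    induction q with
    | zero => exact ⟨by simp, fun v hv => ⟨by simpa using hv, by simp⟩⟩
    | succ q ih =>
      have hs : ∀ v, (x ^ (q + 1)) v = x ((x ^ q) v) := fun v => by rw [pow_succ']; rfl
      refine ⟨by rw [hs, ih.1, hxΩ], fun v hv => ?_⟩
      obtain ⟨h1, h2⟩ := ih.2 v hv
      refine ⟨by rw [hs]; exact hortho _ h1, ?_⟩
      rw [hs, pow_succ', mul_assoc]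
      exact (hshrink _ h1).trans (mul_le_mul_of_nonneg_left h2 hδ)
  refine entanglementEntropy_le_of_approximate_projection (e + w) hΩ.1 (x ^ q) (hpow q).1
    (fun v hv => ((hpow q).2 v hv).1) (fun v hv => ((hpow q).2 v hv).2) (by positivity) hD2
    (fun ψ hψ => ?_) hε
  have hq := hx.pow_words q
  have h1 : SumLE (productVectors L n d (leftSites L n (e + w)))
      (N ^ q * wordRank n d w l (s * (r + 4)) τ ((4 * κ) ^ j * q)) ((x ^ q) ψ) := by
    refine hq.bind (AddMonoidHom.mk' (fun T : State L n d →L[ℂ] State L n d => T ψ)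
      fun _ _ => rfl) fun T hT => ?_
    exact hh.sumLE_word_apply hd hl hp hτ hT hψ
  refine h1.mono subset_rfl (le_trans (Nat.mul_le_mul_right _ ?_) hD)
  rw [pow_mul]
  exact Nat.pow_le_pow_left (by omega) q

end Words

/-! ### Choice of parameters and asymptotics. -/

section Parameters

/-- The scale `κ ≈ exp ((log n) ^ (4 / 5))` and the depth `j ≈ (log n) ^ (1 / 5)` of the
recursion, with the inequalities that the construction needs. -/
structure ScaleAndDepth (a d₀ : ℕ) (g : ℝ) (n κ j : ℕ) : Prop where
  ten_le : 10 ≤ κ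
  le_pow : n ≤ κ ^ j
  le : κ ≤ n
  four_pow_le : 4 ^ j ≤ n
  pow_le : κ ^ j ≤ n ^ 2
  sixteen_le : 16 ≤ n
  dim_le : d₀ ≤ n
  const_le : 4 * a * d₀ ^ 4 ≤ n
  gap_le : 8 * a * 2 ^ j ≤ (κ : ℝ) ^ 2 * g
  log_le : 73 * 2 ^ j * Real.log n ≤ κ
  bound : 584 * ((4 * κ) ^ j * κ ^ 9 : ℕ) * Real.log n
    ≤ (n : ℝ) ^ (1 + 13 * Real.log n ^ (-(1 / 5) : ℝ))
  trivial_bound : (κ : ℝ) ^ 8 * (n + 1) * d₀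
    ≤ (n : ℝ) ^ (1 + 13 * Real.log n ^ (-(1 / 5) : ℝ))

-- With `x = (log n) ^ (1/5)`, `κ = ⌈exp (x⁴)⌉` and `j = ⌈x⌉`, the product `κ ^ j` exceeds `n = exp
-- (x⁵)` by a factor of only `exp (O(x⁴))`. Since `x⁴ = x⁵ / x`, every factor `exp (O(x⁴))` is `n ^
-- O((log n) ^ (-1/5))`. The factors `2 ^ j` and `log n` are polynomial in `exp x`, hence negligible
-- against `κ`.
set_option maxHeartbeats 1000000 in
theorem exists_scaleAndDepth (a d₀ : ℕ) {g : ℝ} (hg : 0 < g) :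
    ∃ n₀ : ℕ, ∀ n ≥ n₀, ∃ κ j : ℕ, ScaleAndDepth a d₀ g n κ j := by
  -- A common lower bound to be imposed on `Z = exp x`. The value `70080 = 584 * 120` serves `584 x⁵
  -- ≤ Z²` via `x⁵ ≤ 5! Z`.
  set C₀ : ℝ := 70080 + 24 * a / g + d₀ + 4 * a * d₀ ^ 4 with hC₀
  have hC₀1 : 70080 ≤ C₀ := by
    have : 0 ≤ 24 * a / g := by positivity
    have : (0:ℝ) ≤ 4 * a * d₀ ^ 4 := by positivity
    have : (0:ℝ) ≤ d₀ := by positivity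
    linarith
  set x₀ : ℝ := max 2 (Real.log C₀)
  refine ⟨⌈Real.exp (x₀ ^ 5)⌉₊, fun n hn => ?_⟩
  have hnx : Real.exp (x₀ ^ 5) ≤ n := (Nat.le_ceil _).trans (by exact_mod_cast hn)
  have hn0 : (0:ℝ) < n := (Real.exp_pos _).trans_le hnx
  have hx₀ : 2 ≤ x₀ := le_max_left _ _
  have hlog : x₀ ^ 5 ≤ Real.log n := by rwa [Real.le_log_iff_exp_le hn0]
  have hlog0 : 0 ≤ Real.log n := le_trans (by positivity) hlog
  set x : ℝ := Real.log n ^ (1 / 5 : ℝ) with hx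
  have hx5 : x ^ 5 = Real.log n := by
    rw [hx, ← Real.rpow_natCast, ← Real.rpow_mul hlog0]; norm_num
  have hx0 : 0 ≤ x := Real.rpow_nonneg hlog0 _
  have hxx : x₀ ≤ x := by
    rw [← hx5] at hlog
    exact le_of_pow_le_pow_left₀ (by norm_num) hx0 hlog
  have hx2 : 2 ≤ x := hx₀.trans hxx
  have hnexp : (n : ℝ) = Real.exp (x ^ 5) := by rw [hx5, Real.exp_log hn0]
  have hrhs : (n : ℝ) ^ (1 + 13 * Real.log n ^ (-(1 / 5) : ℝ)) = Real.exp (x ^ 5 + 13 * x ^ 4) := by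
    rw [Real.rpow_neg hlog0, ← hx, Real.rpow_def_of_pos hn0, ← hx5]
    congr 1
    field_simp
  set Z := Real.exp x with hZ
  have hZC : C₀ ≤ Z := by
    have : Real.log C₀ ≤ x := (le_max_right _ _).trans hxx
    rwa [Real.log_le_iff_le_exp (by linarith)] at this
  have hZ1 : 70080 ≤ Z := hC₀1.trans hZC
  have hZ0 : 0 < Z := by linarith
  have hZg : 24 * a ≤ Z * g := by
    have h1 : 24 * a / g ≤ Z := by
      have : (0:ℝ) ≤ 4 * a * d₀ ^ 4 := by positivity
      have : (0:ℝ) ≤ d₀ := by positivity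
      linarith
    rwa [div_le_iff₀ hg] at h1
  have hZd : (d₀ : ℝ) ≤ Z := by
    have : 0 ≤ 24 * a / g := by positivity
    have : (0:ℝ) ≤ 4 * a * d₀ ^ 4 := by positivity
    linarith
  have hZa : 4 * a * d₀ ^ 4 ≤ Z := by
    have : 0 ≤ 24 * a / g := by positivity
    have : (0:ℝ) ≤ d₀ := by positivity
    linarith
  have hx3 : 4 ≤ x ^ 2 := by nlinarith
  have hx4 : 8 * x ≤ x ^ 4 := by nlinarith [mul_le_mul hx3 hx3 (by norm_num) (by positivity)]
  have hx45 : 2 * x ^ 4 ≤ x ^ 5 := by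
    have : x ^ 5 = x * x ^ 4 := by ring
    rw [this]; gcongr
  have hfact : x ^ 5 ≤ 120 * Z := by
    have := Real.pow_div_factorial_le_exp x hx0 5
    rw [div_le_iff₀ (by positivity)] at this
    norm_num [Nat.factorial] at this
    linarith
  have he : (2:ℝ) ≤ Real.exp 1 := by linarith [Real.exp_one_gt_d9]
  have he3 : Real.exp 1 ≤ 3 := by linarith [Real.exp_one_lt_d9]
  set y := Real.exp (x ^ 4)
  have hy1 : 1 ≤ y := Real.one_le_exp (by positivity)
  set κ := ⌈y⌉₊
  have hκy : y ≤ κ := Nat.le_ceil y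
  have hκe : (κ : ℝ) ≤ Real.exp (1 + x ^ 4) := by
    have h1 : (κ : ℝ) < y + 1 := Nat.ceil_lt_add_one (by positivity)
    rw [Real.exp_add]
    have : 2 * y ≤ Real.exp 1 * y := by gcongr
    linarith
  have hyZ : Z ^ 8 ≤ y := by
    rw [hZ, ← Real.exp_nat_mul]
    exact Real.exp_le_exp.2 (by exact_mod_cast hx4)
  have hZpow : ∀ k ≤ 8, Z ^ k ≤ κ := fun k hk =>
    (pow_le_pow_right₀ (by linarith) hk).trans (hyZ.trans hκy)
  set j := ⌈x⌉₊
  have hjx : x ≤ j := Nat.le_ceil x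
  have hjx1 : (j : ℝ) ≤ x + 1 := (Nat.ceil_lt_add_one hx0).le
  have h2j : (2:ℝ) ^ j ≤ Real.exp (x + 1) := by
    calc (2:ℝ) ^ j ≤ Real.exp 1 ^ j := by gcongr
      _ = Real.exp j := by rw [← Real.exp_nat_mul]; simp
      _ ≤ _ := Real.exp_le_exp.2 hjx1
  have h2jZ : (2:ℝ) ^ j ≤ 3 * Z := by
    refine h2j.trans ?_
    rw [Real.exp_add, mul_comm]
    gcongr
  have h4j : (4:ℝ) ^ j ≤ Real.exp (2 * x + 2) := by
    calc (4:ℝ) ^ j = 2 ^ j * 2 ^ j := by rw [← mul_pow]; norm_num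
      _ ≤ Real.exp (x + 1) * Real.exp (x + 1) := by gcongr
      _ = Real.exp (2 * x + 2) := by rw [← Real.exp_add]; ring_nf
  have hκj : (κ : ℝ) ^ j ≤ Real.exp ((1 + x ^ 4) * (x + 1)) := by
    calc (κ : ℝ) ^ j ≤ Real.exp (1 + x ^ 4) ^ j := by gcongr
      _ = Real.exp ((1 + x ^ 4) * j) := by rw [← Real.exp_nat_mul]; ring_nf
      _ ≤ _ := Real.exp_le_exp.2 (by gcongr)
  have hκk : ∀ k : ℕ, (κ : ℝ) ^ k ≤ Real.exp (k * (1 + x ^ 4)) := by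
    intro k
    rw [Real.exp_nat_mul]
    gcongr
  have hZn : Z ≤ n := by
    rw [hnexp]
    exact Real.exp_le_exp.2 (by linarith)
  refine ⟨κ, j, ?_, ?_, ?_, ?_, ?_, ?_, ?_, ?_, ?_, ?_, ?_, ?_⟩
  · have := hZpow 1 (by norm_num)
    rw [pow_one] at this
    have : (10:ℝ) ≤ κ := by linarith
    exact_mod_cast this
  · have : (n : ℝ) ≤ (κ : ℝ) ^ j := by
      calc (n : ℝ) = Real.exp (x * x ^ 4) := by rw [hnexp]; ring_nf
        _ ≤ Real.exp (j * x ^ 4) := Real.exp_le_exp.2 (by gcongr)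
        _ = y ^ j := Real.exp_nat_mul _ _
        _ ≤ _ := by gcongr
    exact_mod_cast this
  · have : (κ : ℝ) ≤ n := by
      rw [hnexp]
      exact hκe.trans (Real.exp_le_exp.2 (by linarith))
    exact_mod_cast this
  · have : (4:ℝ) ^ j ≤ n := by
      rw [hnexp]
      exact h4j.trans (Real.exp_le_exp.2 (by linarith))
    exact_mod_cast this
  · have : (κ : ℝ) ^ j ≤ (n : ℝ) ^ 2 := by
      rw [hnexp, ← Real.exp_nat_mul]
      refine hκj.trans (Real.exp_le_exp.2 ?_)
      have : (1 + x ^ 4) * (x + 1) = x ^ 5 + x ^ 4 + x + 1 := by ring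
      push_cast
      linarith
    exact_mod_cast this
  · have : (16:ℝ) ≤ n := by linarith
    exact_mod_cast this
  · exact_mod_cast hZd.trans hZn
  · exact_mod_cast hZa.trans hZn
  · have h1 : Z ^ 2 ≤ (κ : ℝ) ^ 2 := by
      have h2 := hZpow 1 (by norm_num)
      rw [pow_one] at h2
      gcongr
    calc 8 * a * 2 ^ j ≤ 8 * a * (3 * Z) := by gcongr
      _ = 24 * a * Z := by ring
      _ ≤ Z * g * Z := by gcongr
      _ = Z ^ 2 * g := by ring
      _ ≤ (κ : ℝ) ^ 2 * g := by gcongr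
  · rw [← hx5]
    calc 73 * 2 ^ j * x ^ 5 ≤ 73 * (3 * Z) * (120 * Z) := by gcongr
      _ = 26280 * Z ^ 2 := by ring
      _ ≤ Z * Z ^ 2 := by gcongr; linarith
      _ = Z ^ 3 := by ring
      _ ≤ κ := hZpow 3 (by norm_num)
  · rw [hrhs, ← hx5]
    have h1 : 584 * x ^ 5 ≤ Real.exp (2 * x) := by
      calc 584 * x ^ 5 ≤ 584 * (120 * Z) := by gcongr
        _ = 70080 * Z := by ring
        _ ≤ Z * Z := by gcongr
        _ = Real.exp (2 * x) := by rw [hZ, ← Real.exp_add]; ring_nf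
    calc 584 * (((4 * κ) ^ j * κ ^ 9 : ℕ) : ℝ) * x ^ 5
        = (584 * x ^ 5) * ((4 : ℝ) ^ j * (κ : ℝ) ^ j * (κ : ℝ) ^ 9) := by
          push_cast; rw [mul_pow]; ring
      _ ≤ Real.exp (2 * x) * (Real.exp (2 * x + 2) * Real.exp ((1 + x ^ 4) * (x + 1))
          * Real.exp ((9 : ℕ) * (1 + x ^ 4))) := by
          gcongr
          exact hκk 9
      _ = Real.exp (2 * x + (2 * x + 2 + (1 + x ^ 4) * (x + 1) + (9 : ℕ) * (1 + x ^ 4))) := by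
          simp only [← Real.exp_add]
      _ ≤ _ := Real.exp_le_exp.2 (by
          have : (1 + x ^ 4) * (x + 1) = x ^ 5 + x ^ 4 + x + 1 := by ring
          push_cast
          linarith)
  · rw [hrhs]
    have h1 : (n : ℝ) + 1 ≤ Real.exp (1 + x ^ 5) := by
      rw [Real.exp_add, ← hnexp]
      have : 2 * (n : ℝ) ≤ Real.exp 1 * n := by gcongr
      linarith
    calc (κ : ℝ) ^ 8 * (n + 1) * d₀
        ≤ Real.exp ((8 : ℕ) * (1 + x ^ 4)) * Real.exp (1 + x ^ 5) * Real.exp x := by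
          gcongr
          exact hκk 8
      _ = Real.exp ((8 : ℕ) * (1 + x ^ 4) + (1 + x ^ 5) + x) := by
          simp only [← Real.exp_add]
      _ ≤ _ := Real.exp_le_exp.2 (by push_cast; linarith)

namespace ScaleAndDepth

variable {a d₀ n κ j : ℕ} {g : ℝ}

/-- At level `i` the overlap is `κ ^ i * l`. The factor `2 ^ (j + 1)` in `l` makes it dominate the
growth `2 ^ (i + 1)` of the error exponent, with a factor of two to spare that absorbs `64 κ`. -/
theorem contraction_le (P : ScaleAndDepth a d₀ g n κ j) {θ : ℝ} (hθ0 : 0 ≤ θ)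
    (hθ : θ ^ a ≤ 1 / 2) {i : ℕ} (hi : i < j) :
    64 * κ * θ ^ (κ ^ i * (a * 2 ^ (j + 1) * κ ^ 2)) ≤ (1 / 2) ^ (κ * (2 * κ) ^ (i + 1)) := by
  have hκ := P.ten_le
  set E := κ * (2 * κ) ^ (i + 1) with hE
  have h1 : 2 * E ≤ κ ^ i * 2 ^ (j + 1) * κ ^ 2 := by
    have h2 : 2 * E = κ ^ i * 2 ^ (i + 2) * κ ^ 2 := by rw [hE, mul_pow]; ring
    rw [h2]
    exact Nat.mul_le_mul_right _ (Nat.mul_le_mul_left _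
      (Nat.pow_le_pow_right (by norm_num) (by omega)))
  have h64 : ∀ m : ℕ, 10 ≤ m → 64 * m ≤ 2 ^ m := by
    intro m hm
    induction m, hm using Nat.le_induction with
    | base => norm_num
    | succ m hm ih => rw [pow_succ]; omega
  have hκE : κ ≤ E := Nat.le_mul_of_pos_right _ (Nat.pow_pos (by omega))
  have h3 : (64 * κ : ℝ) ≤ 2 ^ E := by
    have := (h64 κ hκ).trans (Nat.pow_le_pow_right (by norm_num) hκE)
    exact_mod_cast this
  calc 64 * κ * θ ^ (κ ^ i * (a * 2 ^ (j + 1) * κ ^ 2))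
      = 64 * κ * (θ ^ a) ^ (κ ^ i * 2 ^ (j + 1) * κ ^ 2) := by
        rw [← pow_mul]; congr 2; ring
    _ ≤ 2 ^ E * (1 / 2) ^ (κ ^ i * 2 ^ (j + 1) * κ ^ 2) := by gcongr
    _ ≤ 2 ^ E * (1 / 2) ^ (2 * E) := by
        gcongr ?_ * ?_
        exact pow_le_pow_of_le_one (by norm_num) (by norm_num) h1
    _ = (1 / 2) ^ E := by
        rw [two_mul, pow_add, ← mul_assoc, ← mul_pow]; norm_num

theorem gap_condition (P : ScaleAndDepth a d₀ g n κ j) :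
    ((2 * (a * 2 ^ (j + 1) * κ ^ 2) * (κ ^ 8 + 2) : ℕ) : ℝ) ≤ ((κ ^ 6 : ℕ) : ℝ) ^ 2 * g := by
  have hκ : (2:ℝ) ≤ κ := by exact_mod_cast le_trans (by norm_num) P.ten_le
  have h1 : (2:ℝ) ≤ (κ : ℝ) ^ 8 := hκ.trans (le_self_pow₀ (by linarith) (by norm_num))
  push_cast
  calc 2 * ((a : ℝ) * 2 ^ (j + 1) * κ ^ 2) * (κ ^ 8 + 2)
      ≤ 2 * ((a : ℝ) * 2 ^ (j + 1) * κ ^ 2) * (κ ^ 8 + κ ^ 8) := by gcongr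
    _ = 8 * a * 2 ^ j * (κ : ℝ) ^ 10 := by ring
    _ ≤ (κ : ℝ) ^ 2 * g * (κ : ℝ) ^ 10 := by gcongr ?_ * _; exact P.gap_le
    _ = _ := by ring

/-- The degree `t` is below the strip width `w`, so a word of length `M` uses some column fewer than
`M` times on average and `τ = M` is admissible. -/
theorem degree_le (P : ScaleAndDepth a d₀ g n κ j) : κ ^ 6 * (κ + 4) + 1 ≤ κ ^ 8 := by
  have hκ := P.ten_le
  have h1 : 1 ≤ κ ^ 6 := Nat.one_le_pow _ _ (by omega)
  calc κ ^ 6 * (κ + 4) + 1 ≤ κ ^ 6 * (κ + 5) := by linarith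
    _ ≤ κ ^ 6 * (κ * κ) := by gcongr; nlinarith
    _ = κ ^ 8 := by ring

theorem wordRank_le (P : ScaleAndDepth a d₀ g n κ j) {d : ℕ} (hd : d ≤ d₀) :
    16 ^ ((4 * κ) ^ j * κ ^ 9) * wordRank n d (κ ^ 8) (a * 2 ^ (j + 1) * κ ^ 2)
      (κ ^ 6 * (κ + 4)) ((4 * κ) ^ j * κ ^ 9) ((4 * κ) ^ j * κ ^ 9)
      ≤ n ^ (73 * ((4 * κ) ^ j * κ ^ 9)) := by
  have hκ := P.ten_le
  have hn := P.sixteen_le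
  have hκn := P.le
  set M := (4 * κ) ^ j * κ ^ 9 with hM
  have hM1 : 1 ≤ M := Nat.mul_pos (Nat.pow_pos (by omega)) (Nat.pow_pos (by omega))
  have hMn : M ≤ n ^ 12 := by
    calc M = 4 ^ j * κ ^ j * κ ^ 9 := by rw [hM, mul_pow]
      _ ≤ n * n ^ 2 * n ^ 9 :=
        Nat.mul_le_mul (Nat.mul_le_mul P.four_pow_le P.pow_le) (Nat.pow_le_pow_left hκn 9)
      _ = n ^ 12 := by ring
  have hM13 : M + 1 ≤ n ^ 13 := by
    have : 1 ≤ n ^ 12 := Nat.one_le_pow _ _ (by omega)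
    calc M + 1 ≤ n ^ 12 * 2 := by omega
      _ ≤ n ^ 12 * n := by gcongr; omega
      _ = n ^ 13 := by ring
  have hW : κ ^ 8 * (n + 1) ≤ M := by
    calc κ ^ 8 * (n + 1) ≤ κ ^ 8 * (κ * n) := by gcongr; nlinarith
      _ = n * κ ^ 9 := by ring
      _ ≤ κ ^ j * κ ^ 9 := by gcongr; exact P.le_pow
      _ ≤ (4 * κ) ^ j * κ ^ 9 := by gcongr; omega
  have hdn : d ≤ n := hd.trans P.dim_le
  have hdW : d ^ (κ ^ 8 * (n + 1)) ≤ n ^ M :=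
    (Nat.pow_le_pow_left hdn _).trans (Nat.pow_le_pow_right (by omega) hW)
  have ht : κ ^ 6 * (κ + 4) + 1 ≤ n ^ 8 := P.degree_le.trans (Nat.pow_le_pow_left hκn 8)
  have hl : 2 * (a * 2 ^ (j + 1) * κ ^ 2) * d ^ 4 ≤ n ^ 4 := by
    calc 2 * (a * 2 ^ (j + 1) * κ ^ 2) * d ^ 4 = (4 * a * d ^ 4) * 2 ^ j * κ ^ 2 := by ring
      _ ≤ (4 * a * d₀ ^ 4) * 4 ^ j * n ^ 2 := by gcongr; norm_num
      _ ≤ n * n * n ^ 2 :=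
        Nat.mul_le_mul_right _ (Nat.mul_le_mul P.const_le P.four_pow_le)
      _ = n ^ 4 := by ring
  calc 16 ^ M * wordRank n d (κ ^ 8) (a * 2 ^ (j + 1) * κ ^ 2) (κ ^ 6 * (κ + 4)) M M
      ≤ n ^ M * (n ^ 8 * (n ^ M * (n ^ 13 * ((n ^ 13 * (n ^ 8) ^ 2) ^ M *
          ((n ^ 8) ^ 2 * n ^ 4) ^ M) * n ^ M))) := by
        unfold wordRank
        gcongr
    -- The factors linear in `M` contribute `1 + 1 + 29 + 20 + 1 = 52`, the fixed ones `8 + 13 =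
    -- 21`; as `M ≥ 1`, the total is at most `73 M`.
    _ = n ^ (52 * M + 21) := by ring
    _ ≤ n ^ (73 * M) := Nat.pow_le_pow_right (by omega) (by omega)

/-- With `X = κ (2 κ) ^ j q`, the bound `73 · 2 ^ j log n ≤ κ` gives `D ≤ exp X ≤ 2 ^ (2 X)`, which
the squared shrinking factor cancels. The powers of `1/16` absorb the remaining `2`. -/
theorem error_le (P : ScaleAndDepth a d₀ g n κ j) :
    2 * ((n ^ (73 * ((4 * κ) ^ j * κ ^ 9)) : ℕ) : ℝ) *
      (((1 / 2 : ℝ) ^ (κ * (2 * κ) ^ j) / 16) ^ (κ ^ 9)) ^ 2 ≤ 1 := by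
  have hκ := P.ten_le
  have hn : (0:ℝ) < n := by exact_mod_cast lt_of_lt_of_le (by norm_num) P.sixteen_le
  set q := κ ^ 9
  have hq : 1 ≤ q := Nat.one_le_pow _ _ (by omega)
  set X := κ * (2 * κ) ^ j * q with hX
  have h1 : ((n ^ (73 * ((4 * κ) ^ j * q)) : ℕ) : ℝ) ≤ (2 ^ X) ^ 2 := by
    have h2 : 73 * ((4 * κ) ^ j * q : ℕ) * Real.log n ≤ X := by
      have h3 := mul_le_mul_of_nonneg_right P.log_le (show (0:ℝ) ≤ ((2 * κ) ^ j * q : ℕ) by positivity)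
      refine le_trans (le_of_eq ?_) (h3.trans (le_of_eq ?_))
      · have : (4 * κ) ^ j = 2 ^ j * (2 * κ) ^ j := by rw [← mul_pow]; ring_nf
        rw [this]; push_cast; ring
      · rw [hX]; push_cast; ring
    have he : Real.exp 1 ≤ 2 ^ 2 := by linarith [Real.exp_one_lt_d9]
    calc ((n ^ (73 * ((4 * κ) ^ j * q)) : ℕ) : ℝ)
        = Real.exp (73 * ((4 * κ) ^ j * q : ℕ) * Real.log n) := by
          rw [mul_comm _ (Real.log n), Real.exp_mul, Real.exp_log hn]
          have : (73 * ((4 * κ) ^ j * q : ℕ) : ℝ) = ((73 * ((4 * κ) ^ j * q) : ℕ) : ℝ) := by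
            push_cast; ring
          rw [this, Real.rpow_natCast]
          push_cast; rfl
      _ ≤ Real.exp X := Real.exp_le_exp.2 h2
      _ = Real.exp 1 ^ X := by rw [← Real.exp_nat_mul, mul_one]
      _ ≤ (2 ^ 2) ^ X := by gcongr
      _ = (2 ^ X) ^ 2 := by rw [← pow_mul, ← pow_mul, mul_comm]
  have h4 : ((1 / 16 : ℝ) ^ q) ^ 2 ≤ 1 / 2 := by
    rw [← pow_mul]
    calc (1 / 16 : ℝ) ^ (q * 2) ≤ (1 / 16) ^ 1 :=
          pow_le_pow_of_le_one (by norm_num) (by norm_num) (by omega)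
      _ ≤ 1 / 2 := by norm_num
  have h5 : (((1 / 2 : ℝ) ^ (κ * (2 * κ) ^ j) / 16) ^ q) ^ 2
      = ((1 / 2 : ℝ) ^ X) ^ 2 * ((1 / 16 : ℝ) ^ q) ^ 2 := by
    rw [div_eq_mul_one_div, mul_pow, mul_pow, hX, pow_mul (1 / 2 : ℝ) (κ * (2 * κ) ^ j) q]
  rw [h5]
  calc 2 * ((n ^ (73 * ((4 * κ) ^ j * q)) : ℕ) : ℝ) * (((1 / 2 : ℝ) ^ X) ^ 2 * ((1 / 16 : ℝ) ^ q) ^ 2)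
      ≤ 2 * (2 ^ X) ^ 2 * (((1 / 2 : ℝ) ^ X) ^ 2 * (1 / 2)) := by gcongr
    _ = ((2 * (1 / 2) : ℝ) ^ X) ^ 2 := by rw [mul_pow]; ring
    _ = 1 := by norm_num

end ScaleAndDepth

theorem stripGap_le_one {γ : ℝ} (hγ : 0 < γ) : stripGap γ ≤ 1 := by
  have h1 := contraction_lt_one hγ
  have h2 := contraction_pos hγ
  have h3 : 1 ≤ detectionConst γ := by
    rw [detectionConst, le_div_iff₀ (by have : 0 < 1 - contraction γ := by linarith
                                        positivity)]
    nlinarith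
  have h4 : 0 < γ⁻¹ := by positivity
  refine inv_le_one_of_one_le₀ ?_
  nlinarith [one_le_pow₀ h3 (n := 2)]

theorem card_leftSite_le (L n c : ℕ) : Fintype.card (LeftSite L n c) ≤ c * (n + 1) := by
  have := Fintype.card_le_of_injective
    (fun s : LeftSite L n c => ((⟨s.1.1.val, s.2⟩ : Fin c), s.1.2)) (by
      intro s t hst
      simp only [Prod.mk.injEq, Fin.mk.injEq] at hst
      exact Subtype.ext (Prod.ext (Fin.ext hst.1) hst.2))
  simpa using this

end Parameters

end AreaLaw2D

theorem mainTheorem1 (γ₀ : ℝ) (hγ₀ : 0 < γ₀) (d₀ : ℕ) :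
    ∃ (C : ℝ) (n₀ : ℕ), ∀ (n L d c : ℕ), n₀ ≤ n → d ≤ d₀ → 1 ≤ c → c < L →
      ∀ (h : Fin (L - 1) → Fin n → AreaLaw2D.Op L n d) (Ω : AreaLaw2D.State L n d),
        AreaLaw2D.IsPlaquetteProjectors h →
        AreaLaw2D.IsUniqueZeroEnergyGroundState (AreaLaw2D.hamiltonian h) Ω →
        (γ₀ : EReal) ≤ AreaLaw2D.localGap h →
        AreaLaw2D.entanglementEntropy c Ω
          ≤ (n : ℝ) ^ (1 + C * (Real.log (n : ℝ)) ^ (-(1 / 5) : ℝ)) := by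
  -- An overlap of `a` rows halves the merging error.
  obtain ⟨a, ha⟩ := exists_pow_lt_of_lt_one (show (0:ℝ) < 1 / 2 by norm_num)
    (AreaLaw2D.contraction_lt_one hγ₀)
  have ha1 : 1 ≤ a := by
    by_contra hcon
    have : a = 0 := by omega
    rw [this, pow_zero] at ha
    norm_num at ha
  obtain ⟨n₀, hn₀⟩ := AreaLaw2D.exists_scaleAndDepth a d₀ (AreaLaw2D.stripGap_pos hγ₀)
  refine ⟨13, n₀, fun n L d c hn hd _ hcL h Ω hh hΩ hgap => ?_⟩
  obtain ⟨κ, j, P⟩ := hn₀ n hn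
  have hκ := P.ten_le
  have hd1 : 1 ≤ d := by
    -- For `d = 0` there are no configurations, because `c < L` provides a site; then no unit vector
    -- exists.
    by_contra hcon
    obtain rfl : d = 0 := by omega
    have h0 : Ω = 0 := by
      ext σ
      exact (σ (⟨0, by omega⟩, 0)).elim0
    have h1 := hΩ.1
    rw [h0, norm_zero] at h1
    exact zero_ne_one h1
  by_cases hcw : κ ^ 8 ≤ c
  · have hM1 : 1 ≤ (4 * κ) ^ j * κ ^ 9 :=
      Nat.mul_pos (Nat.pow_pos (by omega)) (Nat.pow_pos (by omega))
    have hw : 1 ≤ κ ^ 8 := Nat.one_le_pow _ _ (by omega)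
    have hl : 1 ≤ a * 2 ^ (j + 1) * κ ^ 2 :=
      Nat.mul_pos (Nat.mul_pos ha1 (by positivity)) (Nat.pow_pos (by omega))
    -- The width `κ ^ 8` makes the Chebyshev degree `κ ^ 6 (κ + 4)` smaller than `w`. The power `q =
    -- κ ^ 9` makes the cost `w (n + 1)` of moving the cut at most the word length `M`.
    have h1 := hh.entanglementEntropy_le_of_parameters hΩ hγ₀ hgap (AreaLaw2D.stripGap_le_one hγ₀)
      hd1 (κ := κ) (j := j) (l := a * 2 ^ (j + 1) * κ ^ 2) (r := κ) (w := κ ^ 8) (s := κ ^ 6)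
      (q := κ ^ 9) (τ := (4 * κ) ^ j * κ ^ 9) (D := n ^ (73 * ((4 * κ) ^ j * κ ^ 9)))
      (by omega) hl hw hcw P.gap_condition
      (fun i hi => P.contraction_le (AreaLaw2D.contraction_pos hγ₀).le ha.le hi)
      (by nlinarith [P.le_pow, Nat.mul_le_mul_left (κ ^ j) hl])
      (by
        have := Nat.mul_le_mul_left ((4 * κ) ^ j * κ ^ 9) P.degree_le
        nlinarith)
      (P.wordRank_le hd)
      (le_trans (by have := P.sixteen_le; omega) (Nat.le_self_pow (by omega) n)) P.error_le
    refine h1.trans (le_trans (le_of_eq ?_) P.bound)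
    rw [Nat.cast_pow, Real.log_pow]
    push_cast
    ring
  -- Too close to the left edge for a strip: the logarithm of the dimension of at most `κ ^ 8`
  -- columns is already small enough.
  · refine (AreaLaw2D.entanglementEntropy_le_log_card c hΩ.1).1.trans (le_trans ?_ P.trivial_bound)
    rw [Fintype.card_fun, Fintype.card_fin, Nat.cast_pow, Real.log_pow]
    have h1 : (Fintype.card (AreaLaw2D.LeftSite L n c) : ℝ) ≤ (κ : ℝ) ^ 8 * (n + 1) := by
      have := (AreaLaw2D.card_leftSite_le L n c).trans
        (Nat.mul_le_mul_right (n + 1) (not_le.1 hcw).le)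
      exact_mod_cast this
    have h2 : Real.log d ≤ d₀ := by
      have := Real.log_le_sub_one_of_pos (show (0:ℝ) < d by exact_mod_cast hd1)
      have : (d : ℝ) ≤ d₀ := by exact_mod_cast hd
      linarith
    have h3 : 0 ≤ Real.log d := Real.log_natCast_nonneg d
    gcongr
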